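/- Consider the class of equations $$u_t+A(t)u_{xxxxx}+B(t)u_{xxx}+C(t)\,u\,u_{xxx}+E(t)\,u\,u_x+F(t)\,u_xu_{xx}+Q(t)u=0,\qquad(1)$$ where $A,B,C,E,F,Q$ are arbitrary smooth functions of $t\in I$ with $A(t)\neq0$, $C(t)\neq 0$, and let $(t,x,u)$ range over a box $I\times J\times K$, where $I,J,K\subseteq\mathbb R$ are nonempty open intervals. (a) Equivalence algebra. Consider smooth vector fields $$Y=\tau\partial_t+\xi\partial_x+\eta\partial_u+\omega^1\partial_A+\omega^2\partial_B+\omega^3\partial_C+\omega^4\partial_E+\omega^5\partial_F+\omega^6\partial_Q$$ on the augmented space ($A\ne0$, $C\neq0$), with $\tau,\xi,\eta$ depending on $(t,x,u)$ and the $\omega^i$ on $(t,x,u,A,B,C,E,F,Q)$. Such a $Y$ satisfies Lie's infinitesimal invariance criterion for the system consisting of (1) and the auxiliary equations $A_x=A_u=B_x=B_u=\dots=Q_x=Q_u=0$ if and only if it lies in the linear span of $$Y_1=x\partial_x+\tfrac12u\partial_u+5A\partial_A+3B\partial_B+\tfrac52C\partial_C+\tfrac12E\partial_E+\tfrac52F\partial_F,\qquad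 Y_2=\partial_x,$$ $$Y_\alpha=\alpha\partial_t-\alpha_t\left(A\partial_A+B\partial_B+C\partial_C+E\partial_E+F\partial_F+Q\partial_Q\right),$$ $$Y_r=ru\partial_u-rC\partial_C-rE\partial_E-rF\partial_F-r_t\partial_Q,$$ where $\alpha=\alpha(t)$ and $r=r(t)$ are arbitrary smooth functions on $I$. (b) Equivalence group. An equivalence transformation of (1) is a nondegenerate (smooth, injective, with nonvanishing Jacobian) point transformation $\Phi:(t,x,u)\mapsto(\tilde t,\tilde x,\tilde u)$ of the box such that for every equation of class (1) there is an equation of class (1), with coefficients $\tilde A(\tilde t),\dots,\tilde Q(\tilde t)$ on the range of $\tilde t$, to which $\Phi$ maps it. Here $\Phi$ maps one equation to another if, whenever a smooth function $u(t,x)$ is transformed by $\Phi$ near a point to a smooth function $\tilde u(\tilde t,\tilde x)$, $u$ satisfies the first equation at that point if and only if $\tilde u$ satisfies the second one at the corresponding point. The equivalence transformations with $\partial\tilde x/\partial x>0$ and $\partial\tilde u/\partial u>0$ are exactly $$\tilde t=\alpha(t),\qquad\tilde x=(x+k_2)e^{k_1},\qquad\tilde u=e^{r(t)k_r+k_1/2}\,u,\qquad(2)$$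 where $\alpha$, $r$ are smooth functions on $I$ with $\alpha_t\neq0$ and $k_1,k_2,k_r$ are real constants. The equivalence transformations without these sign conditions are exactly the transformations (2) followed by $(\tilde t,\tilde x,\tilde u)\mapsto(\tilde t,\pm\tilde x,\pm\tilde u)$, with independent signs. The transformation (2) maps the equation with coefficients $A,\dots,Q$ to the equation with coefficients $\tilde A,\dots,\tilde Q$ if and only if, with $\tilde A,\dots,\tilde Q$ evaluated at $\tilde t=\alpha(t)$ and $A,\dots,Q$ at $t$, for all $t\in I$ $$\tilde A=\frac{e^{5k_1}}{\alpha_t}A,\quad\tilde B=\frac{e^{3k_1}}{\alpha_t}B,\quad\tilde C=\frac{e^{\frac{5k_1}2-rk_r}}{\alpha_t}C,\quad\tilde E=\frac{e^{\frac{k_1}2-rk_r}}{\alpha_t}E,\quad\tilde F=\frac{e^{\frac{5k_1}2-rk_r}}{\alpha_t}F,\quad\tilde Q=\frac{Q-r_tk_r}{\alpha_t}.$$ (c) Normalization. Let $A,\dots,Q$ be the coefficients of an equation of class (1) and let $k_1,k_2\in\mathbb R$. An antiderivative $\int e^{5k_1}A\,dt$ exists on $I$, and for each choice of it $$\tilde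 t=\int e^{5k_1}A\,dt,\qquad\tilde x=(x+k_2)e^{k_1},\qquad\tilde u=\frac{e^{-2k_1}C}{A}\,u$$ is an equivalence transformation of (1), and it maps the given equation to an equation of the subclass with $A=C=1$, $$\tilde u_{\tilde t}+\tilde u_{\tilde x\tilde x\tilde x\tilde x\tilde x}+\tilde B\,\tilde u_{\tilde x\tilde x\tilde x}+\tilde u\,\tilde u_{\tilde x\tilde x\tilde x}+\tilde E\,\tilde u\,\tilde u_{\tilde x}+\tilde F\,\tilde u_{\tilde x}\tilde u_{\tilde x\tilde x}+\tilde Q\,\tilde u=0.$$ More precisely, the coefficients of an equation to which it maps the given one are characterized by $\tilde A=\tilde C=1$ and $$\tilde B=\frac{e^{-2k_1}B}{A},\qquad\tilde E=\frac{e^{-2k_1}E}{C},\qquad\tilde F=\frac FC,\qquad\tilde Q=\frac{e^{-5k_1}\left(Q+\left(\log\left|\frac AC\right|\right)_t\right)}{A}.$$ -/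

import Mathlib

open Set Filter Topology
open scoped ContDiff

noncomputable section

namespace FifthOrderKdV

/-- The space of the variables `(t, x, u)`. -/
abbrev Base := ℝ × ℝ × ℝ

/-- Values `(A, B, C, E, F, Q)` of the arbitrary elements, in this order (indices `0, …, 5`). -/
abbrev Coeff := Fin 6 → ℝ

/-- The box `I × J × K` in the space of `(t, x, u)`. -/
def box (I J K : Set ℝ) : Set Base := I ×ˢ (J ×ˢ K)

/-! ### The class of equations -/

/-- `∂_t` of a function of `(t, x)`. -/
def dt (u : ℝ × ℝ → ℝ) : ℝ × ℝ → ℝ := fun q => deriv (fun s => u (s, q.2)) q.1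

/-- `∂_x` of a function of `(t, x)`. -/
def dx (u : ℝ × ℝ → ℝ) : ℝ × ℝ → ℝ := fun q => deriv (fun y => u (q.1, y)) q.2

/-- The left-hand side
`u_t + A u_xxxxx + B u_xxx + C u u_xxx + E u u_x + F u_x u_xx + Q u` at the point `q = (t, x)`,
where `c = (A, B, C, E, F, Q)` are the values of the coefficients. -/
def lhs (c : Coeff) (u : ℝ × ℝ → ℝ) (q : ℝ × ℝ) : ℝ :=
  dt u q + c 0 * dx^[5] u q + c 1 * dx^[3] u q + c 2 * u q * dx^[3] u q
    + c 3 * u q * dx u q + c 4 * dx u q * dx^[2] u q + c 5 * u q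

/-- Admissible values of the coefficients: `A ≠ 0` and `C ≠ 0`. -/
def admissible : Set Coeff := {c | c 0 ≠ 0 ∧ c 2 ≠ 0}

/-- `θ = (A, …, Q)` are coefficient functions, defined for `t ∈ S`, of an equation of the class. -/
def IsClassCoeff (S : Set ℝ) (θ : ℝ → Coeff) : Prop :=
  ContDiffOn ℝ ∞ θ S ∧ ∀ t ∈ S, θ t ∈ admissible

/-- The subclass with `A = C = 1`. -/
def IsReducedCoeff (S : Set ℝ) (θ : ℝ → Coeff) : Prop :=
  IsClassCoeff S θ ∧ ∀ t ∈ S, θ t 0 = 1 ∧ θ t 2 = 1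

/-! ### Infinitesimal equivalence transformations -/

/-- Vector fields `τ ∂_t + ξ ∂_x + η ∂_u + ω¹ ∂_A + … + ω⁶ ∂_Q` on the augmented space, with
`(τ, ξ, η)` (first component) functions of `(t, x, u)` and `ω` (second component) a function of
`(t, x, u, A, …, Q)`. -/
abbrev VectorField := (Base → Base) × (Base × Coeff → Coeff)

/-- The characteristic `η - τ u_t - ξ u_x`, evaluated along a function `u(t, x)`. -/
def charac (v : Base → Base) (u : ℝ × ℝ → ℝ) : ℝ × ℝ → ℝ := fun q =>
  (v (q.1, q.2, u q)).2.2 - (v (q.1, q.2, u q)).1 * dt u q - (v (q.1, q.2, u q)).2.1 * dx u q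

/-- `ζ^t = D_t (η - τ u_t - ξ u_x) + τ u_tt + ξ u_tx`, along `u`. -/
def zetaT (v : Base → Base) (u : ℝ × ℝ → ℝ) (q : ℝ × ℝ) : ℝ :=
  dt (charac v u) q + (v (q.1, q.2, u q)).1 * dt (dt u) q
    + (v (q.1, q.2, u q)).2.1 * dx (dt u) q

/-- `ζ^J = D_x^n (η - τ u_t - ξ u_x) + τ ∂_t ∂_x^n u + ξ ∂_x^(n+1) u`, for `J = x⋯x` (`n` times),
along `u`. -/
def zetaX (v : Base → Base) (n : ℕ) (u : ℝ × ℝ → ℝ) (q : ℝ × ℝ) : ℝ :=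
  dx^[n] (charac v u) q + (v (q.1, q.2, u q)).1 * dt (dx^[n] u) q
    + (v (q.1, q.2, u q)).2.1 * dx (dx^[n] u) q

/-- The prolongation of the vector field `Y` applied to the left-hand side of the equation. -/
def prolongLhs (Y : VectorField) (c : Coeff) (u : ℝ × ℝ → ℝ) (q : ℝ × ℝ) : ℝ :=
  let η : ℝ := (Y.1 (q.1, q.2, u q)).2.2
  let w : Coeff := Y.2 ((q.1, q.2, u q), c)
  zetaT Y.1 u q
    + (w 0 * dx^[5] u q + c 0 * zetaX Y.1 5 u q)
    + (w 1 * dx^[3] u q + c 1 * zetaX Y.1 3 u q)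
    + (w 2 * u q * dx^[3] u q + c 2 * η * dx^[3] u q + c 2 * u q * zetaX Y.1 3 u q)
    + (w 3 * u q * dx u q + c 3 * η * dx u q + c 3 * u q * zetaX Y.1 1 u q)
    + (w 4 * dx u q * dx^[2] u q + c 4 * zetaX Y.1 1 u q * dx^[2] u q
        + c 4 * dx u q * zetaX Y.1 2 u q)
    + (w 5 * u q + c 5 * η)

/-- `∂_t` of a function of `(t, x, u)`. -/
def pt (f : Base → ℝ) : Base → ℝ := fun p => deriv (fun s => f (s, p.2.1, p.2.2)) p.1

/-- `∂_x` of a function of `(t, x, u)`. -/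
def px (f : Base → ℝ) : Base → ℝ := fun p => deriv (fun y => f (p.1, y, p.2.2)) p.2.1

/-- `∂_u` of a function of `(t, x, u)`. -/
def pu (f : Base → ℝ) : Base → ℝ := fun p => deriv (fun w => f (p.1, p.2.1, w)) p.2.2

/-- The characteristic `ωⁱ - τ θᵢ_t - ξ θᵢ_x - η θᵢ_u` of the arbitrary element `θᵢ`, evaluated
along functions `θ = (A, …, Q)` of `(t, x, u)`. -/
def auxCharac (Y : VectorField) (θ : Base → Coeff) (i : Fin 6) : Base → ℝ := fun p =>
  Y.2 (p, θ p) i - (Y.1 p).1 * pt (fun z => θ z i) p - (Y.1 p).2.1 * px (fun z => θ z i) p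
    - (Y.1 p).2.2 * pu (fun z => θ z i) p

/-- The coefficient of `∂/∂(θᵢ_x)` in the prolongation of `Y`, along `θ`. -/
def auxX (Y : VectorField) (θ : Base → Coeff) (i : Fin 6) (p : Base) : ℝ :=
  px (auxCharac Y θ i) p + (Y.1 p).1 * pt (px fun z => θ z i) p
    + (Y.1 p).2.1 * px (px fun z => θ z i) p + (Y.1 p).2.2 * pu (px fun z => θ z i) p

/-- The coefficient of `∂/∂(θᵢ_u)` in the prolongation of `Y`, along `θ`. -/
def auxU (Y : VectorField) (θ : Base → Coeff) (i : Fin 6) (p : Base) : ℝ :=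
  pu (auxCharac Y θ i) p + (Y.1 p).1 * pt (pu fun z => θ z i) p
    + (Y.1 p).2.1 * px (pu fun z => θ z i) p + (Y.1 p).2.2 * pu (pu fun z => θ z i) p

/-- `Y` is an infinitesimal equivalence transformation (element of the equivalence algebra) over
the domain `D` of the variables `(t, x, u)`: it is smooth, and the system formed by the equation
and the auxiliary equations `θᵢ_x = θᵢ_u = 0` satisfies Lie's infinitesimal invariance criterion,
that is, the prolongation of `Y` annihilates each equation at the points (jets, represented by
smooth functions) that satisfy the system. -/
structure IsEquivalenceGenerator (D : Set Base) (Y : VectorField) : Prop where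
  smooth_base : ContDiffOn ℝ ∞ Y.1 D
  smooth_coeff : ContDiffOn ℝ ∞ Y.2 (D ×ˢ admissible)
  invariant_eq : ∀ (u : ℝ × ℝ → ℝ) (q : ℝ × ℝ) (c : Coeff), ContDiffAt ℝ ∞ u q →
    (q.1, q.2, u q) ∈ D → c ∈ admissible → lhs c u q = 0 → prolongLhs Y c u q = 0
  invariant_aux : ∀ (θ : Base → Coeff) (p : Base), ContDiffAt ℝ ∞ θ p → p ∈ D →
    θ p ∈ admissible →
    (∀ i, px (fun z => θ z i) p = 0 ∧ pu (fun z => θ z i) p = 0) →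
    ∀ i, auxX Y θ i p = 0 ∧ auxU Y θ i p = 0

/-- `Y₁ = x ∂_x + u/2 ∂_u + 5A ∂_A + 3B ∂_B + 5/2 C ∂_C + 1/2 E ∂_E + 5/2 F ∂_F`. -/
def Y₁ : VectorField :=
  (fun p => (0, p.2.1, 1 / 2 * p.2.2),
   fun z => ![5 * z.2 0, 3 * z.2 1, 5 / 2 * z.2 2, 1 / 2 * z.2 3, 5 / 2 * z.2 4, 0])

/-- `Y₂ = ∂_x`. -/
def Y₂ : VectorField := (fun _ => (0, 1, 0), fun _ => 0)

/-- `Y_α = α ∂_t - α_t (A ∂_A + B ∂_B + C ∂_C + E ∂_E + F ∂_F + Q ∂_Q)`. -/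
def Yα (α : ℝ → ℝ) : VectorField :=
  (fun p => (α p.1, 0, 0), fun z i => -(deriv α z.1.1 * z.2 i))

/-- `Y_r = r u ∂_u - r C ∂_C - r E ∂_E - r F ∂_F - r_t ∂_Q`. -/
def Yr (r : ℝ → ℝ) : VectorField :=
  (fun p => (0, 0, r p.1 * p.2.2),
   fun z => ![0, 0, -(r z.1.1 * z.2 2), -(r z.1.1 * z.2 3), -(r z.1.1 * z.2 4),
     -deriv r z.1.1])

/-- The vector fields spanned by `Y₁`, `Y₂`, `Y_α` and `Y_r`, with `α`, `r` smooth on `I`. -/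
def generatorSpan (I : Set ℝ) : Submodule ℝ VectorField :=
  Submodule.span ℝ (({Y₁, Y₂} : Set VectorField)
    ∪ {Y | ∃ α : ℝ → ℝ, ContDiffOn ℝ ∞ α I ∧ Y = Yα α}
    ∪ {Y | ∃ r : ℝ → ℝ, ContDiffOn ℝ ∞ r I ∧ Y = Yr r})

/-! ### Finite equivalence transformations -/

/-- The map `(t, x) ↦ (t̃, x̃)` induced by the point transformation `Φ` along `u(t, x)`. -/
def inducedMap (Φ : Base → Base) (u : ℝ × ℝ → ℝ) (q : ℝ × ℝ) : ℝ × ℝ :=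
  ((Φ (q.1, q.2, u q)).1, (Φ (q.1, q.2, u q)).2.1)

/-- The point transformation `Φ`, on the domain `D`, maps the equation with coefficient functions
`θ` to the equation with coefficient functions `θ'`: whenever `Φ` carries the graph of `u`, near
the point over `q`, to the graph of `v` (so that `v` is the transform of `u`; the non-vanishing
Jacobian says that the transformed graph is again a graph), `u` satisfies the first equation at `q`
if and only if `v` satisfies the second one at the corresponding point. -/
def MapsEquation (Φ : Base → Base) (D : Set Base) (θ θ' : ℝ → Coeff) : Prop :=
  ∀ (u v : ℝ × ℝ → ℝ) (q : ℝ × ℝ),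
    ContDiffAt ℝ ∞ u q → (q.1, q.2, u q) ∈ D →
    (fderiv ℝ (inducedMap Φ u) q).det ≠ 0 →
    ContDiffAt ℝ ∞ v (inducedMap Φ u q) →
    (∀ᶠ q' in 𝓝 q, v (inducedMap Φ u q') = (Φ (q'.1, q'.2, u q')).2.2) →
    (lhs (θ q.1) u q = 0 ↔
      lhs (θ' (inducedMap Φ u q).1) v (inducedMap Φ u q) = 0)

/-- `Φ` is an equivalence transformation of the class over the box `I × J × K`: a nondegenerate
point transformation of `(t, x, u)` that maps every equation of the class with `t ∈ I` to some
equation of the class. -/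
structure IsEquivalenceTransformation (I J K : Set ℝ) (Φ : Base → Base) : Prop where
  smooth : ContDiffOn ℝ ∞ Φ (box I J K)
  nondegenerate : ∀ p ∈ box I J K, (fderiv ℝ Φ p).det ≠ 0
  injective : InjOn Φ (box I J K)
  maps_class : ∀ θ, IsClassCoeff I θ →
    ∃ θ', IsClassCoeff ((fun p => (Φ p).1) '' box I J K) θ' ∧ MapsEquation Φ (box I J K) θ θ'

/-- `t̃ = α(t)`, `x̃ = (x + k₂) e^{k₁}`, `ũ = e^{r(t) k_r + k₁/2} u`. -/
def groupMap (α r : ℝ → ℝ) (k₁ k₂ kr : ℝ) : Base → Base := fun p =>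
  (α p.1, (p.2.1 + k₂) * Real.exp k₁, Real.exp (r p.1 * kr + k₁ / 2) * p.2.2)

/-- The values of `Ã, …, Q̃` at `t̃ = α(t)` for the transformation `groupMap α r k₁ k₂ kr`. -/
def groupCoeff (α r : ℝ → ℝ) (k₁ kr : ℝ) (θ : ℝ → Coeff) (t : ℝ) : Coeff :=
  ![Real.exp (5 * k₁) / deriv α t * θ t 0,
    Real.exp (3 * k₁) / deriv α t * θ t 1,
    Real.exp (5 * k₁ / 2 - r t * kr) / deriv α t * θ t 2,
    Real.exp (k₁ / 2 - r t * kr) / deriv α t * θ t 3,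
    Real.exp (5 * k₁ / 2 - r t * kr) / deriv α t * θ t 4,
    (θ t 5 - deriv r t * kr) / deriv α t]

/-- `(t, x, u) ↦ (t, σ₁ x, σ₂ u)`, used with `σ₁, σ₂ ∈ {1, -1}`. -/
def reflection (σ₁ σ₂ : ℝ) : Base → Base := fun p => (p.1, σ₁ * p.2.1, σ₂ * p.2.2)

/-- `α` and `r` are smooth on `I` and `α_t ≠ 0` there. -/
def AdmissibleParams (I : Set ℝ) (α r : ℝ → ℝ) : Prop :=
  ContDiffOn ℝ ∞ α I ∧ (∀ t ∈ I, deriv α t ≠ 0) ∧ ContDiffOn ℝ ∞ r I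

/-! ### The normalization `A = C = 1` -/

/-- `α = ∫ e^{5 k₁} A dt` on `I`, where `A = θ₀`. -/
def IsTimePrimitive (I : Set ℝ) (θ : ℝ → Coeff) (k₁ : ℝ) (α : ℝ → ℝ) : Prop :=
  ∀ t ∈ I, HasDerivAt α (Real.exp (5 * k₁) * θ t 0) t

/-- `t̃ = α(t)`, `x̃ = (x + k₂) e^{k₁}`, `ũ = e^{-2 k₁} (C / A) u`. -/
def normMap (θ : ℝ → Coeff) (α : ℝ → ℝ) (k₁ k₂ : ℝ) : Base → Base := fun p =>
  (α p.1, (p.2.1 + k₂) * Real.exp k₁, Real.exp (-2 * k₁) * θ p.1 2 / θ p.1 0 * p.2.2)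

/-- The values of `Ã, …, Q̃` at `t̃ = α(t)` for the transformation `normMap θ α k₁ k₂`. -/
def normCoeff (θ : ℝ → Coeff) (k₁ : ℝ) (t : ℝ) : Coeff :=
  ![1,
    Real.exp (-2 * k₁) * θ t 1 / θ t 0,
    1,
    Real.exp (-2 * k₁) * θ t 3 / θ t 2,
    θ t 4 / θ t 2,
    Real.exp (-5 * k₁) * (θ t 5 + deriv (fun s => Real.log |θ s 0 / θ s 2|) t) / θ t 0]

end FifthOrderKdV

end

open FifthOrderKdV

/-! The method is comparison of jets. A polynomial `jetFun` realises arbitrary values of u_t and of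
u, u_x, …, u_xxxxx at a point. Choosing u_t so that the equation holds there turns invariance into
an identity in free parameters, whose coefficients can be compared.

All finite transformations in the theorem have the form (α(t), a x + b, R(t) u), called `scaleMap`.
For such a map the chain rule (`IsScaling.lhs_eq`) turns the new left-hand side into R/α_t times an
old one with explicit coefficients. Independence of the differential monomials then gives the
transformation rule as an equivalence (`IsScaling.mapsEquation_iff`). The group formulas and the
normalization are particular choices of a and R.

That nothing else occurs is shown with the test equations u_t + u_xxxxx + u u_xxx + e u u_x + f u_x
u_xx = 0, for (e, f) = (0,0), (0,1), (1,0). If u and u + δ both solve the equation at a point where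
δ = 0, their transforms differ near the image point by κδ to leading order with κ ≠ 0
(`exists_transform_perturbation`). Taking δ = (t - t₀)^5, which is invisible to the old equation,
forces t̃ = α(t), since otherwise δ would change the fifth x̃-derivative. Taking δ = (x - x₀)^5 -
120 (t - t₀) gives (D_x x̃)^5 = Ã t̃_t for every slope u_x, hence x̃ = a(t) x + b(t). Since u_xxxx
is absent from the equation, varying it must not change the fifth x-derivative of ũ, so D_x(ũ_u) = 0
and ũ = R(t) u + S(t, x) (`exists_slope`). The remaining identity is polynomial in the jet: f = 1
yields S_x = 0, e = 0 yields a_t x + b_t = 0, and e = 1 yields S = 0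
(`IsEquivalenceTransformation.exists_scaleMap`). Since R has no zero on an interval, its sign is
constant and its modulus is an exponential.

The equivalence algebra follows the same pattern. The auxiliary equations make τ and ω independent
of (x, u). Perturbing u_t and u_xxxxx makes ξ affine in x, varying u_xxxx makes η affine in u, and
coefficient comparison does the rest (`IsEquivalenceGenerator.exists_eqOn`). Conversely, the
prolongation of a field from the span multiplies the left-hand side by R - α_t, where R u is its
u-component. -/

namespace FifthOrderKdV

open Asymptotics

/-! ### Derivatives read off from asymptotic expansions -/

/-- A smooth function that is `o((y - x₀)^n)` has vanishing derivatives up to order `n`. -/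
theorem iteratedDeriv_eq_zero_of_isLittleO {f : ℝ → ℝ} {x₀ : ℝ} {n : ℕ}
    (hf : ContDiffAt ℝ n f x₀) (h : f =o[𝓝 x₀] fun y => (y - x₀) ^ n) {k : ℕ} (hk : k ≤ n) :
    iteratedDeriv k f x₀ = 0 := by
  induction k using Nat.strong_induction_on with
  | _ k ih =>
    obtain ⟨s, hs, hfs⟩ := (hf.of_le (by exact_mod_cast hk)).contDiffOn (m := k) le_rfl (by simp)
    obtain ⟨r, hr, hrs⟩ := Metric.mem_nhds_iff.1 (by simpa using hs)
    have hball : x₀ ∈ Metric.ball x₀ r := Metric.mem_ball_self hr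
    -- With the lower derivatives already known to vanish, the Taylor polynomial of order k is its
    -- top term alone, which must then be o((y - x₀)^k).
    have ht := taylor_isLittleO (convex_ball x₀ r) hball (hfs.mono hrs)
    rw [Metric.isOpen_ball.nhdsWithin_eq hball] at ht
    have hD : ∀ j, iteratedDerivWithin j f (Metric.ball x₀ r) x₀ = iteratedDeriv j f x₀ :=
      fun j => iteratedDerivWithin_of_isOpen Metric.isOpen_ball hball
    have hE : ∀ y, taylorWithinEval f k (Metric.ball x₀ r) x₀ y
        = ((k.factorial : ℝ)⁻¹ * (y - x₀) ^ k) • iteratedDeriv k f x₀ := by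
      intro y
      rw [taylor_within_apply, Finset.sum_range_succ, Finset.sum_eq_zero, hD, zero_add]
      intro j hj
      rw [hD, ih j (Finset.mem_range.1 hj) ((Finset.mem_range.1 hj).le.trans hk), smul_zero]
    simp only [hE] at ht
    have h' : f =o[𝓝 x₀] fun y => (y - x₀) ^ k := by
      refine h.trans_isBigO ?_
      have : (fun y : ℝ => (y - x₀) ^ (n - k)) =O[𝓝 x₀] fun _ => (1 : ℝ) :=
        (show ContinuousAt (fun y : ℝ => (y - x₀) ^ (n - k)) x₀ by fun_prop).norm.isBoundedUnder_le.isBigO_one ℝ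
      have h2 := (isBigO_refl (fun y : ℝ => (y - x₀) ^ k) (𝓝 x₀)).mul this
      refine h2.congr (fun y => ?_) fun y => by simp
      rw [← pow_add, Nat.add_sub_cancel' hk]
    have h3 := h'.sub ht
    set c := (k.factorial : ℝ)⁻¹ * iteratedDeriv k f x₀ with hc
    have h4 : (fun y => c * (y - x₀) ^ k) =o[𝓝 x₀] fun y => (y - x₀) ^ k := by
      refine h3.congr_left fun y => ?_
      simp only [smul_eq_mul, hc]; ring
    by_contra hne
    have hc0 : c ≠ 0 := mul_ne_zero (by positivity) hne
    have h5 := (isLittleO_const_mul_left_iff hc0).1 h4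
    -- The monomial is nonzero at points arbitrarily close to x₀, so it cannot be little-o of
    -- itself.
    have h6 : ∃ᶠ y in 𝓝 x₀, (y - x₀) ^ k ≠ 0 := by
      have : ∃ᶠ y in 𝓝[≠] x₀, (y - x₀) ^ k ≠ 0 :=
        Eventually.frequently (f := 𝓝[≠] x₀)
          (eventually_mem_nhdsWithin.mono fun y hy => pow_ne_zero _ (sub_ne_zero.2 hy))
      exact this.filter_mono nhdsWithin_le_nhds
    exact isLittleO_irrefl (h6.mono fun y hy => by simpa using hy) h5

theorem iteratedDeriv_pow_sub (n k : ℕ) (x₀ : ℝ) :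
    iteratedDeriv k (fun y : ℝ => (y - x₀) ^ n) x₀ = if k = n then (n.factorial : ℝ) else 0 := by
  have := congrFun (iteratedDeriv_comp_sub_const k (fun y : ℝ => y ^ n) x₀) x₀
  rw [this, sub_self, iteratedDeriv_fun_pow_zero]
  split_ifs <;> simp_all

/-- Subtracting the monomial reduces to the case of a negligible function. Applied to differences of
functions, this says how an asymptotic perturbation alters each derivative at the point. -/
theorem iteratedDeriv_eq_of_isLittleO {f : ℝ → ℝ} {x₀ c : ℝ} {n : ℕ}
    (hf : ContDiffAt ℝ n f x₀)
    (h : (fun y => f y - c * (y - x₀) ^ n) =o[𝓝 x₀] fun y => (y - x₀) ^ n) {k : ℕ}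
    (hk : k ≤ n) :
    iteratedDeriv k f x₀ = if k = n then n.factorial * c else 0 := by
  have hp : ContDiffAt ℝ n (fun y : ℝ => c * (y - x₀) ^ n) x₀ := by fun_prop
  have h1 : iteratedDeriv k (f - fun y => c * (y - x₀) ^ n) x₀ = 0 :=
    iteratedDeriv_eq_zero_of_isLittleO (hf.sub hp) h hk
  have hk' : (k : WithTop ℕ∞) ≤ n := by exact_mod_cast hk
  rw [iteratedDeriv_sub (hf.of_le hk') (hp.of_le hk'), sub_eq_zero] at h1
  rw [h1, iteratedDeriv_const_mul_field, iteratedDeriv_pow_sub]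
  split_ifs <;> ring

/-! ### Iterated derivatives in x -/

theorem dx_iterate (n : ℕ) (u : ℝ × ℝ → ℝ) :
    dx^[n] u = fun q => iteratedDeriv n (fun y => u (q.1, y)) q.2 := by
  induction n with
  | zero => ext q; simp
  | succ n ih =>
    rw [Function.iterate_succ_apply', ih]
    ext q
    simp only [dx, iteratedDeriv_succ]

theorem dx_iterate_apply (n : ℕ) (u : ℝ × ℝ → ℝ) (q : ℝ × ℝ) :
    dx^[n] u q = iteratedDeriv n (fun y => u (q.1, y)) q.2 := by rw [dx_iterate]

theorem iteratedDeriv_comp_affine (n : ℕ) (w : ℝ → ℝ) (a b : ℝ) :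
    iteratedDeriv n (fun y => w (a * y + b)) = fun y => a ^ n * iteratedDeriv n w (a * y + b) := by
  induction n with
  | zero => simp
  | succ n ih =>
    rw [iteratedDeriv_succ, ih]
    ext y
    rw [deriv_const_mul_field, iteratedDeriv_succ,
      deriv_comp_mul_left a (fun z => iteratedDeriv n w (z + b)) y, deriv_comp_add_const]
    simp only [smul_eq_mul]; ring

/-! ### Polynomial test functions -/

/-- A polynomial with prescribed derivative `a` in `t` and prescribed derivatives `p k` in `x`. -/
noncomputable def jetFun (q : ℝ × ℝ) (a : ℝ) (p : ℕ → ℝ) : ℝ × ℝ → ℝ := fun z =>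
  a * (z.1 - q.1) + ∑ k ∈ Finset.range 6, p k * ((k.factorial : ℝ)⁻¹ * (z.2 - q.2) ^ k)

theorem contDiff_jetFun (q : ℝ × ℝ) (a : ℝ) (p : ℕ → ℝ) : ContDiff ℝ ∞ (jetFun q a p) := by
  unfold jetFun; fun_prop

theorem jetFun_self (q : ℝ × ℝ) (a : ℝ) (p : ℕ → ℝ) : jetFun q a p q = p 0 := by
  simp [jetFun, Finset.sum_range_succ]

theorem dt_jetFun (q : ℝ × ℝ) (a : ℝ) (p : ℕ → ℝ) : dt (jetFun q a p) = fun _ => a := by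
  ext z
  simp [dt, jetFun]

theorem dx_jetFun (q : ℝ × ℝ) (a : ℝ) (p : ℕ → ℝ) :
    dx (jetFun q a p) = jetFun q 0 (fun k => if k < 5 then p (k + 1) else 0) := by
  ext z
  have h : HasDerivAt (fun y => jetFun q a p (z.1, y))
      (jetFun q 0 (fun k => if k < 5 then p (k + 1) else 0) z) z.2 := by
    have h1 : ∀ k : ℕ, HasDerivAt (fun y : ℝ => (y - q.2) ^ k) (k * (z.2 - q.2) ^ (k - 1)) z.2 :=
      fun k => by simpa using ((hasDerivAt_id z.2).sub_const q.2).fun_pow k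
    have h2 := (HasDerivAt.fun_sum (u := Finset.range 6) fun k _ =>
      ((h1 k).const_mul ((k.factorial : ℝ)⁻¹)).const_mul (p k)).const_add (a * (z.1 - q.1))
    refine h2.congr_deriv ?_
    simp [jetFun, Finset.sum_range_succ, Nat.factorial]
    ring
  exact h.deriv

/-- One x-derivative already removes the term in t, so the case of order zero is excluded; the zero
default reflects that the polynomial has degree at most five in x. -/
theorem dx_iterate_jetFun_succ (q : ℝ × ℝ) (a : ℝ) (p : ℕ → ℝ) (n : ℕ) :
    dx^[n + 1] (jetFun q a p) =
      jetFun q 0 (fun k => if k + n < 5 then p (k + n + 1) else 0) := by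
  induction n with
  | zero => simp [dx_jetFun]
  | succ n ih =>
    rw [Function.iterate_succ_apply', ih, dx_jetFun]
    congr 1
    ext k
    by_cases h : k + (n + 1) < 5
    · rw [if_pos (by omega), if_pos (by omega), if_pos h]; congr 1; ring
    · rw [if_neg h]
      split_ifs <;> first | rfl | omega

theorem dx_iterate_jetFun (q : ℝ × ℝ) (a : ℝ) (p : ℕ → ℝ) {n : ℕ} (hn : n < 6) :
    dx^[n] (jetFun q a p) q = p n := by
  cases n with
  | zero => exact jetFun_self q a p
  | succ n => rw [dx_iterate_jetFun_succ, jetFun_self]; simp; omega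

/-- The parameters are free, so `a` can be chosen to make this vanish. The absence of `p 4` is what
later allows u_xxxx to be varied without leaving the set of solutions. -/
theorem lhs_jetFun (c : Coeff) (q : ℝ × ℝ) (a : ℝ) (p : ℕ → ℝ) :
    lhs c (jetFun q a p) q = a + c 0 * p 5 + c 1 * p 3 + c 2 * p 0 * p 3 + c 3 * p 0 * p 1
      + c 4 * p 1 * p 2 + c 5 * p 0 := by
  have h1 : dx (jetFun q a p) q = p 1 := dx_iterate_jetFun q a p (n := 1) (by norm_num)
  rw [lhs, dt_jetFun, dx_iterate_jetFun _ _ _ (by norm_num), dx_iterate_jetFun _ _ _ (by norm_num),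
    dx_iterate_jetFun _ _ _ (by norm_num), h1, jetFun_self]

/-! ### Local inverses, determinants and constancy -/

theorem det_ne_zero_iff_injective {E : Type*} [NormedAddCommGroup E] [NormedSpace ℝ E]
    [FiniteDimensional ℝ E] (L : E →L[ℝ] E) : L.det ≠ 0 ↔ Function.Injective L := by
  rw [ContinuousLinearMap.det, Ne, LinearMap.det_eq_zero_iff_ker_ne_bot, not_not]
  exact LinearMap.ker_eq_bot

theorem exists_localInverse {F : ℝ × ℝ → ℝ × ℝ} {q : ℝ × ℝ} (hF : ContDiffAt ℝ ∞ F q)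
    (hdet : (fderiv ℝ F q).det ≠ 0) :
    ∃ g : ℝ × ℝ → ℝ × ℝ, ContDiffAt ℝ ∞ g (F q) ∧ g (F q) = q ∧
      (∀ᶠ z in 𝓝 (F q), F (g z) = z) ∧ ∀ᶠ q' in 𝓝 q, g (F q') = q' := by
  let e := ContinuousLinearMap.toContinuousLinearEquivOfDetNeZero _ hdet
  have he : HasFDerivAt F (e : ℝ × ℝ →L[ℝ] ℝ × ℝ) q := by
    simpa [e] using (hF.differentiableAt (by simp)).hasFDerivAt
  have hs := hF.hasStrictFDerivAt' he (by simp)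
  exact ⟨hF.localInverse he (by simp), hF.to_localInverse he (by simp),
    hF.localInverse_apply_image he (by simp), hs.eventually_right_inverse,
    hs.eventually_left_inverse⟩

theorem eq_of_hasDerivAt_zero {S : Set ℝ} (hS : IsOpen S) (hS' : S.OrdConnected) {f : ℝ → ℝ}
    (hf : ∀ y ∈ S, HasDerivAt f 0 y) {y z : ℝ} (hy : y ∈ S) (hz : z ∈ S) : f y = f z :=
  hS.is_const_of_deriv_eq_zero hS'.isPreconnected
    (fun w hw => (hf w hw).differentiableAt.differentiableWithinAt)
    (fun w hw => (hf w hw).deriv) hy hz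

/-! ### Transformation of derivatives -/

theorem dt_eq_fderiv {v : ℝ × ℝ → ℝ} {q : ℝ × ℝ} (hv : DifferentiableAt ℝ v q) :
    dt v q = fderiv ℝ v q (1, 0) := by
  have h : HasDerivAt (fun s : ℝ => (s, q.2)) ((1 : ℝ), (0 : ℝ)) q.1 :=
    (hasDerivAt_id q.1).prodMk (hasDerivAt_const _ _)
  exact (HasFDerivAt.comp_hasDerivAt q.1 (f := fun s : ℝ => (s, q.2)) (by exact hv.hasFDerivAt)
    h).deriv

theorem dx_eq_fderiv {v : ℝ × ℝ → ℝ} {q : ℝ × ℝ} (hv : DifferentiableAt ℝ v q) :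
    dx v q = fderiv ℝ v q (0, 1) := by
  have h : HasDerivAt (fun s : ℝ => (q.1, s)) ((0 : ℝ), (1 : ℝ)) q.2 :=
    (hasDerivAt_const _ _).prodMk (hasDerivAt_id q.2)
  exact (HasFDerivAt.comp_hasDerivAt q.2 (f := fun s : ℝ => (q.1, s)) (by exact hv.hasFDerivAt)
    h).deriv

theorem fderiv_apply_eq {v : ℝ × ℝ → ℝ} {q : ℝ × ℝ} (hv : DifferentiableAt ℝ v q) (a b : ℝ) :
    fderiv ℝ v q (a, b) = a * dt v q + b * dx v q := by
  have : ((a, b) : ℝ × ℝ) = a • ((1 : ℝ), (0 : ℝ)) + b • ((0 : ℝ), (1 : ℝ)) := by simp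
  rw [this, map_add, map_smul, map_smul, dt_eq_fderiv hv, dx_eq_fderiv hv]; simp

theorem pow_mul_dx_iterate {v : ℝ × ℝ → ℝ} {f : ℝ → ℝ} {t a b x : ℝ}
    (h : ∀ᶠ y in 𝓝 x, v (t, a * y + b) = f y) (n : ℕ) :
    a ^ n * dx^[n] v (t, a * x + b) = iteratedDeriv n f x := by
  rw [dx_iterate_apply, ← Filter.EventuallyEq.iteratedDeriv_eq n h,
    iteratedDeriv_comp_affine n (fun z => v (t, z))]

theorem hasDerivAt_along {v : ℝ × ℝ → ℝ} {f X Y : ℝ → ℝ} {X' Y' t : ℝ}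
    (hv : DifferentiableAt ℝ v (X t, Y t)) (hX : HasDerivAt X X' t) (hY : HasDerivAt Y Y' t)
    (h : ∀ᶠ s in 𝓝 t, v (X s, Y s) = f s) :
    HasDerivAt f (X' * dt v (X t, Y t) + Y' * dx v (X t, Y t)) t := by
  have h1 := HasFDerivAt.comp_hasDerivAt t (f := fun s : ℝ => (X s, Y s)) hv.hasFDerivAt
    (hX.prodMk hY)
  rw [fderiv_apply_eq hv] at h1
  exact h1.congr_of_eventuallyEq (h.mono fun s hs => hs.symm)

theorem contDiffAt_graph {u : ℝ × ℝ → ℝ} {q : ℝ × ℝ} (hu : ContDiffAt ℝ ∞ u q) :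
    ContDiffAt ℝ ∞ (fun q' : ℝ × ℝ => ((q'.1, q'.2, u q') : Base)) q :=
  contDiffAt_fst.prodMk (contDiffAt_snd.prodMk hu)

theorem contDiffAt_inducedMap {Φ : Base → Base} {u : ℝ × ℝ → ℝ} {q : ℝ × ℝ}
    (hΦ : ContDiffAt ℝ ∞ Φ (q.1, q.2, u q)) (hu : ContDiffAt ℝ ∞ u q) :
    ContDiffAt ℝ ∞ (inducedMap Φ u) q := by
  have h := ContDiffAt.comp q (g := Φ) hΦ (contDiffAt_graph hu)
  exact (contDiffAt_fst.comp q h).prodMk (contDiffAt_fst.comp q (contDiffAt_snd.comp q h))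

theorem fderiv_inducedMap {Φ : Base → Base} {u : ℝ × ℝ → ℝ} {q : ℝ × ℝ}
    (hΦ : DifferentiableAt ℝ Φ (q.1, q.2, u q)) (hu : DifferentiableAt ℝ u q) (a b : ℝ) :
    fderiv ℝ (inducedMap Φ u) q (a, b) =
      ((fderiv ℝ Φ (q.1, q.2, u q) (a, b, a * dt u q + b * dx u q)).1,
        (fderiv ℝ Φ (q.1, q.2, u q) (a, b, a * dt u q + b * dx u q)).2.1) := by
  have h1 : HasFDerivAt (fun q' : ℝ × ℝ => ((q'.1, q'.2, u q') : Base)) _ q :=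
    hasFDerivAt_fst.prodMk (hasFDerivAt_snd.prodMk hu.hasFDerivAt)
  have h2 := HasFDerivAt.comp q (g := Φ) hΦ.hasFDerivAt h1
  have h3 : HasFDerivAt (inducedMap Φ u) _ q := h2.fst.prodMk h2.snd.fst
  rw [h3.fderiv, ← fderiv_apply_eq hu]
  simp

theorem det_ne_zero_of_apply {L : ℝ × ℝ →L[ℝ] ℝ × ℝ}
    (h : (L (1, 0)).1 * (L (0, 1)).2 - (L (0, 1)).1 * (L (1, 0)).2 ≠ 0) : L.det ≠ 0 := by
  rw [det_ne_zero_iff_injective, injective_iff_map_eq_zero]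
  rintro ⟨a, b⟩ hab
  have : ((a, b) : ℝ × ℝ) = a • ((1 : ℝ), (0 : ℝ)) + b • ((0 : ℝ), (1 : ℝ)) := by simp
  rw [this, map_add, map_smul, map_smul] at hab
  have h1 : a * (L (1, 0)).1 + b * (L (0, 1)).1 = 0 := by simpa using congrArg Prod.fst hab
  have h2 : a * (L (1, 0)).2 + b * (L (0, 1)).2 = 0 := by simpa using congrArg Prod.snd hab
  have ha : a * ((L (1, 0)).1 * (L (0, 1)).2 - (L (0, 1)).1 * (L (1, 0)).2) = 0 := by
    linear_combination (L (0, 1)).2 * h1 - (L (0, 1)).1 * h2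
  have hb : b * ((L (1, 0)).1 * (L (0, 1)).2 - (L (0, 1)).1 * (L (1, 0)).2) = 0 := by
    linear_combination (L (1, 0)).1 * h2 - (L (1, 0)).2 * h1
  simp [(mul_eq_zero.1 ha).resolve_right h, (mul_eq_zero.1 hb).resolve_right h]

/-- The transform of a smooth function whose graph is transversal to the transformation. -/
theorem exists_transform {Φ : Base → Base} {u : ℝ × ℝ → ℝ} {q : ℝ × ℝ}
    (hΦ : ContDiffAt ℝ ∞ Φ (q.1, q.2, u q)) (hu : ContDiffAt ℝ ∞ u q)
    (hdet : (fderiv ℝ (inducedMap Φ u) q).det ≠ 0) :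
    ∃ v : ℝ × ℝ → ℝ, ContDiffAt ℝ ∞ v (inducedMap Φ u q) ∧
      ∀ᶠ q' in 𝓝 q, v (inducedMap Φ u q') = (Φ (q'.1, q'.2, u q')).2.2 := by
  obtain ⟨g, hg, hgq, -, hgl⟩ := exists_localInverse (contDiffAt_inducedMap hΦ hu) hdet
  refine ⟨fun z => (Φ ((g z).1, (g z).2, u (g z))).2.2, ?_, hgl.mono fun q' hq' => by
    simp only [hq']⟩
  have h := ContDiffAt.comp q (g := Φ) hΦ (contDiffAt_graph hu)
  have h2 : ContDiffAt ℝ ∞ (fun q' : ℝ × ℝ => (Φ (q'.1, q'.2, u q')).2.2) q :=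
    contDiffAt_snd.comp q (contDiffAt_snd.comp q h)
  rw [← hgq] at h2
  exact h2.comp _ hg

/-! ### Transformations that scale `x` and `u` -/

theorem isOpen_box {I J K : Set ℝ} (hI : IsOpen I) (hJ : IsOpen J) (hK : IsOpen K) :
    IsOpen (box I J K) := hI.prod (hJ.prod hK)

/-- `(t, x, u) ↦ (α(t), a x + b, R(t) u)`. -/
def scaleMap (α R : ℝ → ℝ) (a b : ℝ) : Base → Base := fun p =>
  (α p.1, a * p.2.1 + b, R p.1 * p.2.2)

/-- The coefficients at `α(t)` of the image of the equation with coefficients `θ` under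
`scaleMap α R a b`. -/
noncomputable def scaleCoeff (α R : ℝ → ℝ) (a : ℝ) (θ : ℝ → Coeff) (t : ℝ) : Coeff :=
  ![a ^ 5 * θ t 0 / deriv α t, a ^ 3 * θ t 1 / deriv α t, a ^ 3 * θ t 2 / (R t * deriv α t),
    a * θ t 3 / (R t * deriv α t), a ^ 3 * θ t 4 / (R t * deriv α t),
    (θ t 5 - deriv R t / R t) / deriv α t]

/-- The conditions under which `scaleMap α R a b` is nondegenerate over `I`. -/
structure IsScaling (I : Set ℝ) (α R : ℝ → ℝ) (a : ℝ) : Prop where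
  smooth_time : ContDiffOn ℝ ∞ α I
  deriv_time : ∀ t ∈ I, deriv α t ≠ 0
  smooth_factor : ContDiffOn ℝ ∞ R I
  factor_ne : ∀ t ∈ I, R t ≠ 0
  scale_ne : a ≠ 0

section Scaling

variable {I J K : Set ℝ} {α R : ℝ → ℝ} {a b : ℝ}

theorem IsScaling.contDiffAt_time (h : IsScaling I α R a) (hI : IsOpen I) {t : ℝ} (ht : t ∈ I) :
    ContDiffAt ℝ ∞ α t := h.smooth_time.contDiffAt (hI.mem_nhds ht)

theorem IsScaling.contDiffAt_factor (h : IsScaling I α R a) (hI : IsOpen I) {t : ℝ} (ht : t ∈ I) :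
    ContDiffAt ℝ ∞ R t := h.smooth_factor.contDiffAt (hI.mem_nhds ht)

theorem IsScaling.contDiffAt (h : IsScaling I α R a) (hI : IsOpen I) {p : Base} (hp : p.1 ∈ I) :
    ContDiffAt ℝ ∞ (scaleMap α R a b) p := by
  have h1 : ContDiffAt ℝ ∞ (fun p : Base => α p.1) p :=
    (h.contDiffAt_time hI hp).comp p contDiffAt_fst
  have h2 : ContDiffAt ℝ ∞ (fun p : Base => R p.1) p :=
    (h.contDiffAt_factor hI hp).comp p contDiffAt_fst
  exact h1.prodMk (((contDiffAt_const.mul contDiffAt_snd.fst).add contDiffAt_const).prodMk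
    (h2.mul contDiffAt_snd.snd))

theorem IsScaling.fderiv_apply (h : IsScaling I α R a) (hI : IsOpen I) {p : Base} (hp : p.1 ∈ I)
    (w : Base) : fderiv ℝ (scaleMap α R a b) p w =
      (deriv α p.1 * w.1, a * w.2.1, deriv R p.1 * w.1 * p.2.2 + R p.1 * w.2.2) := by
  have h1 : HasFDerivAt (fun p : Base => α p.1) _ p :=
    (((h.contDiffAt_time hI hp).differentiableAt (by simp)).hasDerivAt).comp_hasFDerivAt p
      (hasFDerivAt_fst (𝕜 := ℝ) (p := p))
  have h2 : HasFDerivAt (fun p : Base => R p.1) _ p :=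
    (((h.contDiffAt_factor hI hp).differentiableAt (by simp)).hasDerivAt).comp_hasFDerivAt p
      (hasFDerivAt_fst (𝕜 := ℝ) (p := p))
  have h3 : HasFDerivAt (fun p : Base => a * p.2.1 + b) _ p :=
    ((hasFDerivAt_snd (𝕜 := ℝ) (p := p)).fst.const_mul a).add_const b
  have h4 : HasFDerivAt (fun p : Base => R p.1 * p.2.2) _ p := h2.mul (hasFDerivAt_snd (𝕜 := ℝ) (p := p)).snd
  have h5 : HasFDerivAt (scaleMap α R a b) _ p := h1.prodMk (h3.prodMk h4)
  rw [h5.fderiv]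
  simp
  ring

theorem IsScaling.det_ne_zero (h : IsScaling I α R a) (hI : IsOpen I) {p : Base} (hp : p.1 ∈ I) :
    (fderiv ℝ (scaleMap α R a b) p).det ≠ 0 := by
  rw [det_ne_zero_iff_injective, injective_iff_map_eq_zero]
  rintro ⟨x, y, z⟩ hw
  rw [h.fderiv_apply hI hp] at hw
  simp only [Prod.mk_eq_zero, mul_eq_zero, h.deriv_time _ hp, h.scale_ne, false_or] at hw
  obtain ⟨rfl, rfl, hz⟩ := hw
  simpa [h.factor_ne _ hp] using hz

/-- Each x̃-derivative costs a factor 1/a, and differentiating R(t) u in t adds R_t u, which is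
absorbed into the coefficient of u. The overall factor is nonzero, so the two left-hand sides vanish
together. -/
theorem IsScaling.lhs_eq (h : IsScaling I α R a) (hI : IsOpen I) {u v : ℝ × ℝ → ℝ} {q : ℝ × ℝ}
    (hq : q.1 ∈ I) (hu : ContDiffAt ℝ ∞ u q)
    (hv : ContDiffAt ℝ ∞ v (inducedMap (scaleMap α R a b) u q))
    (huv : ∀ᶠ q' in 𝓝 q, v (inducedMap (scaleMap α R a b) u q') =
      (scaleMap α R a b (q'.1, q'.2, u q')).2.2) (c : Coeff) :
    lhs c v (inducedMap (scaleMap α R a b) u q) = R q.1 / deriv α q.1 *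
      lhs ![deriv α q.1 * c 0 / a ^ 5, deriv α q.1 * c 1 / a ^ 3,
        R q.1 * deriv α q.1 * c 2 / a ^ 3, R q.1 * deriv α q.1 * c 3 / a,
        R q.1 * deriv α q.1 * c 4 / a ^ 3, deriv R q.1 / R q.1 + deriv α q.1 * c 5] u q := by
  obtain ⟨t, x⟩ := q
  simp only [inducedMap, scaleMap] at hv huv hq ⊢
  have hdx : ∀ n, a ^ n * dx^[n] v (α t, a * x + b) = R t * dx^[n] u (t, x) := by
    intro n
    rw [pow_mul_dx_iterate (f := fun y => R t * u (t, y)), iteratedDeriv_const_mul_field,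
      dx_iterate_apply]
    exact (show Tendsto (fun y => (t, y)) (𝓝 x) (𝓝 (t, x)) from
      Continuous.tendsto (by fun_prop) x).eventually huv
  have h0 : v (α t, a * x + b) = R t * u (t, x) := by simpa using hdx 0
  have h1 : a * dx v (α t, a * x + b) = R t * dx u (t, x) := by simpa using hdx 1
  have hα := ((h.contDiffAt_time hI hq).differentiableAt (by simp)).hasDerivAt
  have hR := ((h.contDiffAt_factor hI hq).differentiableAt (by simp)).hasDerivAt
  have ht := hasDerivAt_along (v := v) (f := fun s => R s * u (s, x)) (Y := fun _ => a * x + b)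
    (hv.differentiableAt (by simp)) hα (hasDerivAt_const _ _)
    ((show Tendsto (fun s => (s, x)) (𝓝 t) (𝓝 (t, x)) from
      Continuous.tendsto (by fun_prop) t).eventually huv)
  have hut : HasDerivAt (fun s => u (s, x)) (dt u (t, x)) t := by
    have : DifferentiableAt ℝ (fun s => u (s, x)) t :=
      DifferentiableAt.comp t (g := u) (f := fun s => (s, x)) (hu.differentiableAt (by simp))
        (by fun_prop)
    exact this.hasDerivAt
  have ht' := ht.unique (hR.mul hut)
  have ha := h.scale_ne
  have hR0 := h.factor_ne t hq
  have hα0 := h.deriv_time t hq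
  have e0 : dt v (α t, a * x + b) =
      (deriv R t * u (t, x) + R t * dt u (t, x)) / deriv α t := by
    field_simp
    linear_combination ht'
  have e1 : dx v (α t, a * x + b) = R t * dx u (t, x) / a := by
    field_simp
    linear_combination h1
  have en : ∀ n, dx^[n] v (α t, a * x + b) = R t * dx^[n] u (t, x) / a ^ n := by
    intro n
    field_simp
    linear_combination hdx n
  simp only [lhs, e0, e1, en, h0]
  simp [Matrix.cons_val]
  field_simp
  ring

theorem exists_mem_ne_zero (hK : IsOpen K) (hK₀ : K.Nonempty) : ∃ w ∈ K, w ≠ 0 :=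
  (dense_compl_singleton (0 : ℝ)).inter_open_nonempty K hK hK₀

/-- Independence of the differential monomials over an open set of values of u. Two distinct values
are needed to separate u_xxx from u u_xxx, and one nonzero value to reach the coefficients of u u_x
and u. -/
theorem coeff_eq_zero (hK : IsOpen K) (hK₀ : K.Nonempty) {d : Coeff}
    (h : ∀ w ∈ K, ∀ p : ℕ → ℝ, p 0 = w → d 0 * p 5 + d 1 * p 3 + d 2 * p 0 * p 3
      + d 3 * p 0 * p 1 + d 4 * p 1 * p 2 + d 5 * p 0 = 0) : d = 0 := by
  obtain ⟨w, hw, hw0⟩ := exists_mem_ne_zero hK hK₀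
  obtain ⟨z, ⟨hz, hzw⟩⟩ := (dense_compl_singleton w).inter_open_nonempty K hK hK₀
  have hzw' : z - w ≠ 0 := sub_ne_zero.2 hzw
  let P : ℝ → ℝ → ℝ → ℝ → ℝ → ℕ → ℝ := fun y p1 p2 p3 p5 n =>
    match n with | 0 => y | 1 => p1 | 2 => p2 | 3 => p3 | 5 => p5 | _ => 0
  have H : ∀ y ∈ K, ∀ p1 p2 p3 p5 : ℝ, d 0 * p5 + d 1 * p3 + d 2 * y * p3
      + d 3 * y * p1 + d 4 * p1 * p2 + d 5 * y = 0 :=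
    fun y hy p1 p2 p3 p5 => h y hy (P y p1 p2 p3 p5) rfl
  have a0 := H w hw 0 0 0 0
  have a1 := H w hw 0 0 0 1
  have a2 := H w hw 0 0 1 0
  have a3 := H w hw 1 0 0 0
  have a4 := H w hw 1 1 0 0
  have a5 := H z hz 0 0 1 0
  have a6 := H z hz 0 0 0 0
  have d5 : d 5 = 0 := (mul_eq_zero.1 (show d 5 * w = 0 by linarith)).resolve_right hw0
  have d2 : d 2 = 0 := (mul_eq_zero.1 (show d 2 * (z - w) = 0 by rw [d5] at *; linarith)).resolve_right
    hzw'
  have d3 : d 3 = 0 := (mul_eq_zero.1 (show d 3 * w = 0 by linarith)).resolve_right hw0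
  ext i
  fin_cases i <;> simp [d5, d2, d3] <;> simp only [d5, d2, d3] at * <;> linarith

theorem IsScaling.mapsEquation_iff (h : IsScaling I α R a) (hI : IsOpen I) (hJ₀ : J.Nonempty)
    (hK : IsOpen K) (hK₀ : K.Nonempty) (θ θ' : ℝ → Coeff) :
    MapsEquation (scaleMap α R a b) (box I J K) θ θ' ↔
      ∀ t ∈ I, θ' (α t) = scaleCoeff α R a θ t := by
  have ha := h.scale_ne
  constructor
  · intro hM t ht
    obtain ⟨x, hx⟩ := hJ₀
    have hR := h.factor_ne t ht
    have hα := h.deriv_time t ht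
    set c := θ' (α t) with hc
    have key : (![deriv α t * c 0 / a ^ 5, deriv α t * c 1 / a ^ 3,
        R t * deriv α t * c 2 / a ^ 3, R t * deriv α t * c 3 / a,
        R t * deriv α t * c 4 / a ^ 3, deriv R t / R t + deriv α t * c 5] - θ t : Coeff) = 0 := by
      refine coeff_eq_zero hK hK₀ fun w hw p hp => ?_
      -- The time derivative that makes the test function a solution at the point; subtracting the
      -- two equations then eliminates it and leaves a relation among the x-derivatives.
      set m := -(θ t 0 * p 5 + θ t 1 * p 3 + θ t 2 * p 0 * p 3 + θ t 3 * p 0 * p 1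
        + θ t 4 * p 1 * p 2 + θ t 5 * p 0) with hm
      set u := jetFun (t, x) m p with hu
      have hus : ContDiffAt ℝ ∞ u (t, x) := (contDiff_jetFun _ _ _).contDiffAt
      have hD : (t, x, u (t, x)) ∈ box I J K := ⟨ht, hx, by
        rw [hu, jetFun_self, hp]; exact hw⟩
      have hΦ : ContDiffAt ℝ ∞ (scaleMap α R a b) (t, x, u (t, x)) := h.contDiffAt hI ht
      have hdet : (fderiv ℝ (inducedMap (scaleMap α R a b) u) (t, x)).det ≠ 0 := by
        apply det_ne_zero_of_apply
        rw [fderiv_inducedMap (hΦ.differentiableAt (by simp)) (hus.differentiableAt (by simp)),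
          fderiv_inducedMap (hΦ.differentiableAt (by simp)) (hus.differentiableAt (by simp)),
          h.fderiv_apply hI ht, h.fderiv_apply hI ht]
        simp [hα, ha]
      obtain ⟨v, hv, huv⟩ := exists_transform hΦ hus hdet
      have h1 := (hM u v (t, x) hus hD hdet hv huv).1 (by rw [hu, lhs_jetFun, hm]; ring)
      rw [h.lhs_eq hI ht hus hv huv] at h1
      have h2 := (mul_eq_zero.1 h1).resolve_left (div_ne_zero hR hα)
      rw [hu, lhs_jetFun] at h2
      simp only [inducedMap, scaleMap, ← hc] at h2
      simp only [Pi.sub_apply]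
      linear_combination h2 - hm
    have k := fun i => congrFun key i
    have k0 := k 0
    have k1 := k 1
    have k2 := k 2
    have k3 := k 3
    have k4 := k 4
    have k5 := k 5
    simp [Matrix.cons_val, sub_eq_zero] at k0 k1 k2 k3 k4 k5
    ext i
    fin_cases i <;> simp [scaleCoeff, Matrix.cons_val, ← k0, ← k1, ← k2, ← k3, ← k4, ← k5] <;>
      field_simp
  · intro hθ u v q hu hD hdet hv huv
    have hq : q.1 ∈ I := hD.1
    have hR := h.factor_ne _ hq
    have hα := h.deriv_time _ hq
    rw [h.lhs_eq hI hq hu hv huv, mul_eq_zero, or_iff_right (div_ne_zero hR hα)]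
    have : (inducedMap (scaleMap α R a b) u q).1 = α q.1 := rfl
    rw [this, hθ _ hq]
    have e : (![deriv α q.1 * scaleCoeff α R a θ q.1 0 / a ^ 5,
        deriv α q.1 * scaleCoeff α R a θ q.1 1 / a ^ 3,
        R q.1 * deriv α q.1 * scaleCoeff α R a θ q.1 2 / a ^ 3,
        R q.1 * deriv α q.1 * scaleCoeff α R a θ q.1 3 / a,
        R q.1 * deriv α q.1 * scaleCoeff α R a θ q.1 4 / a ^ 3,
        deriv R q.1 / R q.1 + deriv α q.1 * scaleCoeff α R a θ q.1 5] : Coeff) = θ q.1 := by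
      ext i
      fin_cases i <;> simp [scaleCoeff, Matrix.cons_val] <;> field_simp
      ring
    rw [e]

theorem injOn_of_deriv_ne_zero (hI' : I.OrdConnected)
    (hα : ContDiffOn ℝ ∞ α I) (h : ∀ t ∈ I, deriv α t ≠ 0) : InjOn α I := by
  have key : ∀ x ∈ I, ∀ y ∈ I, x < y → α x ≠ α y := by
    intro x hx y hy hxy he
    obtain ⟨c, hc, hc'⟩ := exists_deriv_eq_zero hxy (hα.continuousOn.mono (hI'.out hx hy)) he
    exact h c (hI'.out hx hy (Ioo_subset_Icc_self hc)) hc'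
  intro x hx y hy he
  rcases lt_trichotomy x y with hxy | hxy | hxy
  · exact absurd he (key x hx y hy hxy)
  · exact hxy
  · exact absurd he.symm (key y hy x hx hxy)

/-- Rolle's theorem makes α injective on the interval. Near each α(t) the set-theoretic inverse
agrees with the smooth local inverse, because the latter takes values in I and is a right inverse of
α. -/
theorem exists_smooth_inverse (hI : IsOpen I) (hI' : I.OrdConnected)
    (hα : ContDiffOn ℝ ∞ α I) (h : ∀ t ∈ I, deriv α t ≠ 0) :
    ∃ β : ℝ → ℝ, ContDiffOn ℝ ∞ β (α '' I) ∧ ∀ t ∈ I, β (α t) = t := by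
  have hinj := injOn_of_deriv_ne_zero hI' hα h
  have hβ : ∀ t ∈ I, Function.invFunOn α I (α t) = t := fun t ht => hinj.leftInvOn_invFunOn ht
  refine ⟨Function.invFunOn α I, ?_, hβ⟩
  rintro _ ⟨t, ht, rfl⟩
  have hc := hα.contDiffAt (hI.mem_nhds ht)
  have hd := ((hc.differentiableAt (by simp)).hasDerivAt).hasFDerivAt_equiv (h t ht)
  have hs := hc.hasStrictFDerivAt' hd (by simp)
  have hg : ContDiffAt ℝ ∞ (hc.localInverse hd (by simp)) (α t) := hc.to_localInverse hd (by simp)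
  have hgt : hc.localInverse hd (by simp) (α t) = t := hc.localInverse_apply_image hd (by simp)
  refine (hg.congr_of_eventuallyEq ?_).contDiffWithinAt
  have h1 : ∀ᶠ y in 𝓝 (α t), hc.localInverse hd (by simp) y ∈ I :=
    hg.continuousAt.eventually_mem (by rw [hgt]; exact hI.mem_nhds ht)
  filter_upwards [h1, hs.eventually_right_inverse] with y hy1 hy2
  have hy2' : α (hc.localInverse hd (by simp) y) = y := hy2
  conv_lhs => rw [← hy2']
  exact hβ _ hy1

theorem image_time_box (hJ₀ : J.Nonempty) (hK₀ : K.Nonempty) {Φ : Base → Base}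
    (hΦ : ∀ p ∈ box I J K, (Φ p).1 = α p.1) :
    (fun p => (Φ p).1) '' box I J K = α '' I := by
  obtain ⟨x, hx⟩ := hJ₀
  obtain ⟨w, hw⟩ := hK₀
  ext y
  constructor
  · rintro ⟨p, hp, rfl⟩
    exact ⟨p.1, hp.1, (hΦ p hp).symm⟩
  · rintro ⟨t, ht, rfl⟩
    exact ⟨(t, x, w), ⟨ht, hx, hw⟩, hΦ (t, x, w) ⟨ht, hx, hw⟩⟩

theorem IsScaling.exists_coeff (h : IsScaling I α R a) (hI : IsOpen I) (hI' : I.OrdConnected)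
    {θ : ℝ → Coeff} (hθ : IsClassCoeff I θ) :
    ∃ θ', IsClassCoeff (α '' I) θ' ∧ ∀ t ∈ I, θ' (α t) = scaleCoeff α R a θ t := by
  obtain ⟨β, hβs, hβ⟩ := exists_smooth_inverse hI hI' h.smooth_time h.deriv_time
  refine ⟨fun y => scaleCoeff α R a θ (β y), ⟨?_, ?_⟩, fun t ht => by simp only [hβ t ht]⟩
  · have hmaps : MapsTo β (α '' I) I := by
      rintro _ ⟨t, ht, rfl⟩
      rw [hβ t ht]; exact ht
    refine ContDiffOn.comp (g := scaleCoeff α R a θ) ?_ hβs hmaps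
    have hα' : ContDiffOn ℝ ∞ (deriv α) I := h.smooth_time.deriv_of_isOpen hI (by simp)
    have hR' : ContDiffOn ℝ ∞ (deriv R) I := h.smooth_factor.deriv_of_isOpen hI (by simp)
    have hθi : ∀ i, ContDiffOn ℝ ∞ (fun t => θ t i) I := contDiffOn_pi.1 hθ.1
    have hR := h.smooth_factor
    have hαn := h.deriv_time
    have hRn := h.factor_ne
    have hRα : ∀ t ∈ I, R t * deriv α t ≠ 0 := fun t ht => mul_ne_zero (hRn t ht) (hαn t ht)
    rw [contDiffOn_pi]
    intro i
    fin_cases i <;> simp only [scaleCoeff]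
    · exact (contDiffOn_const.mul (hθi 0)).div hα' hαn
    · exact (contDiffOn_const.mul (hθi 1)).div hα' hαn
    · exact (contDiffOn_const.mul (hθi 2)).div (hR.mul hα') hRα
    · exact (contDiffOn_const.mul (hθi 3)).div (hR.mul hα') hRα
    · exact (contDiffOn_const.mul (hθi 4)).div (hR.mul hα') hRα
    · exact ((hθi 5).sub (hR'.div hR hRn)).div hα' hαn
  · rintro _ ⟨t, ht, rfl⟩
    simp only [hβ t ht]
    have hA := hθ.2 t ht
    simp [admissible, scaleCoeff, h.scale_ne, h.deriv_time t ht, h.factor_ne t ht, hA.1, hA.2]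

theorem IsScaling.isEquivalenceTransformation (h : IsScaling I α R a) (hI : IsOpen I)
    (hI' : I.OrdConnected) (hJ₀ : J.Nonempty) (hK : IsOpen K) (hK₀ : K.Nonempty) :
    IsEquivalenceTransformation I J K (scaleMap α R a b) where
  smooth := fun _ hp => (h.contDiffAt hI hp.1).contDiffWithinAt
  nondegenerate := fun _ hp => h.det_ne_zero hI hp.1
  injective := by
    rintro ⟨t, x, w⟩ hp ⟨t', x', w'⟩ hp' he
    simp only [scaleMap, Prod.mk.injEq] at he
    obtain rfl : t = t' := injOn_of_deriv_ne_zero hI' h.smooth_time h.deriv_time hp.1 hp'.1 he.1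
    have h1 : x = x' := mul_left_cancel₀ h.scale_ne (by linarith [he.2.1])
    have h2 : w = w' := mul_left_cancel₀ (h.factor_ne t hp.1) he.2.2
    rw [h1, h2]
  maps_class := by
    intro θ hθ
    obtain ⟨θ', h1, h2⟩ := h.exists_coeff hI hI' hθ
    rw [image_time_box hJ₀ hK₀ fun _ _ => rfl]
    exact ⟨θ', h1, (h.mapsEquation_iff hI hJ₀ hK hK₀ θ θ').2 h2⟩

end Scaling

/-! ### Dependence on the values on the box only -/

theorem inducedMap_congr {Φ Ψ : Base → Base} {D : Set Base} (hD : IsOpen D) (h : EqOn Φ Ψ D)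
    {u : ℝ × ℝ → ℝ} {q : ℝ × ℝ} (hu : ContinuousAt u q) (hq : (q.1, q.2, u q) ∈ D) :
    ∀ᶠ q' in 𝓝 q, Φ (q'.1, q'.2, u q') = Ψ (q'.1, q'.2, u q') := by
  have hc : ContinuousAt (fun q' : ℝ × ℝ => ((q'.1, q'.2, u q') : Base)) q := by fun_prop
  exact (hc.eventually_mem (hD.mem_nhds hq)).mono fun q' hq' => h hq'

theorem MapsEquation.congr {Φ Ψ : Base → Base} {D : Set Base} (hD : IsOpen D) (h : EqOn Φ Ψ D)
    {θ θ' : ℝ → Coeff} (hM : MapsEquation Φ D θ θ') : MapsEquation Ψ D θ θ' := by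
  intro u v q hu hq hdet hv huv
  have h1 := inducedMap_congr hD h hu.continuousAt hq
  have h2 : inducedMap Φ u =ᶠ[𝓝 q] inducedMap Ψ u := h1.mono fun q' hq' => by
    simp only [inducedMap, hq']
  rw [← h2.fderiv_eq] at hdet
  rw [← h2.eq_of_nhds] at hv ⊢
  refine hM u v q hu hq hdet hv ?_
  filter_upwards [huv, h1, h2] with q' e1 e2 e3
  rw [e3, e1, e2]

theorem IsEquivalenceTransformation.congr {I J K : Set ℝ} {Φ Ψ : Base → Base} (hI : IsOpen I)
    (hJ : IsOpen J) (hK : IsOpen K) (h : EqOn Φ Ψ (box I J K))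
    (hΦ : IsEquivalenceTransformation I J K Φ) : IsEquivalenceTransformation I J K Ψ where
  smooth := hΦ.smooth.congr h.symm
  nondegenerate := fun p hp => by
    rw [← (h.eventuallyEq_of_mem ((isOpen_box hI hJ hK).mem_nhds hp)).fderiv_eq]
    exact hΦ.nondegenerate p hp
  injective := hΦ.injective.congr h
  maps_class := by
    intro θ hθ
    obtain ⟨θ', h1, h2⟩ := hΦ.maps_class θ hθ
    have : (fun p => (Ψ p).1) '' box I J K = (fun p => (Φ p).1) '' box I J K :=
      image_congr fun p hp => by rw [h hp]
    rw [this]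
    exact ⟨θ', h1, h2.congr (isOpen_box hI hJ hK) h⟩

/-! ### Perturbation of the transformed function -/

theorem surjective_of_det_ne_zero {L : Base →L[ℝ] Base} (h : L.det ≠ 0) :
    Function.Surjective L :=
  LinearMap.injective_iff_surjective.1 ((det_ne_zero_iff_injective L).1 h)

theorem clm_apply_eq {F : Type*} [NormedAddCommGroup F] [NormedSpace ℝ F] (L : Base →L[ℝ] F)
    (a b c : ℝ) : L (a, b, c) = a • L (1, 0, 0) + b • L (0, 1, 0) + c • L (0, 0, 1) := by
  have : ((a, b, c) : Base) = a • ((1, 0, 0) : Base) + b • ((0, 1, 0) : Base)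
    + c • ((0, 0, 1) : Base) := by simp
  rw [this, map_add, map_add, map_smul, map_smul, map_smul]

/-- First-order effect on the transform `v` of `u` of the replacement of `u` by `u + δ`. -/
theorem exists_transform_perturbation {Φ : Base → Base} {u δ v : ℝ × ℝ → ℝ} {q : ℝ × ℝ}
    (hΦ : ContDiffAt ℝ ∞ Φ (q.1, q.2, u q)) (hΦd : (fderiv ℝ Φ (q.1, q.2, u q)).det ≠ 0)
    (hu : ContDiffAt ℝ ∞ u q) (hδ : ContDiffAt ℝ ∞ δ q) (hδ0 : δ q = 0)
    (hdet : (fderiv ℝ (inducedMap Φ (u + δ)) q).det ≠ 0)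
    (hv : ContDiffAt ℝ ∞ v (inducedMap Φ u q))
    (huv : ∀ᶠ q' in 𝓝 q, v (inducedMap Φ u q') = (Φ (q'.1, q'.2, u q')).2.2) :
    ∃ (g : ℝ × ℝ → ℝ × ℝ) (v' : ℝ × ℝ → ℝ) (κ : ℝ), κ ≠ 0 ∧
      ContDiffAt ℝ ∞ g (inducedMap Φ u q) ∧ g (inducedMap Φ u q) = q ∧
      (∀ᶠ z in 𝓝 (inducedMap Φ u q), inducedMap Φ (u + δ) (g z) = z) ∧
      ContDiffAt ℝ ∞ v' (inducedMap Φ u q) ∧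
      (∀ᶠ q' in 𝓝 q, v' (inducedMap Φ (u + δ) q') = (Φ (q'.1, q'.2, (u + δ) q')).2.2) ∧
      (fun z => v' z - v z - κ * δ (g z)) =o[𝓝 (inducedMap Φ u q)] fun z => δ (g z) := by
  have hz : inducedMap Φ (u + δ) q = inducedMap Φ u q := by simp [inducedMap, hδ0]
  have hΦ' : ContDiffAt ℝ ∞ Φ (q.1, q.2, (u + δ) q) := by simpa [hδ0] using hΦ
  have huδ : ContDiffAt ℝ ∞ (u + δ) q := hu.add hδ
  obtain ⟨g, hg, hgq, hgr, hgl⟩ :=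
    exists_localInverse (contDiffAt_inducedMap hΦ' huδ) hdet
  rw [hz] at hg hgq hgr
  set z₀ := inducedMap Φ u q with hz₀
  set p : Base := (q.1, q.2, u q) with hp
  -- G is the height of the transformed point above the graph of v. It vanishes on the graph of u
  -- and equals v' - v on the graph of u + δ, so its first-order growth in the u-direction compares
  -- the two transforms.
  set G : Base → ℝ := fun w => (Φ w).2.2 - v ((Φ w).1, (Φ w).2.1) with hG
  have hGs : ContDiffAt ℝ ∞ G p := by
    have h1 : ContDiffAt ℝ ∞ (fun w => ((Φ w).1, (Φ w).2.1)) p := hΦ.fst.prodMk hΦ.snd.fst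
    exact hΦ.snd.snd.sub (ContDiffAt.comp p (g := v) hv h1)
  have hGst := hGs.hasStrictFDerivAt (n := ∞) (by simp)
  set G' := fderiv ℝ G p with hG'
  have hgr0 : ContDiffAt ℝ ∞ (fun q' : ℝ × ℝ => ((q'.1, q'.2, u q') : Base)) q :=
    contDiffAt_graph hu
  have hG0 : ∀ᶠ q' in 𝓝 q, G (q'.1, q'.2, u q') = 0 := huv.mono fun q' hq' => by
    simp only [hG, ← hq']; exact sub_self _
  -- The differential of G kills the tangent plane of the graph of u. If it also killed the
  -- u-direction it would be zero, whereas it equals 1 on the preimage of the vertical direction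
  -- under the invertible differential of Φ.
  have hκ : G' (0, 0, 1) ≠ 0 := by
    intro h0
    obtain ⟨w, hw⟩ := surjective_of_det_ne_zero hΦd (0, 0, 1)
    have h1 : HasFDerivAt G ((ContinuousLinearMap.snd ℝ ℝ ℝ).comp
        ((ContinuousLinearMap.snd ℝ ℝ (ℝ × ℝ)).comp (fderiv ℝ Φ p)) - (fderiv ℝ v z₀).comp
        (((ContinuousLinearMap.fst ℝ ℝ (ℝ × ℝ)).comp (fderiv ℝ Φ p)).prod
          ((ContinuousLinearMap.fst ℝ ℝ ℝ).comp
            ((ContinuousLinearMap.snd ℝ ℝ (ℝ × ℝ)).comp (fderiv ℝ Φ p))))) p := by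
      have hd := (hΦ.differentiableAt (by simp)).hasFDerivAt
      exact hd.snd.snd.sub (HasFDerivAt.comp p (g := v)
        (hv.differentiableAt (by simp)).hasFDerivAt (hd.fst.prodMk hd.snd.fst))
    have h2 : G' w = 1 := by
      rw [hG', h1.fderiv]
      simp only [hw, sub_apply, ContinuousLinearMap.comp_apply, ContinuousLinearMap.prod_apply,
        ContinuousLinearMap.coe_fst', ContinuousLinearMap.coe_snd', sub_eq_self]
      exact map_zero (fderiv ℝ v z₀)
    have h3 : HasFDerivAt (fun q' : ℝ × ℝ => G (q'.1, q'.2, u q'))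
        (G'.comp ((ContinuousLinearMap.fst ℝ ℝ ℝ).prod
          ((ContinuousLinearMap.snd ℝ ℝ ℝ).prod (fderiv ℝ u q)))) q :=
      HasFDerivAt.comp q (g := G) hGst.hasFDerivAt
        (hasFDerivAt_fst.prodMk (hasFDerivAt_snd.prodMk
          (hu.differentiableAt (by simp)).hasFDerivAt))
    have h4 : HasFDerivAt (fun q' : ℝ × ℝ => G (q'.1, q'.2, u q')) (0 : ℝ × ℝ →L[ℝ] ℝ) q :=
      (hasFDerivAt_const (0 : ℝ) q).congr_of_eventuallyEq hG0
    have h5 := DFunLike.congr_fun (h3.unique h4) (w.1, w.2.1)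
    have h6 : w = (w.1, w.2.1, fderiv ℝ u q (w.1, w.2.1))
        + (w.2.2 - fderiv ℝ u q (w.1, w.2.1)) • ((0, 0, 1) : Base) := by
      ext <;> simp
    rw [h6, map_add, map_smul, h0] at h2
    simp at h5
    simp [h5] at h2
  refine ⟨g, fun z => (Φ ((g z).1, (g z).2, (u + δ) (g z))).2.2, G' (0, 0, 1), hκ, hg, hgq, hgr,
    ?_, hgl.mono fun q' hq' => by simp only [hq'], ?_⟩
  · have h2 : ContDiffAt ℝ ∞ (fun q' : ℝ × ℝ => (Φ (q'.1, q'.2, (u + δ) q')).2.2) q :=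
      (ContDiffAt.comp q (g := Φ) hΦ' (contDiffAt_graph huδ)).snd.snd
    rw [← hgq] at h2
    exact h2.comp _ hg
  · have hgc : Tendsto g (𝓝 z₀) (𝓝 q) := by
      have := hg.continuousAt.tendsto
      rwa [hgq] at this
    have hlim : Tendsto (fun z => ((((g z).1, (g z).2, (u + δ) (g z)) : Base),
        (((g z).1, (g z).2, u (g z)) : Base))) (𝓝 z₀) (𝓝 (p, p)) := by
      have e1 : Tendsto (fun q' : ℝ × ℝ => ((q'.1, q'.2, (u + δ) q') : Base)) (𝓝 q) (𝓝 p) := by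
        have := (contDiffAt_graph huδ).continuousAt.tendsto
        simpa [hδ0, hp] using this
      exact (e1.comp hgc).prodMk_nhds (hgr0.continuousAt.tendsto.comp hgc)
    -- Strict differentiability is needed because both of the compared points move with z.
    have h1 := (hasStrictFDerivAt_iff_isLittleO.1 hGst).comp_tendsto hlim
    refine (h1.congr' ?_ (Eventually.of_forall fun z => rfl)).trans_isBigO ?_
    · filter_upwards [hgc.eventually hG0, hgr] with z hz1 hz2
      have e1 : G ((g z).1, (g z).2, (u + δ) (g z))
          = (Φ ((g z).1, (g z).2, (u + δ) (g z))).2.2 - v z := by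
        simp only [hG]
        congr 2
      have e2 : (((g z).1, (g z).2, (u + δ) (g z)) : Base) - ((g z).1, (g z).2, u (g z))
          = δ (g z) • ((0, 0, 1) : Base) := by
        ext <;> simp
      simp only [Function.comp_apply, e1, e2, hz1, map_smul, smul_eq_mul]
      ring
    · refine IsBigO.of_bound 1 (Eventually.of_forall fun z => ?_)
      simp [Prod.norm_def]

theorem dx_iterate_eq_of_isLittleO {v v' : ℝ × ℝ → ℝ} {z : ℝ × ℝ} {c : ℝ} {n : ℕ}
    (hv : ContDiffAt ℝ ∞ v z) (hv' : ContDiffAt ℝ ∞ v' z)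
    (h : (fun s => v' (z.1, s) - v (z.1, s) - c * (s - z.2) ^ n) =o[𝓝 z.2]
      fun s => (s - z.2) ^ n) {k : ℕ} (hk : k ≤ n) :
    dx^[k] v' z = dx^[k] v z + if k = n then n.factorial * c else 0 := by
  have hl : ∀ {w : ℝ × ℝ → ℝ}, ContDiffAt ℝ ∞ w z → ∀ m : ℕ,
      ContDiffAt ℝ m (fun s => w (z.1, s)) z.2 := fun hw m =>
    ContDiffAt.comp z.2 (hw.of_le (by exact_mod_cast le_top)) (by fun_prop)
  have h1 := iteratedDeriv_eq_of_isLittleO ((hl hv' n).sub (hl hv n)) h hk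
  have h2 : iteratedDeriv k ((fun s => v' (z.1, s)) - fun s => v (z.1, s)) z.2 = _ := h1
  rw [iteratedDeriv_sub (hl hv' k) (hl hv k)] at h2
  rw [dx_iterate_apply, dx_iterate_apply, ← h2]; ring

theorem dt_eq_of_isLittleO {v v' : ℝ × ℝ → ℝ} {z : ℝ × ℝ} {c : ℝ}
    (hv : ContDiffAt ℝ ∞ v z) (hv' : ContDiffAt ℝ ∞ v' z)
    (h : (fun s => v' (s, z.2) - v (s, z.2) - c * (s - z.1)) =o[𝓝 z.1] fun s => s - z.1) :
    dt v' z = dt v z + c := by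
  have hl : ∀ {w : ℝ × ℝ → ℝ}, ContDiffAt ℝ ∞ w z →
      ContDiffAt ℝ (1 : ℕ) (fun s => w (s, z.2)) z.1 := fun hw =>
    ContDiffAt.comp z.1 (hw.of_le (by exact_mod_cast le_top)) (by fun_prop)
  have h1 := iteratedDeriv_eq_of_isLittleO (n := 1) (c := c) ((hl hv').sub (hl hv))
    (by simpa using h) le_rfl
  have h2 : iteratedDeriv 1 ((fun s => v' (s, z.2)) - fun s => v (s, z.2)) z.1 = _ := h1
  rw [iteratedDeriv_sub (hl hv') (hl hv)] at h2
  simp only [iteratedDeriv_one] at h2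
  simp only [dt]
  simp at h2
  linarith

/-- If `u` and its perturbation `u + δ` solve the equation at a point, so do their transforms,
and the perturbation of the transform has no effect on the left-hand side. -/
theorem MapsEquation.exists_perturbation {Φ : Base → Base} {D : Set Base} {θ θ' : ℝ → Coeff}
    (hM : MapsEquation Φ D θ θ') {u δ : ℝ × ℝ → ℝ} {q : ℝ × ℝ}
    (hΦ : ContDiffAt ℝ ∞ Φ (q.1, q.2, u q)) (hΦd : (fderiv ℝ Φ (q.1, q.2, u q)).det ≠ 0)
    (hD : (q.1, q.2, u q) ∈ D)
    (hu : ContDiffAt ℝ ∞ u q) (hδ : ContDiffAt ℝ ∞ δ q) (hδ0 : δ q = 0)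
    (hdet : (fderiv ℝ (inducedMap Φ u) q).det ≠ 0)
    (hdet' : (fderiv ℝ (inducedMap Φ (u + δ)) q).det ≠ 0)
    (h1 : lhs (θ q.1) u q = 0) (h2 : lhs (θ q.1) (u + δ) q = 0) :
    ∃ g : ℝ × ℝ → ℝ × ℝ, ContDiffAt ℝ ∞ g (inducedMap Φ u q) ∧ g (inducedMap Φ u q) = q ∧
      (∀ᶠ z in 𝓝 (inducedMap Φ u q), inducedMap Φ (u + δ) (g z) = z) ∧
      ∀ c d : ℝ,
        (fun s => δ (g ((inducedMap Φ u q).1, s)) - c * (s - (inducedMap Φ u q).2) ^ 5)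
          =o[𝓝 (inducedMap Φ u q).2] (fun s => (s - (inducedMap Φ u q).2) ^ 5) →
        (fun s => δ (g (s, (inducedMap Φ u q).2)) - d * (s - (inducedMap Φ u q).1))
          =o[𝓝 (inducedMap Φ u q).1] (fun s => s - (inducedMap Φ u q).1) →
        d + 120 * c * θ' (inducedMap Φ u q).1 0 = 0 := by
  obtain ⟨v, hv, huv⟩ := exists_transform hΦ hu hdet
  obtain ⟨g, v', κ, hκ, hg, hgq, hgr, hv', huv', hW⟩ :=
    exists_transform_perturbation hΦ hΦd hu hδ hδ0 hdet' hv huv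
  refine ⟨g, hg, hgq, hgr, fun c d hc hd => ?_⟩
  have hz : inducedMap Φ (u + δ) q = inducedMap Φ u q := by simp [inducedMap, hδ0]
  have l1 := (hM u v q hu hD hdet hv huv).1 h1
  have l2 := (hM (u + δ) v' q (hu.add hδ) (by simpa [hδ0] using hD) hdet' (by rwa [hz])
    huv').1 h2
  rw [hz] at l2
  set z₀ := inducedMap Φ u q
  have hx : (fun s => v' (z₀.1, s) - v (z₀.1, s) - κ * c * (s - z₀.2) ^ 5) =o[𝓝 z₀.2]
      fun s => (s - z₀.2) ^ 5 := by
    have hO : (fun s => δ (g (z₀.1, s))) =O[𝓝 z₀.2] fun s => (s - z₀.2) ^ 5 :=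
      (hc.isBigO.add ((isBigO_refl (fun s : ℝ => (s - z₀.2) ^ 5) _).const_mul_left c)).congr_left
        fun s => by ring
    have hl : Tendsto (fun s => (z₀.1, s)) (𝓝 z₀.2) (𝓝 z₀) :=
      Continuous.tendsto (by fun_prop) z₀.2
    exact (((hW.comp_tendsto hl).trans_isBigO hO).add (hc.const_mul_left κ)).congr_left
      fun s => by simp only [Function.comp_apply]; ring
  have ht : (fun s => v' (s, z₀.2) - v (s, z₀.2) - κ * d * (s - z₀.1)) =o[𝓝 z₀.1]
      fun s => s - z₀.1 := by
    have hO : (fun s => δ (g (s, z₀.2))) =O[𝓝 z₀.1] fun s => s - z₀.1 :=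
      (hd.isBigO.add ((isBigO_refl (fun s : ℝ => s - z₀.1) _).const_mul_left d)).congr_left
        fun s => by ring
    have hl : Tendsto (fun s => (s, z₀.2)) (𝓝 z₀.1) (𝓝 z₀) :=
      Continuous.tendsto (by fun_prop) z₀.1
    exact (((hW.comp_tendsto hl).trans_isBigO hO).add (hd.const_mul_left κ)).congr_left
      fun s => by simp only [Function.comp_apply]; ring
  -- The difference of the transforms is of fifth order in x̃, so of all the derivatives in the
  -- equation only the fifth x̃-derivative and the t̃-derivative change, by 120 κ c and κ d.
  have hdx := fun (k : ℕ) (hk : k ≤ 5) => dx_iterate_eq_of_isLittleO hv hv' hx hk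
  have e0 : v' z₀ = v z₀ := by simpa using hdx 0 (by norm_num)
  have e1 : dx v' z₀ = dx v z₀ := by simpa using hdx 1 (by norm_num)
  rw [lhs, dt_eq_of_isLittleO hv hv' ht, hdx 5 le_rfl, hdx 3 (by norm_num), hdx 2 (by norm_num),
    e0, e1] at l2
  rw [lhs] at l1
  have : κ * (d + 120 * c * θ' z₀.1 0) = 0 := by
    have h5 : ((5).factorial : ℝ) = 120 := by norm_num [Nat.factorial]
    rw [if_pos rfl, if_neg (by norm_num), if_neg (by norm_num), h5] at l2
    linear_combination l2 - l1
  exact (mul_eq_zero.1 this).resolve_left hκ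

theorem isLittleO_pow_of_hasDerivAt {f : ℝ → ℝ} {m s₀ : ℝ} (hf : HasDerivAt f m s₀) (n : ℕ) :
    (fun s => (f s - f s₀) ^ (n + 1) - m ^ (n + 1) * (s - s₀) ^ (n + 1)) =o[𝓝 s₀]
      fun s => (s - s₀) ^ (n + 1) := by
  have h0 : (fun s => f s - f s₀ - m * (s - s₀)) =o[𝓝 s₀] fun s => s - s₀ :=
    (hasDerivAt_iff_isLittleO.1 hf).congr_left fun s => by simp [mul_comm]
  have hO : (fun s => f s - f s₀) =O[𝓝 s₀] fun s => s - s₀ := hf.isBigO_sub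
  induction n with
  | zero => simpa using h0
  | succ n ih =>
    have h1 := (hO.pow (n + 1)).mul_isLittleO h0
    have h2 := ih.mul_isBigO ((isBigO_refl (fun s : ℝ => s - s₀) (𝓝 s₀)).const_mul_left m)
    exact ((h1.add (h2.congr_right fun s => rfl)).congr_left fun s => by ring).congr_right
      fun s => by ring

theorem isLittleO_pow_succ_sub (s₀ : ℝ) (n : ℕ) :
    (fun s : ℝ => (s - s₀) ^ (n + 2)) =o[𝓝 s₀] fun s => s - s₀ := by
  have h := isLittleO_pow_sub_sub (E' := ℝ) s₀ (show 1 < n + 2 by omega)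
  exact isLittleO_norm_left.1 (h.congr_left fun s => (norm_pow _ _).symm)

/-! ### The time and space components of an equivalence transformation -/

/-- Two nonzero polynomials have a common non-zero point. If b = 0 both are affine in z alone, each
with at most one zero, so one of z = 0, 1, 2 works; otherwise z is chosen for the second factor and
then y for the first. It serves to pick u_t = y and u_x = z. -/
theorem exists_ne_zero_and_ne_zero {a b c d e : ℝ} (h : a ≠ 0 ∨ b ≠ 0 ∨ c ≠ 0)
    (h' : d ≠ 0 ∨ e ≠ 0) : ∃ y z : ℝ, a + b * y + c * z ≠ 0 ∧ d + e * z ≠ 0 := by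
  by_contra! H
  have H' : ∀ y z : ℝ, a + b * y + c * z = 0 ∨ d + e * z = 0 := fun y z => by
    by_cases hz : a + b * y + c * z = 0
    · exact Or.inl hz
    · exact Or.inr (H y z hz)
  by_cases hb : b = 0
  · have k0 := H' 0 0
    have k1 := H' 0 1
    have k2 := H' 0 2
    subst hb
    have ha : ∀ {p q : ℝ}, p ≠ q → a + 0 * 0 + c * p = 0 → a + 0 * 0 + c * q = 0 →
        a = 0 ∧ c = 0 := by
      intro p q hpq h1 h2
      have hc : c = 0 := (mul_eq_zero.1 (show (p - q) * c = 0 by linarith)).resolve_left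
        (sub_ne_zero.2 hpq)
      exact ⟨by rw [hc] at h1; linarith, hc⟩
    have hd : ∀ {p q : ℝ}, p ≠ q → d + e * p = 0 → d + e * q = 0 → d = 0 ∧ e = 0 := by
      intro p q hpq h1 h2
      have hc : e = 0 := (mul_eq_zero.1 (show (p - q) * e = 0 by linarith)).resolve_left
        (sub_ne_zero.2 hpq)
      exact ⟨by rw [hc] at h1; linarith, hc⟩
    have ha' : ¬ (a = 0 ∧ c = 0) := by tauto
    have hd' : ¬ (d = 0 ∧ e = 0) := by tauto
    rcases k0 with k0 | k0 <;> rcases k1 with k1 | k1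
    · exact ha' (ha zero_ne_one k0 k1)
    · rcases k2 with k2 | k2
      · exact ha' (ha two_ne_zero.symm k0 k2)
      · exact hd' (hd (by norm_num) k1 k2)
    · rcases k2 with k2 | k2
      · exact ha' (ha (by norm_num) k1 k2)
      · exact hd' (hd two_ne_zero.symm k0 k2)
    · exact hd' (hd zero_ne_one k0 k1)
  · obtain ⟨z, hz⟩ : ∃ z, d + e * z ≠ 0 := by
      by_contra! hz
      have z0 := hz 0
      have z1 := hz 1
      rcases h' with h' | h'
      · apply h'; linarith
      · apply h'; linarith
    have y0 := (H' 0 z).resolve_right hz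
    have y1 := (H' 1 z).resolve_right hz
    apply hb; linarith

/-- These are the coefficients of 1, y, z in the Jacobian determinant of (t̃, x̃) along a graph with
u_t = y and u_x = z; the yz-terms cancel. If all vanished, the first two components of L would have
rank below two, against surjectivity. -/
theorem minors_ne_zero {L : Base →L[ℝ] Base} (hL : L.det ≠ 0) :
    (L (1, 0, 0)).1 * (L (0, 1, 0)).2.1 - (L (0, 1, 0)).1 * (L (1, 0, 0)).2.1 ≠ 0 ∨
    (L (0, 0, 1)).1 * (L (0, 1, 0)).2.1 - (L (0, 1, 0)).1 * (L (0, 0, 1)).2.1 ≠ 0 ∨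
    (L (1, 0, 0)).1 * (L (0, 0, 1)).2.1 - (L (0, 0, 1)).1 * (L (1, 0, 0)).2.1 ≠ 0 := by
  by_contra! H
  obtain ⟨h1, h2, h3⟩ := H
  obtain ⟨⟨a, b, c⟩, hv⟩ := surjective_of_det_ne_zero hL (1, 0, 0)
  obtain ⟨⟨a', b', c'⟩, hw⟩ := surjective_of_det_ne_zero hL (0, 1, 0)
  rw [clm_apply_eq] at hv hw
  simp only [Prod.ext_iff, Prod.fst_add, Prod.snd_add, Prod.smul_fst, Prod.smul_snd,
    smul_eq_mul] at hv hw
  obtain ⟨v1, v2, -⟩ := hv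
  obtain ⟨w1, w2, -⟩ := hw
  set T1 := (L (1, 0, 0)).1
  set T2 := (L (0, 1, 0)).1
  set T3 := (L (0, 0, 1)).1
  set X1 := (L (1, 0, 0)).2.1
  set X2 := (L (0, 1, 0)).2.1
  set X3 := (L (0, 0, 1)).2.1
  have : (a * T1 + b * T2 + c * T3) * (a' * X1 + b' * X2 + c' * X3)
      - (a' * T1 + b' * T2 + c' * T3) * (a * X1 + b * X2 + c * X3) = 0 := by
    linear_combination (a * b' - a' * b) * h1 + (c * b' - c' * b) * h2 + (a * c' - a' * c) * h3
  rw [v1, v2, w1, w2] at this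
  norm_num at this

theorem det_inducedMap_ne_zero {Φ : Base → Base} {u : ℝ × ℝ → ℝ} {q : ℝ × ℝ}
    (hΦ : DifferentiableAt ℝ Φ (q.1, q.2, u q)) (hu : DifferentiableAt ℝ u q)
    (h : ∀ L, L = fderiv ℝ Φ (q.1, q.2, u q) →
      ((L (1, 0, 0)).1 + dt u q * (L (0, 0, 1)).1) *
        ((L (0, 1, 0)).2.1 + dx u q * (L (0, 0, 1)).2.1) -
      ((L (0, 1, 0)).1 + dx u q * (L (0, 0, 1)).1) *
        ((L (1, 0, 0)).2.1 + dt u q * (L (0, 0, 1)).2.1) ≠ 0) :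
    (fderiv ℝ (inducedMap Φ u) q).det ≠ 0 := by
  apply det_ne_zero_of_apply
  rw [fderiv_inducedMap hΦ hu, fderiv_inducedMap hΦ hu, clm_apply_eq _ 1 0,
    clm_apply_eq _ 0 1 (0 * dt u q + 1 * dx u q)]
  simpa using h _ rfl

/-- The coefficients of `u_t + u_xxxxx + u u_xxx + e u u_x + f u_x u_xx = 0`. -/
def testCoeff (e f : ℝ) : ℝ → Coeff := fun _ => ![1, 0, 1, e, f, 0]

theorem isClassCoeff_testCoeff (S : Set ℝ) (e f : ℝ) : IsClassCoeff S (testCoeff e f) :=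
  ⟨contDiffOn_const, fun _ _ => by simp [testCoeff, admissible]⟩

theorem lhs_testCoeff_jetFun (e f t : ℝ) (q : ℝ × ℝ) (a : ℝ) (p : ℕ → ℝ) :
    lhs (testCoeff e f t) (jetFun q a p) q =
      a + p 5 + p 0 * p 3 + e * p 0 * p 1 + f * p 1 * p 2 := by
  rw [lhs_jetFun]; simp [testCoeff, Matrix.cons_val]

/-- A family of derivatives of order up to five. -/
def jet (p0 p1 p2 p3 p4 p5 : ℝ) : ℕ → ℝ := fun n =>
  match n with
  | 0 => p0 | 1 => p1 | 2 => p2 | 3 => p3 | 4 => p4 | 5 => p5 | _ => 0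

section Necessity

variable {I J K : Set ℝ} {Φ : Base → Base}

theorem IsEquivalenceTransformation.contDiffAt (h : IsEquivalenceTransformation I J K Φ)
    (hI : IsOpen I) (hJ : IsOpen J) (hK : IsOpen K) {p : Base} (hp : p ∈ box I J K) :
    ContDiffAt ℝ ∞ Φ p := h.smooth.contDiffAt ((isOpen_box hI hJ hK).mem_nhds hp)

theorem dt_add_apply {u δ : ℝ × ℝ → ℝ} {q : ℝ × ℝ} (hu : DifferentiableAt ℝ u q)
    (hδ : DifferentiableAt ℝ δ q) : dt (u + δ) q = dt u q + dt δ q := by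
  rw [dt_eq_fderiv (hu.add hδ), dt_eq_fderiv hu, dt_eq_fderiv hδ, fderiv_add hu hδ]; rfl

theorem hasDerivAt_fst_line {F : Type*} [NormedAddCommGroup F] [NormedSpace ℝ F]
    {g : ℝ × ℝ → F} {z : ℝ × ℝ} {G : ℝ × ℝ →L[ℝ] F} (hg : HasFDerivAt g G z) :
    HasDerivAt (fun s => g (z.1, s)) (G (0, 1)) z.2 := by
  have e : HasDerivAt (fun s : ℝ => (z.1, s)) ((0 : ℝ), (1 : ℝ)) z.2 :=
    (hasDerivAt_const _ _).prodMk (hasDerivAt_id _)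
  exact HasFDerivAt.comp_hasDerivAt z.2 (f := fun s : ℝ => (z.1, s)) hg e

theorem hasDerivAt_snd_line {F : Type*} [NormedAddCommGroup F] [NormedSpace ℝ F]
    {g : ℝ × ℝ → F} {z : ℝ × ℝ} {G : ℝ × ℝ →L[ℝ] F} (hg : HasFDerivAt g G z) :
    HasDerivAt (fun s => g (s, z.2)) (G (1, 0)) z.1 := by
  have e : HasDerivAt (fun s : ℝ => (s, z.2)) ((1 : ℝ), (0 : ℝ)) z.1 :=
    (hasDerivAt_id _).prodMk (hasDerivAt_const _ _)
  exact HasFDerivAt.comp_hasDerivAt z.1 (f := fun s : ℝ => (s, z.2)) hg e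

theorem fderiv_localInverse_apply {F g : ℝ × ℝ → ℝ × ℝ} {z q : ℝ × ℝ} {G : ℝ × ℝ →L[ℝ] ℝ × ℝ}
    (hF : DifferentiableAt ℝ F q) (hg : HasFDerivAt g G z) (hgq : g z = q)
    (h : ∀ᶠ y in 𝓝 z, F (g y) = y) (w : ℝ × ℝ) : fderiv ℝ F q (G w) = w := by
  have e1 : HasFDerivAt F (fderiv ℝ F q) (g z) := by rw [hgq]; exact hF.hasFDerivAt
  have e3 := (hasFDerivAt_id (𝕜 := ℝ) z).congr_of_eventuallyEq h
  simpa using DFunLike.congr_fun ((e1.comp z hg).unique e3) w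

/-- If t̃ depended on x or u, some slope z would give D_x t̃ ≠ 0, and the inverse of the induced map
would make t vary along the x̃-direction. Then δ = (t - t₀)^5, which leaves the old equation
untouched at the point, would contribute to the fifth x̃-derivative, where the coefficient is
nonzero. -/
theorem IsEquivalenceTransformation.fderiv_time (h : IsEquivalenceTransformation I J K Φ)
    (hI : IsOpen I) (hJ : IsOpen J) (hK : IsOpen K) {p : Base} (hp : p ∈ box I J K) :
    (fderiv ℝ Φ p (0, 1, 0)).1 = 0 ∧ (fderiv ℝ Φ p (0, 0, 1)).1 = 0 := by
  by_contra hne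
  have hne' : (fderiv ℝ Φ p (0, 1, 0)).1 ≠ 0 ∨ (fderiv ℝ Φ p (0, 0, 1)).1 ≠ 0 := by tauto
  obtain ⟨θ', hθ', hM⟩ := h.maps_class _ (isClassCoeff_testCoeff I 0 0)
  -- The first condition makes the graph transversal, so that the transform exists; the second says
  -- D_x t̃ ≠ 0.
  obtain ⟨y, z, hyz, hz⟩ := exists_ne_zero_and_ne_zero
    (minors_ne_zero (h.nondegenerate p hp)) hne'
  obtain ⟨t, x, w⟩ := p
  set L := fderiv ℝ Φ (t, x, w) with hL
  set u := jetFun (t, x) y (jet w z 0 0 0 (-y)) with hu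
  set δ : ℝ × ℝ → ℝ := fun q => (q.1 - t) ^ 5 with hδ
  have hus : ContDiffAt ℝ ∞ u (t, x) := (contDiff_jetFun _ _ _).contDiffAt
  have hδs : ContDiffAt ℝ ∞ δ (t, x) := by rw [hδ]; fun_prop
  have hu0 : u (t, x) = w := jetFun_self _ _ _
  have hΦ : ContDiffAt ℝ ∞ Φ (t, x, u (t, x)) := by
    rw [hu0]; exact h.contDiffAt hI hJ hK hp
  have hδ0 : δ (t, x) = 0 := by simp [hδ]
  have hdxδ : ∀ n, dx^[n] (u + δ) (t, x) = dx^[n] u (t, x) := fun n => by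
    simp [dx_iterate_apply, hδ]
  have hdtδ : dt (u + δ) (t, x) = dt u (t, x) := by
    have : HasDerivAt (fun s : ℝ => (s - t) ^ 5) 0 t := by
      simpa using ((hasDerivAt_id t).sub_const t).fun_pow 5
    rw [dt_add_apply (hus.differentiableAt (by simp)) (hδs.differentiableAt (by simp))]
    simp only [dt, hδ, this.deriv, add_zero]
  have hdtu : dt u (t, x) = y := by rw [hu, dt_jetFun]
  have hdxu : dx u (t, x) = z := dx_iterate_jetFun (t, x) y _ (n := 1) (by norm_num)
  have hdxuδ : dx (u + δ) (t, x) = z := (hdxδ 1).trans hdxu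
  have huδ0 : (u + δ) (t, x) = w := by simp [hδ0, hu0]
  have hdet : (fderiv ℝ (inducedMap Φ u) (t, x)).det ≠ 0 := by
    refine det_inducedMap_ne_zero (hΦ.differentiableAt (by simp))
      (hus.differentiableAt (by simp)) ?_
    rintro _ rfl
    rw [hdtu, hdxu, hu0, ← hL]
    intro h0
    apply hyz
    linear_combination h0
  have hΦ' : ContDiffAt ℝ ∞ Φ (t, x, (u + δ) (t, x)) := by
    rw [huδ0]; exact h.contDiffAt hI hJ hK hp
  have huδs : ContDiffAt ℝ ∞ (u + δ) (t, x) := hus.add hδs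
  have hdet' : (fderiv ℝ (inducedMap Φ (u + δ)) (t, x)).det ≠ 0 := by
    refine det_inducedMap_ne_zero (hΦ'.differentiableAt (by simp))
      (huδs.differentiableAt (by simp)) ?_
    rintro _ rfl
    rw [hdtδ, hdtu, hdxuδ, huδ0, ← hL]
    intro h0
    apply hyz
    linear_combination h0
  have hl : lhs (testCoeff 0 0 t) u (t, x) = 0 := by
    rw [hu, lhs_testCoeff_jetFun]; simp [jet]
  have hl' : lhs (testCoeff 0 0 t) (u + δ) (t, x) = 0 := by
    have e : lhs (testCoeff 0 0 t) (u + δ) (t, x) = lhs (testCoeff 0 0 t) u (t, x) := by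
      rw [lhs, lhs, hdtδ, hdxδ, hdxδ, hdxδ, hdxuδ, hdxu, huδ0, hu0]
    rw [e, hl]
  obtain ⟨g, hg, hgq, hgr, H⟩ := hM.exists_perturbation (q := (t, x)) hΦ
    (by rw [hu0]; exact h.nondegenerate _ hp) (by rw [hu0]; exact hp) hus hδs hδ0 hdet hdet' hl hl'
  have hι : inducedMap Φ u (t, x) = ((Φ (t, x, w)).1, (Φ (t, x, w)).2.1) := by
    simp [inducedMap, hu0]
  have hιδ : inducedMap Φ (u + δ) (t, x) = inducedMap Φ u (t, x) := by simp [inducedMap, hδ0]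
  set z₀ := inducedMap Φ u (t, x) with hz₀
  have hgd := (hg.differentiableAt (by simp)).hasFDerivAt
  set G := fderiv ℝ g z₀ with hG
  have hgx := (hasDerivAt_fst_line hgd).fst
  have hgt := (hasDerivAt_snd_line hgd).fst
  have hgz : (g z₀).1 = t := by rw [hgq]
  have hm := isLittleO_pow_of_hasDerivAt hgx 4
  have hm' := isLittleO_pow_of_hasDerivAt hgt 4
  simp only [Prod.mk.eta, hgz] at hm hm'
  have hO : (fun s => ((g (s, z₀.2)).1 - t) ^ 5) =o[𝓝 z₀.1] fun s => s - z₀.1 := by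
    have h1 := isLittleO_pow_succ_sub z₀.1 3
    exact ((hm'.trans h1).add (h1.const_mul_left ((G (1, 0)).1 ^ 5))).congr_left fun s => by ring
  have hfin := H ((G (0, 1)).1 ^ 5) 0 hm (hO.congr_left fun s => by simp [hδ])
  have hA : θ' z₀.1 0 ≠ 0 := (hθ'.2 z₀.1 ⟨(t, x, w), hp, by rw [hι]⟩).1
  have hG1 : (G (0, 1)).1 = 0 := by
    have : (G (0, 1)).1 ^ 5 * θ' z₀.1 0 = 0 := by linarith
    simpa [hA] using this
  -- The differential of the inverse sends the x̃-direction to (0, G₂), so the time component of the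
  -- inverse relation is G₂ D_x t̃ = 0. Hence G₂ = 0, which is incompatible with the space component
  -- being 1.
  have hinv := fderiv_localInverse_apply
    ((contDiffAt_inducedMap (q := (t, x)) hΦ' huδs).differentiableAt (by simp)) hgd hgq hgr (0, 1)
  have hG2 : G (0, 1) = (0, (G (0, 1)).2) := by ext <;> simp [hG1]
  rw [hG2, fderiv_inducedMap (hΦ'.differentiableAt (by simp))
    (huδs.differentiableAt (by simp)), hdxuδ, huδ0, ← hL, clm_apply_eq] at hinv
  have hf := congrArg Prod.fst hinv
  have hs := congrArg Prod.snd hinv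
  simp at hf hs
  have : (G (0, 1)).2 * ((L (0, 1, 0)).1 + (L (0, 0, 1)).1 * z) = 0 := by linear_combination hf
  have h0 := (mul_eq_zero.1 this).resolve_right hz
  simp [h0] at hs

theorem IsEquivalenceTransformation.time_eq (h : IsEquivalenceTransformation I J K Φ)
    (hI : IsOpen I) (hJ : IsOpen J) (hJ' : J.OrdConnected) (hK : IsOpen K)
    (hK' : K.OrdConnected) {t x w x' w' : ℝ} (hp : (t, x, w) ∈ box I J K)
    (hp' : (t, x', w') ∈ box I J K) : (Φ (t, x, w)).1 = (Φ (t, x', w')).1 := by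
  have hd : ∀ {p : Base}, p ∈ box I J K → HasFDerivAt Φ (fderiv ℝ Φ p) p := fun hp =>
    ((h.contDiffAt hI hJ hK hp).differentiableAt (by simp)).hasFDerivAt
  have e1 : (Φ (t, x, w)).1 = (Φ (t, x', w)).1 := by
    refine eq_of_hasDerivAt_zero (f := fun y => (Φ (t, y, w)).1) hJ hJ' (fun y hy => ?_)
      hp.2.1 hp'.2.1
    have hb : (t, y, w) ∈ box I J K := ⟨hp.1, hy, hp.2.2⟩
    have e : HasDerivAt (fun s : ℝ => ((t, s, w) : Base)) (0, 1, 0) y :=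
      (hasDerivAt_const _ _).prodMk ((hasDerivAt_id _).prodMk (hasDerivAt_const _ _))
    rw [← (h.fderiv_time hI hJ hK hb).1]
    exact (HasFDerivAt.comp_hasDerivAt y (hd hb) e).fst
  have e2 : (Φ (t, x', w)).1 = (Φ (t, x', w')).1 := by
    refine eq_of_hasDerivAt_zero (f := fun y => (Φ (t, x', y)).1) hK hK' (fun y hy => ?_)
      hp.2.2 hp'.2.2
    have hb : (t, x', y) ∈ box I J K := ⟨hp.1, hp'.2.1, hy⟩
    have e : HasDerivAt (fun s : ℝ => ((t, x', s) : Base)) (0, 0, 1) y :=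
      (hasDerivAt_const _ _).prodMk ((hasDerivAt_const _ _).prodMk (hasDerivAt_id _))
    rw [← (h.fderiv_time hI hJ hK hb).2]
    exact (HasFDerivAt.comp_hasDerivAt y (hd hb) e).fst
  exact e1.trans e2

theorem IsEquivalenceTransformation.fderiv_time_ne_zero
    (h : IsEquivalenceTransformation I J K Φ) (hI : IsOpen I) (hJ : IsOpen J) (hK : IsOpen K)
    {p : Base} (hp : p ∈ box I J K) : (fderiv ℝ Φ p (1, 0, 0)).1 ≠ 0 := by
  intro h0
  obtain ⟨h1, h2⟩ := h.fderiv_time hI hJ hK hp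
  obtain ⟨⟨a, b, c⟩, hw⟩ := surjective_of_det_ne_zero (h.nondegenerate p hp) (1, 0, 0)
  rw [clm_apply_eq] at hw
  have := congrArg Prod.fst hw
  simp [h0, h1, h2] at this

/-- The perturbation (x - x₀)^5 - 120 (t - t₀) changes u_xxxxx by 120 and u_t by -120, so u_t +
u_xxxxx is preserved. After transformation the two changes are weighted by Ã/(D_x x̃)^5 and 1/t̃_t
and must still cancel. The function f is Ã; the right-hand side does not involve the slope z. -/
theorem IsEquivalenceTransformation.fderiv_space_pow (h : IsEquivalenceTransformation I J K Φ)
    (hI : IsOpen I) (hJ : IsOpen J) (hJ' : J.OrdConnected) (hK : IsOpen K)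
    (hK' : K.OrdConnected) :
    ∃ f : ℝ → ℝ, ∀ p ∈ box I J K, ∀ z : ℝ,
      (fderiv ℝ Φ p (0, 1, 0)).2.1 + z * (fderiv ℝ Φ p (0, 0, 1)).2.1 ≠ 0 →
      ((fderiv ℝ Φ p (0, 1, 0)).2.1 + z * (fderiv ℝ Φ p (0, 0, 1)).2.1) ^ 5 =
        f (Φ p).1 * (fderiv ℝ Φ p (1, 0, 0)).1 := by
  obtain ⟨θ', hθ', hM⟩ := h.maps_class _ (isClassCoeff_testCoeff I 0 0)
  refine ⟨fun y => θ' y 0, ?_⟩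
  rintro ⟨t, x, w⟩ hp z hz
  set L := fderiv ℝ Φ (t, x, w) with hL
  obtain ⟨hT1, hT2⟩ := h.fderiv_time hI hJ hK hp
  have hT0 := h.fderiv_time_ne_zero hI hJ hK hp
  rw [← hL] at hT0 hT1 hT2
  set u := jetFun (t, x) 0 (jet w z 0 0 0 0) with hu
  set δ : ℝ × ℝ → ℝ := fun q => (q.2 - x) ^ 5 - 120 * (q.1 - t) with hδ
  have huδ : u + δ = jetFun (t, x) (-120) (jet w z 0 0 0 120) := by
    ext q
    simp [hu, hδ, jetFun, Finset.sum_range_succ, jet, Nat.factorial]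
    ring
  have hus : ContDiffAt ℝ ∞ u (t, x) := (contDiff_jetFun _ _ _).contDiffAt
  have hδs : ContDiffAt ℝ ∞ δ (t, x) := by rw [hδ]; fun_prop
  have hu0 : u (t, x) = w := jetFun_self _ _ _
  have hδ0 : δ (t, x) = 0 := by simp [hδ]
  have huδ0 : (u + δ) (t, x) = w := by simp [hδ0, hu0]
  have huδs : ContDiffAt ℝ ∞ (u + δ) (t, x) := hus.add hδs
  have hΦ0 := h.contDiffAt hI hJ hK hp
  have hΦ : ContDiffAt ℝ ∞ Φ (t, x, u (t, x)) := by rwa [hu0]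
  have hΦ' : ContDiffAt ℝ ∞ Φ (t, x, (u + δ) (t, x)) := by rwa [huδ0]
  have hdxu : dx u (t, x) = z := dx_iterate_jetFun (t, x) 0 _ (n := 1) (by norm_num)
  have hdxuδ : dx (u + δ) (t, x) = z := by
    rw [huδ]; exact dx_iterate_jetFun (t, x) _ _ (n := 1) (by norm_num)
  have hdet : (fderiv ℝ (inducedMap Φ u) (t, x)).det ≠ 0 := by
    refine det_inducedMap_ne_zero (hΦ.differentiableAt (by simp))
      (hus.differentiableAt (by simp)) ?_
    rintro _ rfl
    rw [hdxu, hu0, ← hL, hT1, hT2]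
    simpa using ⟨hT0, hz⟩
  have hdet' : (fderiv ℝ (inducedMap Φ (u + δ)) (t, x)).det ≠ 0 := by
    refine det_inducedMap_ne_zero (hΦ'.differentiableAt (by simp))
      (huδs.differentiableAt (by simp)) ?_
    rintro _ rfl
    rw [hdxuδ, huδ0, ← hL, hT1, hT2]
    simpa using ⟨hT0, hz⟩
  have hl : lhs (testCoeff 0 0 t) u (t, x) = 0 := by
    rw [hu, lhs_testCoeff_jetFun]; simp [jet]
  have hl' : lhs (testCoeff 0 0 t) (u + δ) (t, x) = 0 := by
    rw [huδ, lhs_testCoeff_jetFun]; simp [jet]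
  obtain ⟨g, hg, hgq, hgr, H⟩ := hM.exists_perturbation (q := (t, x)) hΦ
    (by rw [hu0]; exact h.nondegenerate _ hp) (by rw [hu0]; exact hp) hus hδs hδ0 hdet hdet' hl hl'
  have hι : inducedMap Φ u (t, x) = ((Φ (t, x, w)).1, (Φ (t, x, w)).2.1) := by
    simp [inducedMap, hu0]
  set z₀ := inducedMap Φ u (t, x) with hz₀
  have hgd := (hg.differentiableAt (by simp)).hasFDerivAt
  set G := fderiv ℝ g z₀ with hG
  have hinv := fderiv_localInverse_apply
    ((contDiffAt_inducedMap (q := (t, x)) hΦ' huδs).differentiableAt (by simp)) hgd hgq hgr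
  have hinv' : ∀ e : ℝ × ℝ, (G e).1 * (L (1, 0, 0)).1 = e.1 := fun e => by
    have h1 := congrArg Prod.fst (hinv e)
    rw [show G e = ((G e).1, (G e).2) from rfl, fderiv_inducedMap
      (hΦ'.differentiableAt (by simp)) (huδs.differentiableAt (by simp)), huδ0, ← hL,
      clm_apply_eq] at h1
    simpa [hT1, hT2] using h1
  have hG1 : (G (0, 1)).1 = 0 := by simpa [hT0] using hinv' (0, 1)
  have hG2 : (G (0, 1)).2 * ((L (0, 1, 0)).2.1 + z * (L (0, 0, 1)).2.1) = 1 := by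
    have h1 := congrArg Prod.snd (hinv (0, 1))
    rw [show G (0, 1) = ((G (0, 1)).1, (G (0, 1)).2) from rfl, hG1, fderiv_inducedMap
      (hΦ'.differentiableAt (by simp)) (huδs.differentiableAt (by simp)), huδ0, ← hL, hdxuδ,
      clm_apply_eq] at h1
    simp at h1
    linear_combination h1
  have hG3 : (G (1, 0)).1 * (L (1, 0, 0)).1 = 1 := hinv' (1, 0)
  have hgx := (hasDerivAt_fst_line hgd).snd
  have hgt := (hasDerivAt_snd_line hgd).snd
  have hgt1 := (hasDerivAt_snd_line hgd).fst
  have hgz1 : (g z₀).1 = t := by rw [hgq]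
  have hgz : (g z₀).2 = x := by rw [hgq]
  have hm := isLittleO_pow_of_hasDerivAt hgx 4
  have hm' := isLittleO_pow_of_hasDerivAt hgt 4
  have hm1 := isLittleO_pow_of_hasDerivAt hgt1 0
  simp only [Prod.mk.eta, hgz, hgz1] at hm hm' hm1
  -- A fifth-order expansion along a line of constant t̃ requires the linear term of δ to vanish
  -- there exactly. It does: t̃ is a function of t alone and is injective near t, so t is constant
  -- on such a line.
  have htime : ∀ᶠ s in 𝓝 z₀.2, (g (z₀.1, s)).1 = t := by
    have hl : Tendsto (fun s => (z₀.1, s)) (𝓝 z₀.2) (𝓝 z₀) :=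
      Continuous.tendsto (by fun_prop) z₀.2
    have hgc : Tendsto (fun y => (g y).1) (𝓝 z₀) (𝓝 t) := by
      have := hg.continuousAt.fst.tendsto
      rwa [hgz1] at this
    have hTd : HasDerivAt (fun s => (Φ (s, x, w)).1) (L (1, 0, 0)).1 t := by
      have e : HasDerivAt (fun s : ℝ => ((s, x, w) : Base)) (1, 0, 0) t :=
        (hasDerivAt_id _).prodMk ((hasDerivAt_const _ _).prodMk (hasDerivAt_const _ _))
      have hL' : HasFDerivAt Φ L (t, x, w) := (hΦ0.differentiableAt (by simp)).hasFDerivAt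
      have hc : HasDerivAt (fun s => Φ (s, x, w)) (L (1, 0, 0)) t :=
        HasFDerivAt.comp_hasDerivAt (f := fun s : ℝ => ((s, x, w) : Base)) t hL' e
      exact hc.fst
    have hne := hTd.eventually_ne (c := (Φ (t, x, w)).1) hT0
    rw [eventually_nhdsWithin_iff] at hne
    have hbox : ∀ᶠ y in 𝓝 z₀, ((g y).1, (g y).2, (u + δ) (g y)) ∈ box I J K := by
      have hc : ContinuousAt (fun y => (((g y).1, (g y).2, (u + δ) (g y)) : Base)) z₀ := by
        have := (contDiffAt_graph huδs).continuousAt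
        rw [← hgq] at this
        exact this.comp hg.continuousAt
      refine hc.eventually_mem ((isOpen_box hI hJ hK).mem_nhds ?_)
      rw [hgq, huδ0]; exact hp
    filter_upwards [hl.eventually (hgc.eventually hne), hl.eventually hgr, hl.eventually hbox]
      with s h1 h2 h3
    by_contra hcon
    apply h1 hcon
    have h4 := congrArg Prod.fst h2
    simp only [inducedMap] at h4
    rw [← h.time_eq hI hJ hJ' hK hK' h3 (x' := x) (w' := w) ⟨h3.1, hp.2.1, hp.2.2⟩, h4, hι]
  have hc : (fun s => δ (g (z₀.1, s)) - (G (0, 1)).2 ^ 5 * (s - z₀.2) ^ 5) =o[𝓝 z₀.2]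
      fun s => (s - z₀.2) ^ 5 := by
    refine hm.congr' ?_ EventuallyEq.rfl
    filter_upwards [htime] with s hs
    simp [hδ, hs]
  have hd : (fun s => δ (g (s, z₀.2)) - (-120 * (G (1, 0)).1) * (s - z₀.1)) =o[𝓝 z₀.1]
      fun s => s - z₀.1 := by
    have h1 := isLittleO_pow_succ_sub z₀.1 3
    have h2 : (fun s => (g (s, z₀.2)).1 - t - (G (1, 0)).1 * (s - z₀.1)) =o[𝓝 z₀.1]
      fun s => s - z₀.1 := by simpa using hm1
    exact (((hm'.trans h1).add (h1.const_mul_left ((G (1, 0)).2 ^ 5))).add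
      (h2.const_mul_left (-120))).congr_left fun s => by simp only [hδ]; ring
  have hfin := H _ _ hc hd
  have e1 : z₀.1 = (Φ (t, x, w)).1 := by rw [hι]
  rw [e1] at hfin
  have h5 : ((G (0, 1)).2 * ((L (0, 1, 0)).2.1 + z * (L (0, 0, 1)).2.1)) ^ 5 = 1 := by
    rw [hG2]; norm_num
  set Xx := (L (0, 1, 0)).2.1 + z * (L (0, 0, 1)).2.1
  linear_combination (-Xx ^ 5 * (L (1, 0, 0)).1 / 120) * hfin - Xx ^ 5 * hG3
    + θ' (Φ (t, x, w)).1 0 * (L (1, 0, 0)).1 * h5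

/-- If x̃ depended on u, suitable slopes z would make D_x x̃ equal to 1 and to 2, and the
slope-independent right-hand side of `fderiv_space_pow` would be both 1 and 32. The remaining
nonvanishing is forced by the Jacobian. -/
theorem IsEquivalenceTransformation.fderiv_space (h : IsEquivalenceTransformation I J K Φ)
    (hI : IsOpen I) (hJ : IsOpen J) (hJ' : J.OrdConnected) (hK : IsOpen K)
    (hK' : K.OrdConnected) {p : Base} (hp : p ∈ box I J K) :
    (fderiv ℝ Φ p (0, 0, 1)).2.1 = 0 ∧ (fderiv ℝ Φ p (0, 1, 0)).2.1 ≠ 0 := by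
  obtain ⟨f, hf⟩ := h.fderiv_space_pow hI hJ hJ' hK hK'
  have h0 : (fderiv ℝ Φ p (0, 0, 1)).2.1 = 0 := by
    by_contra hne
    have k := hf p hp
    set b := (fderiv ℝ Φ p (0, 0, 1)).2.1
    set a := (fderiv ℝ Φ p (0, 1, 0)).2.1
    have e1 : a + (1 - a) / b * b = 1 := by field_simp; ring
    have e2 : a + (2 - a) / b * b = 2 := by field_simp; ring
    have k1 := k ((1 - a) / b) (by rw [e1]; norm_num)
    have k2 := k ((2 - a) / b) (by rw [e2]; norm_num)
    rw [e1] at k1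
    rw [e2] at k2
    linarith
  refine ⟨h0, fun h1 => ?_⟩
  obtain ⟨h2, h3⟩ := h.fderiv_time hI hJ hK hp
  have hm := minors_ne_zero (h.nondegenerate p hp)
  simp [h0, h1, h2, h3] at hm

/-- The first two components of an equivalence transformation. -/
theorem IsEquivalenceTransformation.exists_affine (h : IsEquivalenceTransformation I J K Φ)
    (hI : IsOpen I) (hJ : IsOpen J) (hJ' : J.OrdConnected) (hJ₀ : J.Nonempty) (hK : IsOpen K)
    (hK' : K.OrdConnected) (hK₀ : K.Nonempty) :
    ∃ α a b : ℝ → ℝ, ContDiffOn ℝ ∞ α I ∧ ContDiffOn ℝ ∞ a I ∧ ContDiffOn ℝ ∞ b I ∧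
      (∀ t ∈ I, deriv α t ≠ 0) ∧ (∀ t ∈ I, a t ≠ 0) ∧
      ∀ p ∈ box I J K, (Φ p).1 = α p.1 ∧ (Φ p).2.1 = a p.1 * p.2.1 + b p.1 := by
  obtain ⟨x₀, hx₀⟩ := id hJ₀
  obtain ⟨w₀, hw₀⟩ := hK₀
  obtain ⟨x₁, hx₁, hx₁'⟩ := (dense_compl_singleton x₀).inter_open_nonempty J hJ hJ₀
  have hne : x₁ - x₀ ≠ 0 := sub_ne_zero.2 hx₁'
  have hd : ∀ {p : Base}, p ∈ box I J K → HasFDerivAt Φ (fderiv ℝ Φ p) p := fun hp =>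
    ((h.contDiffAt hI hJ hK hp).differentiableAt (by simp)).hasFDerivAt
  have hs : ∀ {x w : ℝ}, x ∈ J → w ∈ K → ContDiffOn ℝ ∞ (fun t => Φ (t, x, w)) I :=
    fun {x w} hx hw => h.smooth.comp (by fun_prop) fun t ht => ⟨ht, hx, hw⟩
  obtain ⟨f, hf⟩ := h.fderiv_space_pow hI hJ hJ' hK hK'
  set A : ℝ → ℝ := fun t => (fderiv ℝ Φ (t, x₀, w₀) (0, 1, 0)).2.1 with hA
  have hXx : ∀ {t x}, t ∈ I → x ∈ J →
      HasDerivAt (fun y => (Φ (t, y, w₀)).2.1) (A t) x := by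
    intro t x ht hx
    have hb : (t, x, w₀) ∈ box I J K := ⟨ht, hx, hw₀⟩
    have hb₀ : (t, x₀, w₀) ∈ box I J K := ⟨ht, hx₀, hw₀⟩
    have e : HasDerivAt (fun s : ℝ => ((t, s, w₀) : Base)) (0, 1, 0) x :=
      (hasDerivAt_const _ _).prodMk ((hasDerivAt_id _).prodMk (hasDerivAt_const _ _))
    have e1 := (HasFDerivAt.comp_hasDerivAt x (hd hb) e).snd.fst
    -- The fifth power of x̃_x equals Ã(t̃) t̃_t, which depends on t only, and the real fifth power
    -- is injective.
    have e2 : (fderiv ℝ Φ (t, x, w₀) (0, 1, 0)).2.1 = A t := by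
      have k1 := hf _ hb 0
      have k2 := hf _ hb₀ 0
      simp only [zero_mul, add_zero] at k1 k2
      have k1' := k1 (h.fderiv_space hI hJ hJ' hK hK' hb).2
      have k2' := k2 (h.fderiv_space hI hJ hJ' hK hK' hb₀).2
      have e3 : (fderiv ℝ Φ (t, x, w₀) (1, 0, 0)).1 = (fderiv ℝ Φ (t, x₀, w₀) (1, 0, 0)).1 := by
        have e : ∀ y, HasDerivAt (fun s : ℝ => ((s, y, w₀) : Base)) (1, 0, 0) t := fun y =>
          (hasDerivAt_id _).prodMk ((hasDerivAt_const _ _).prodMk (hasDerivAt_const _ _))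
        have d1 : HasDerivAt (fun s => (Φ (s, x, w₀)).1)
            (fderiv ℝ Φ (t, x, w₀) (1, 0, 0)).1 t :=
          (HasFDerivAt.comp_hasDerivAt t (hd hb) (e x)).fst
        have d2 : HasDerivAt (fun s => (Φ (s, x₀, w₀)).1)
            (fderiv ℝ Φ (t, x₀, w₀) (1, 0, 0)).1 t :=
          (HasFDerivAt.comp_hasDerivAt t (hd hb₀) (e x₀)).fst
        refine d1.unique (d2.congr_of_eventuallyEq ?_)
        filter_upwards [hI.mem_nhds ht] with s hs
        exact h.time_eq hI hJ hJ' hK hK' ⟨hs, hx, hw₀⟩ ⟨hs, hx₀, hw₀⟩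
      rw [e3, h.time_eq hI hJ hJ' hK hK' hb hb₀, ← k2'] at k1'
      exact (Odd.strictMono_pow (by decide : Odd 5)).injective k1'
    rw [← e2]; exact e1
  have hXw : ∀ {t x w}, t ∈ I → x ∈ J → w ∈ K →
      (Φ (t, x, w)).2.1 = (Φ (t, x, w₀)).2.1 := by
    intro t x w ht hx hw
    refine eq_of_hasDerivAt_zero (f := fun y => (Φ (t, x, y)).2.1) hK hK' (fun y hy => ?_) hw hw₀
    have hb : (t, x, y) ∈ box I J K := ⟨ht, hx, hy⟩
    have e : HasDerivAt (fun s : ℝ => ((t, x, s) : Base)) (0, 0, 1) y :=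
      (hasDerivAt_const _ _).prodMk ((hasDerivAt_const _ _).prodMk (hasDerivAt_id _))
    rw [← (h.fderiv_space hI hJ hJ' hK hK' hb).1]
    exact (HasFDerivAt.comp_hasDerivAt y (hd hb) e).snd.fst
  have hX : ∀ {t x}, t ∈ I → x ∈ J →
      (Φ (t, x, w₀)).2.1 = (Φ (t, x₀, w₀)).2.1 + A t * (x - x₀) := by
    intro t x ht hx
    have := eq_of_hasDerivAt_zero (f := fun y => (Φ (t, y, w₀)).2.1 - A t * (y - x₀)) hJ hJ'
      (fun y hy => by
        simpa using (hXx ht hy).fun_sub (((hasDerivAt_id y).sub_const x₀).const_mul (A t))) hx hx₀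
    simp only [sub_self, mul_zero, sub_zero] at this
    linarith
  -- Writing the slope as a difference quotient makes its smoothness in t immediate.
  have hAq : ∀ t ∈ I, ((Φ (t, x₁, w₀)).2.1 - (Φ (t, x₀, w₀)).2.1) / (x₁ - x₀) = A t := by
    intro t ht
    rw [hX ht hx₁]
    field_simp
    ring
  have hAs : ContDiffOn ℝ ∞ A I :=
    (((hs hx₁ hw₀).snd.fst.sub (hs hx₀ hw₀).snd.fst).div_const (x₁ - x₀)).congr
      fun t ht => (hAq t ht).symm
  refine ⟨fun t => (Φ (t, x₀, w₀)).1, A, fun t => (Φ (t, x₀, w₀)).2.1 - A t * x₀,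
    (hs hx₀ hw₀).fst, hAs, (hs hx₀ hw₀).snd.fst.sub (hAs.mul contDiffOn_const), ?_, ?_, ?_⟩
  · intro t ht
    have hb₀ : (t, x₀, w₀) ∈ box I J K := ⟨ht, hx₀, hw₀⟩
    have e : HasDerivAt (fun s : ℝ => ((s, x₀, w₀) : Base)) (1, 0, 0) t :=
      (hasDerivAt_id _).prodMk ((hasDerivAt_const _ _).prodMk (hasDerivAt_const _ _))
    have d : HasDerivAt (fun s => (Φ (s, x₀, w₀)).1) _ t :=
      (HasFDerivAt.comp_hasDerivAt t (hd hb₀) e).fst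
    rw [d.deriv]
    exact h.fderiv_time_ne_zero hI hJ hK hb₀
  · intro t ht
    exact (h.fderiv_space hI hJ hJ' hK hK' ⟨ht, hx₀, hw₀⟩).2
  · rintro ⟨t, x, w⟩ hp
    refine ⟨h.time_eq hI hJ hJ' hK hK' hp ⟨hp.1, hx₀, hw₀⟩, ?_⟩
    simp only
    rw [hXw hp.1 hp.2.1 hp.2.2, hX hp.1 hp.2.1]
    ring

end Necessity

/-! ### Expansions in the dependent variable -/

/-- Mean value inequality on the vertical segment, with a Lipschitz bound for the vertical
derivative. The quadratic remainder is essential: for d = (y - x)^4 it has order eight, whereas a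
mere o(d) would not control the fifth derivative. -/
theorem fiber_expansion {f : ℝ × ℝ → ℝ} {x : ℝ} {h d : ℝ → ℝ} (hf : ContDiffAt ℝ 2 f (x, h x))
    (hh : ContinuousAt h x) (hd : ContinuousAt d x) (hd0 : d x = 0) :
    (fun y => f (y, h y + d y) - f (y, h y) - d y * fderiv ℝ f (y, h y) (0, 1)) =O[𝓝 x]
      fun y => d y ^ 2 := by
  set φ : ℝ × ℝ → ℝ := fun z => fderiv ℝ f z (0, 1) with hφ
  have hφs : ContDiffAt ℝ 1 φ (x, h x) :=
    (hf.fderiv_right (m := 1) (by norm_num)).clm_apply contDiffAt_const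
  obtain ⟨C, s, hs, hC⟩ := hφs.exists_lipschitzOnWith
  have hdiff : ∀ᶠ z in 𝓝 (x, h x), DifferentiableAt ℝ f z :=
    (hf.eventually (by simp)).mono fun z hz => hz.differentiableAt (by simp)
  obtain ⟨r, hr, hball⟩ := Metric.mem_nhds_iff.1 (inter_mem hs hdiff)
  have m1 : ∀ᶠ y in 𝓝 x, (y, h y) ∈ Metric.ball (x, h x) r :=
    (continuousAt_id.prodMk hh).eventually_mem (Metric.ball_mem_nhds _ hr)
  have m2 : ∀ᶠ y in 𝓝 x, (y, h y + d y) ∈ Metric.ball (x, h x) r := by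
    refine (continuousAt_id.prodMk (hh.add hd)).eventually_mem ?_
    simpa [hd0] using Metric.ball_mem_nhds _ hr
  refine IsBigO.of_bound C ?_
  filter_upwards [m1, m2] with y hy1 hy2
  have hseg : ∀ k ∈ segment ℝ (h y) (h y + d y), (y, k) ∈ Metric.ball (x, h x) r := by
    rintro _ ⟨a, b, ha, hb, hab, rfl⟩
    have := convex_ball (x, h x) r hy1 hy2 ha hb hab
    have hy : a * y + b * y = y := by rw [← add_mul, hab, one_mul]
    simpa [hy] using this
  have key := (convex_segment (𝕜 := ℝ) (h y) (h y + d y)).norm_image_sub_le_of_norm_hasDerivWithin_le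
    (f := fun k => f (y, k) - k * φ (y, h y)) (f' := fun k => φ (y, k) - φ (y, h y))
    (C := C * |d y|) (x := h y) (y := h y + d y) (fun k hk => ?_) (fun k hk => ?_)
    (left_mem_segment _ _ _) (right_mem_segment _ _ _)
  · simp only [add_sub_cancel_left, Real.norm_eq_abs] at key
    calc ‖f (y, h y + d y) - f (y, h y) - d y * φ (y, h y)‖
        = |f (y, h y + d y) - (h y + d y) * φ (y, h y) - (f (y, h y) - h y * φ (y, h y))| := by
          rw [Real.norm_eq_abs]; congr 1; ring
      _ ≤ C * |d y| * |d y| := key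
      _ = C * ‖d y ^ 2‖ := by rw [norm_pow, Real.norm_eq_abs]; ring
  · have h1 : HasDerivAt (fun k => f (y, k)) (φ (y, k)) k :=
      hasDerivAt_fst_line (z := (y, k)) ((hball (hseg k hk)).2 : DifferentiableAt ℝ f _).hasFDerivAt
    have h2 := h1.sub ((hasDerivAt_id k).mul_const (φ (y, h y)))
    rw [one_mul] at h2
    exact h2.hasDerivWithinAt
  · have h1 := hC.dist_le_mul _ (hball (hseg k hk)).1 _ (hball hy1).1
    have h2 : dist (y, k) (y, h y) = |k - h y| := by
      simp [Prod.dist_eq, Real.dist_eq]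
    have h3 : |k - h y| ≤ |d y| := by
      obtain ⟨a, b, ha, hb, hab, rfl⟩ := hk
      have : a • h y + b • (h y + d y) - h y = b * d y := by
        simp only [smul_eq_mul]; linear_combination h y * hab
      rw [this, abs_mul, abs_of_nonneg hb]
      exact mul_le_of_le_one_left (abs_nonneg _) (by linarith)
    rw [h2, Real.dist_eq] at h1
    exact h1.trans (mul_le_mul_of_nonneg_left h3 C.2)

/-- The perturbation adds φ(y)(y - x)^4 = φ(x)(y - x)^4 + φ' (y - x)^5 + o((y - x)^5), with φ the
vertical derivative of f along the graph. Orders up to three are untouched, order four is excluded,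
and order five gains 5! φ'. -/
theorem iteratedDeriv_fiber_perturbation {f : ℝ × ℝ → ℝ} {x φ' : ℝ} {h : ℝ → ℝ}
    (hf : ContDiffAt ℝ ∞ f (x, h x)) (hh : ContDiffAt ℝ ∞ h x)
    (hφ : HasDerivAt (fun y => fderiv ℝ f (y, h y) (0, 1)) φ' x) {k : ℕ} (hk : k ≤ 5)
    (hk4 : k ≠ 4) :
    iteratedDeriv k (fun y => f (y, h y + (y - x) ^ 4)) x =
      iteratedDeriv k (fun y => f (y, h y)) x + if k = 5 then 120 * φ' else 0 := by
  set φ : ℝ → ℝ := fun y => fderiv ℝ f (y, h y) (0, 1) with hφd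
  have h1 := fiber_expansion (d := fun y => (y - x) ^ 4) (hf.of_le (by norm_cast))
    hh.continuousAt (by fun_prop) (by simp)
  have h2 : (fun y : ℝ => ((y - x) ^ 4) ^ 2) =o[𝓝 x] fun y => (y - x) ^ 5 := by
    have := ((isLittleO_pow_succ_sub x 2)).mul_isBigO (isBigO_refl (fun y : ℝ => (y - x) ^ 4) (𝓝 x))
    exact (this.congr_left fun y => by ring).congr_right fun y => by ring
  have h3 : (fun y => (y - x) ^ 4 * (φ y - φ x - φ' * (y - x))) =o[𝓝 x] fun y => (y - x) ^ 5 := by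
    have h0 : (fun y => φ y - φ x - φ' * (y - x)) =o[𝓝 x] fun y => y - x :=
      (hasDerivAt_iff_isLittleO.1 hφ).congr_left fun s => by simp [mul_comm]
    have := (isBigO_refl (fun y : ℝ => (y - x) ^ 4) (𝓝 x)).mul_isLittleO h0
    exact this.congr_right fun y => by ring
  have s1 : ContDiffAt ℝ ∞ (fun y => f (y, h y + (y - x) ^ 4)) x := by
    refine ContDiffAt.comp x (g := f) (f := fun y => (y, h y + (y - x) ^ 4)) ?_ ?_
    · simpa using hf
    · exact contDiffAt_id.prodMk (hh.add (by fun_prop))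
  have s2 : ContDiffAt ℝ ∞ (fun y => f (y, h y)) x :=
    ContDiffAt.comp x (g := f) (f := fun y => (y, h y)) hf (contDiffAt_id.prodMk hh)
  have s3 : ContDiffAt ℝ ∞ (fun y : ℝ => φ x * (y - x) ^ 4) x := by fun_prop
  have hle : ∀ n : ℕ, (n : WithTop ℕ∞) ≤ ∞ := fun n => by exact_mod_cast le_top
  have h4 := iteratedDeriv_eq_of_isLittleO (n := 5) (c := φ') (x₀ := x)
    (f := ((fun y => f (y, h y + (y - x) ^ 4)) - fun y => f (y, h y)) - fun y => φ x * (y - x) ^ 4)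
    (((s1.sub s2).sub s3).of_le (hle 5))
    (((h1.trans_isLittleO h2).add h3).congr_left fun y => by
      simp only [Pi.sub_apply, hφd]; ring) hk
  have s12 : ContDiffAt ℝ ∞ ((fun y => f (y, h y + (y - x) ^ 4)) - fun y => f (y, h y)) x :=
    s1.sub s2
  rw [iteratedDeriv_sub (s12.of_le (hle k)) (s3.of_le (hle k)),
    iteratedDeriv_sub (s1.of_le (hle k)) (s2.of_le (hle k)), iteratedDeriv_const_mul_field,
    iteratedDeriv_pow_sub, if_neg hk4] at h4
  have h5 : ((5).factorial : ℝ) = 120 := by norm_num [Nat.factorial]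
  rw [h5] at h4
  linear_combination h4

/-- A function all of whose fifth derivatives along graphs of affine functions are unaffected by
fourth-order perturbations of the latter is affine in the second variable, with a constant slope. -/
theorem exists_slope {J K : Set ℝ} (hJ : IsOpen J) (hJ' : J.OrdConnected) (hK : IsOpen K)
    (hK' : K.OrdConnected) {f : ℝ × ℝ → ℝ} (hf : ContDiffOn ℝ ∞ f (J ×ˢ K))
    (H : ∀ x ∈ J, ∀ w ∈ K, ∀ z : ℝ,
      iteratedDeriv 5 (fun y => f (y, w + z * (y - x) + (y - x) ^ 4)) x =
        iteratedDeriv 5 (fun y => f (y, w + z * (y - x))) x) :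
    ∃ R : ℝ, ∀ x ∈ J, ∀ w ∈ K, ∀ w' ∈ K, f (x, w) - f (x, w') = R * (w - w') := by
  have hO : IsOpen (J ×ˢ K) := hJ.prod hK
  have hfs : ∀ p ∈ J ×ˢ K, ContDiffAt ℝ ∞ f p := fun p hp => hf.contDiffAt (hO.mem_nhds hp)
  set φ : ℝ × ℝ → ℝ := fun p => fderiv ℝ f p (0, 1) with hφ
  have hφs : ∀ p ∈ J ×ˢ K, DifferentiableAt ℝ φ p := fun p hp =>
    (((hfs p hp).fderiv_right (m := ∞) (by simp)).clm_apply
      contDiffAt_const).differentiableAt (by simp)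
  -- The derivative of f_u vanishes in every direction (1, z); the slopes 0 and 1 already span the
  -- plane.
  have hφ0 : ∀ p ∈ J ×ˢ K, ∀ z, fderiv ℝ φ p (1, z) = 0 := by
    rintro ⟨x, w⟩ hp z
    have e : HasDerivAt (fun y : ℝ => (y, w + z * (y - x))) ((1 : ℝ), z) x := by
      refine (hasDerivAt_id x).prodMk ?_
      simpa using (((hasDerivAt_id x).sub_const x).const_mul z).const_add w
    have hd : HasFDerivAt φ (fderiv ℝ φ (x, w)) (x, w + z * (x - x)) := by
      simpa using (hφs _ hp).hasFDerivAt
    have h1 := HasFDerivAt.comp_hasDerivAt (f := fun y : ℝ => (y, w + z * (y - x))) x hd e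
    have h2 := iteratedDeriv_fiber_perturbation (f := f) (x := x) (h := fun y => w + z * (y - x))
      (by simpa using hfs _ hp) (by fun_prop) h1 le_rfl (by norm_num)
    rw [H x hp.1 w hp.2 z, if_pos rfl] at h2
    linarith
  have hφ1 : ∀ p ∈ J ×ˢ K, fderiv ℝ φ p = 0 := by
    intro p hp
    have a0 := hφ0 p hp 0
    have a1 := hφ0 p hp 1
    have e1 : fderiv ℝ φ p (0, 1) = 0 := by
      have : ((0, 1) : ℝ × ℝ) = (1, 1) - (1, 0) := by simp
      rw [this, map_sub, a0, a1, sub_zero]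
    ext
    · simpa using a0
    · simpa using e1
  have hconn : IsPreconnected (J ×ˢ K) := hJ'.isPreconnected.prod hK'.isPreconnected
  obtain ⟨R, hR⟩ := hO.exists_is_const_of_fderiv_eq_zero hconn
    (fun p hp => (hφs p hp).differentiableWithinAt) hφ1
  refine ⟨R, fun x hx w hw w' hw' => ?_⟩
  have := eq_of_hasDerivAt_zero (f := fun y => f (x, y) - R * y) hK hK' (fun y hy => by
    have h1 := hasDerivAt_fst_line (z := (x, y))
      ((hfs (x, y) ⟨hx, hy⟩).differentiableAt (by simp)).hasFDerivAt
    have h2 : fderiv ℝ f (x, y) (0, 1) = R := hR (x, y) ⟨hx, hy⟩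
    rw [h2] at h1
    simpa using h1.fun_sub ((hasDerivAt_id y).const_mul R)) hw hw'
  linarith

/-! ### The transformed dependent variable is affine in u -/

section Necessity

variable {I J K : Set ℝ} {Φ : Base → Base}

/-- The image of the equation under a transformation whose first two components are `α(t)` and
`a(t) x + b(t)`. -/
theorem MapsEquation.lhs_identity (hI : IsOpen I) (hJ : IsOpen J) (hK : IsOpen K)
    (hs : ContDiffOn ℝ ∞ Φ (box I J K)) {α a b : ℝ → ℝ} (hα : ContDiffOn ℝ ∞ α I)
    (ha : ContDiffOn ℝ ∞ a I) (hb : ContDiffOn ℝ ∞ b I) (hα0 : ∀ t ∈ I, deriv α t ≠ 0)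
    (ha0 : ∀ t ∈ I, a t ≠ 0)
    (hΦ : ∀ p ∈ box I J K, (Φ p).1 = α p.1 ∧ (Φ p).2.1 = a p.1 * p.2.1 + b p.1)
    {θ θ' : ℝ → Coeff} (hM : MapsEquation Φ (box I J K) θ θ') {u : ℝ × ℝ → ℝ} {t x : ℝ}
    (hu : ContDiffAt ℝ ∞ u (t, x)) (hp : (t, x, u (t, x)) ∈ box I J K)
    (hl : lhs (θ t) u (t, x) = 0) {N : ℕ → ℝ} {Nt : ℝ}
    (hN : ∀ n, N n = iteratedDeriv n (fun y => (Φ (t, y, u (t, y))).2.2) x)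
    (hNt : HasDerivAt (fun s => (Φ (s, x, u (s, x))).2.2) Nt t) :
    (Nt - (deriv a t * x + deriv b t) * (N 1 / a t)) / deriv α t
      + θ' (α t) 0 * (N 5 / a t ^ 5) + (θ' (α t) 1 + θ' (α t) 2 * N 0) * (N 3 / a t ^ 3)
      + θ' (α t) 3 * N 0 * (N 1 / a t) + θ' (α t) 4 * (N 1 / a t) * (N 2 / a t ^ 2)
      + θ' (α t) 5 * N 0 = 0 := by
  have ht : t ∈ I := hp.1
  have hΦs : ContDiffAt ℝ ∞ Φ (t, x, u (t, x)) :=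
    hs.contDiffAt ((isOpen_box hI hJ hK).mem_nhds hp)
  have hD : ∀ {f : ℝ → ℝ}, ContDiffOn ℝ ∞ f I → HasDerivAt f (deriv f t) t := fun hf =>
    ((hf.contDiffAt (hI.mem_nhds ht)).differentiableAt (by simp)).hasDerivAt
  have hX : HasDerivAt (fun s => a s * x + b s) (deriv a t * x + deriv b t) t :=
    ((hD ha).mul_const x).add (hD hb)
  have hbox : ∀ᶠ q' in 𝓝 (t, x), inducedMap Φ u q' = (α q'.1, a q'.1 * q'.2 + b q'.1) := by
    have hc : ContinuousAt (fun q' : ℝ × ℝ => ((q'.1, q'.2, u q') : Base)) (t, x) :=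
      (contDiffAt_graph hu).continuousAt
    filter_upwards [hc.eventually_mem ((isOpen_box hI hJ hK).mem_nhds hp)] with q' hq'
    ext
    · exact (hΦ _ hq').1
    · exact (hΦ _ hq').2
  have lt : Tendsto (fun s => (s, x)) (𝓝 t) (𝓝 (t, x)) := Continuous.tendsto (by fun_prop) t
  have lx : Tendsto (fun y => (t, y)) (𝓝 x) (𝓝 (t, x)) := Continuous.tendsto (by fun_prop) x
  have hιd := ((contDiffAt_inducedMap (q := (t, x)) hΦs hu).differentiableAt
    (by simp)).hasFDerivAt
  have hX1 := (hD hα).prodMk hX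
  have d1 : fderiv ℝ (inducedMap Φ u) (t, x) (1, 0) =
      (deriv α t, deriv a t * x + deriv b t) :=
    (hasDerivAt_snd_line hιd).unique (hX1.congr_of_eventuallyEq (lt.eventually hbox))
  have d2 : fderiv ℝ (inducedMap Φ u) (t, x) (0, 1) = (0, a t) := by
    have hY : HasDerivAt (fun y => a t * y + b t) (a t) x := by
      simpa using ((hasDerivAt_id x).const_mul (a t)).add_const (b t)
    have hY1 := (hasDerivAt_const x (α t)).prodMk hY
    exact (hasDerivAt_fst_line hιd).unique (hY1.congr_of_eventuallyEq (lx.eventually hbox))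
  have hdet : (fderiv ℝ (inducedMap Φ u) (t, x)).det ≠ 0 := by
    apply det_ne_zero_of_apply
    rw [d1, d2]
    simp [hα0 t ht, ha0 t ht]
  obtain ⟨v, hv, huv⟩ := exists_transform (q := (t, x)) hΦs hu hdet
  have hl' := (hM u v (t, x) hu hp hdet hv huv).1 hl
  have hz : inducedMap Φ u (t, x) = (α t, a t * x + b t) := hbox.self_of_nhds
  rw [hz] at hl' hv
  have huv' : ∀ᶠ q' in 𝓝 (t, x), v (α q'.1, a q'.1 * q'.2 + b q'.1)
      = (Φ (q'.1, q'.2, u q')).2.2 := by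
    filter_upwards [huv, hbox] with q' h1 h2
    rw [← h1, h2]
  have hdx : ∀ n, a t ^ n * dx^[n] v (α t, a t * x + b t) = N n := fun n => by
    rw [hN]; exact pow_mul_dx_iterate (lx.eventually huv') n
  have hdt := (hasDerivAt_along (hv.differentiableAt (by simp)) (hD hα) hX
    (lt.eventually huv')).unique hNt
  have ha := ha0 t ht
  have hα' := hα0 t ht
  have en : ∀ n, dx^[n] v (α t, a t * x + b t) = N n / a t ^ n := fun n => by
    rw [← hdx]; field_simp
  have e0 : v (α t, a t * x + b t) = N 0 := by simpa using en 0
  have e1 : dx v (α t, a t * x + b t) = N 1 / a t := by simpa using en 1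
  have et : dt v (α t, a t * x + b t) =
      (Nt - (deriv a t * x + deriv b t) * (N 1 / a t)) / deriv α t := by
    rw [eq_div_iff hα', ← e1]; linear_combination hdt
  rw [lhs, et, en, en, en, e1, e0] at hl'
  linear_combination hl'

/-- Since u_xxxx is absent from the equation, changing it preserves solutions at the point. In the
transformed identity only the fifth derivative of ũ can react, and its coefficient Ã is nonzero, so
that derivative is unchanged. -/
theorem IsEquivalenceTransformation.exists_slope (h : IsEquivalenceTransformation I J K Φ)
    (hI : IsOpen I) (hJ : IsOpen J) (hJ' : J.OrdConnected) (hJ₀ : J.Nonempty) (hK : IsOpen K)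
    (hK' : K.OrdConnected) (hK₀ : K.Nonempty) {t : ℝ} (ht : t ∈ I) :
    ∃ R : ℝ, ∀ x ∈ J, ∀ w ∈ K, ∀ w' ∈ K,
      (Φ (t, x, w)).2.2 - (Φ (t, x, w')).2.2 = R * (w - w') := by
  obtain ⟨α, a, b, hα, ha, hb, hα0, ha0, hΦ⟩ := h.exists_affine hI hJ hJ' hJ₀ hK hK' hK₀
  obtain ⟨θ', hθ', hM⟩ := h.maps_class _ (isClassCoeff_testCoeff I 0 0)
  set f : ℝ × ℝ → ℝ := fun z => (Φ (t, z.1, z.2)).2.2 with hf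
  have hfs : ContDiffOn ℝ ∞ f (J ×ˢ K) :=
    (h.smooth.comp (f := fun z : ℝ × ℝ => ((t, z.1, z.2) : Base)) (by fun_prop)
      fun z hz => ⟨ht, hz.1, hz.2⟩).snd.snd
  refine FifthOrderKdV.exists_slope hJ hJ' hK hK' hfs fun x hx w hw z => ?_
  have hb₀ : (t, x, w) ∈ box I J K := ⟨ht, hx, hw⟩
  have hne : θ' (α t) 0 ≠ 0 := (hθ'.2 (α t) ⟨(t, x, w), hb₀, (hΦ _ hb₀).1⟩).1
  have hNt : HasDerivAt (fun s => (Φ (s, x, w)).2.2) (deriv (fun s => (Φ (s, x, w)).2.2) t) t := by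
    have : ContDiffOn ℝ ∞ (fun s => (Φ (s, x, w)).2.2) I :=
      (h.smooth.comp (f := fun s : ℝ => ((s, x, w) : Base)) (by fun_prop)
        fun s hs => ⟨hs, hx, hw⟩).snd.snd
    exact ((this.contDiffAt (hI.mem_nhds ht)).differentiableAt (by simp)).hasDerivAt
  have key : ∀ r : ℝ, _ := fun r =>
    hM.lhs_identity hI hJ hK h.smooth hα ha hb hα0 ha0 hΦ (t := t) (x := x)
      (u := jetFun (t, x) 0 (jet w z 0 0 r 0)) (contDiff_jetFun _ _ _).contDiffAt
      (by rw [jetFun_self]; exact hb₀) (by rw [lhs_testCoeff_jetFun]; simp [jet])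
      (fun n => rfl) (Nt := deriv (fun s => (Φ (s, x, w)).2.2) t) (by
        refine hNt.congr_of_eventuallyEq (Eventually.of_forall fun s => ?_)
        simp [jetFun, Finset.sum_range_succ, jet])
  have k0 := key 0
  -- 24 = 4!, so that the perturbation is exactly (y - x)^4.
  have k1 := key 24
  have j0 : ∀ y, jetFun (t, x) 0 (jet w z 0 0 0 0) (t, y) = w + z * (y - x) := fun y => by
    simp [jetFun, Finset.sum_range_succ, jet]
  have j1 : ∀ y, jetFun (t, x) 0 (jet w z 0 0 24 0) (t, y) = w + z * (y - x) + (y - x) ^ 4 :=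
    fun y => by simp [jetFun, Finset.sum_range_succ, jet, Nat.factorial]
  simp only [j0] at k0
  simp only [j1] at k1
  have hO : IsOpen (J ×ˢ K) := hJ.prod hK
  have hfx : ContDiffAt ℝ ∞ f (x, w + z * (x - x)) := by
    simpa using hfs.contDiffAt (hO.mem_nhds ⟨hx, hw⟩)
  have hφ : DifferentiableAt ℝ (fun y => fderiv ℝ f (y, w + z * (y - x)) (0, 1)) x := by
    have h1 : DifferentiableAt ℝ (fun p => fderiv ℝ f p (0, 1)) (x, w + z * (x - x)) :=
      ((hfx.fderiv_right (m := ∞) (by simp)).clm_apply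
        contDiffAt_const).differentiableAt (by simp)
    exact DifferentiableAt.comp x (f := fun y => (y, w + z * (y - x))) h1 (by fun_prop)
  have P : ∀ k : ℕ, k ≤ 3 →
      iteratedDeriv k (fun y => (Φ (t, y, w + z * (y - x) + (y - x) ^ 4)).2.2) x =
      iteratedDeriv k (fun y => (Φ (t, y, w + z * (y - x))).2.2) x := fun k hk => by
    have := iteratedDeriv_fiber_perturbation (h := fun y => w + z * (y - x)) hfx (by fun_prop)
      hφ.hasDerivAt (k := k) (by omega) (by omega)
    rwa [if_neg (by omega), add_zero] at this
  rw [P 0 (by norm_num), P 1 (by norm_num), P 2 (by norm_num), P 3 (by norm_num)] at k1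
  have ha' := ha0 t ht
  have h5 := k1.trans k0.symm
  simp only [add_left_inj, add_right_inj] at h5
  have h6 := mul_left_cancel₀ hne h5
  field_simp at h6
  exact h6

end Necessity

/-! ### Equivalence transformations are scalings -/

section Necessity

variable {I J K : Set ℝ} {Φ : Base → Base}

theorem contDiffOn_slices {f : Base → ℝ} (hf : ContDiffOn ℝ ∞ f (box I J K)) {t x w : ℝ} :
    (x ∈ J → w ∈ K → ContDiffOn ℝ ∞ (fun s => f (s, x, w)) I) ∧
    (t ∈ I → w ∈ K → ContDiffOn ℝ ∞ (fun y => f (t, y, w)) J) :=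
  ⟨fun hx hw => hf.comp (f := fun s : ℝ => ((s, x, w) : Base)) (by fun_prop)
      fun _ hs => ⟨hs, hx, hw⟩,
    fun ht hw => hf.comp (f := fun y : ℝ => ((t, y, w) : Base)) (by fun_prop)
      fun _ hs => ⟨ht, hs, hw⟩⟩

/-- A function on the box that is affine in `u` with slope depending only on `t`. -/
theorem exists_affine_in_u (hK : IsOpen K) (hK₀ : K.Nonempty) (hJ₀ : J.Nonempty) {f : Base → ℝ}
    (hf : ContDiffOn ℝ ∞ f (box I J K))
    (h : ∀ t ∈ I, ∃ R : ℝ, ∀ x ∈ J, ∀ w ∈ K, ∀ w' ∈ K, f (t, x, w) - f (t, x, w') = R * (w - w')) :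
    ∃ (R : ℝ → ℝ) (S : ℝ → ℝ → ℝ), ContDiffOn ℝ ∞ R I ∧
      (∀ x ∈ J, ContDiffOn ℝ ∞ (fun t => S t x) I) ∧ (∀ t ∈ I, ContDiffOn ℝ ∞ (S t) J) ∧
      ∀ p ∈ box I J K, f p = R p.1 * p.2.2 + S p.1 p.2.1 := by
  obtain ⟨w₀, hw₀⟩ := id hK₀
  obtain ⟨w₁, hw₁, hw₁'⟩ := (dense_compl_singleton w₀).inter_open_nonempty K hK hK₀
  obtain ⟨x₀, hx₀⟩ := hJ₀
  have hne : w₁ - w₀ ≠ 0 := sub_ne_zero.2 hw₁'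
  set R : ℝ → ℝ := fun t => (f (t, x₀, w₁) - f (t, x₀, w₀)) / (w₁ - w₀) with hR
  have hRs : ContDiffOn ℝ ∞ R I :=
    (((contDiffOn_slices hf (t := 0)).1 hx₀ hw₁).sub
      ((contDiffOn_slices hf (t := 0)).1 hx₀ hw₀)).div_const _
  refine ⟨R, fun t x => f (t, x, w₀) - R t * w₀, hRs, fun x hx => ?_, fun t ht => ?_, ?_⟩
  · exact ((contDiffOn_slices hf (t := 0)).1 hx hw₀).sub (hRs.mul contDiffOn_const)
  · exact ((contDiffOn_slices hf (x := 0)).2 ht hw₀).sub contDiffOn_const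
  · rintro ⟨t, x, w⟩ ⟨ht, hx, hw⟩
    obtain ⟨R', hR'⟩ := h t ht
    have e : R t = R' := by
      simp only [hR]
      rw [hR' x₀ hx₀ w₁ hw₁ w₀ hw₀]; field_simp
    have := hR' x hx w hw w₀ hw₀
    simp only
    rw [e]
    linear_combination this

theorem iteratedDeriv_affine_jetFun (t x m R : ℝ) (p : ℕ → ℝ) {S : ℝ → ℝ}
    (hS : ContDiffAt ℝ ∞ S x) {n : ℕ} (hn : n < 6) :
    iteratedDeriv n (fun y => R * jetFun (t, x) m p (t, y) + S y) x =
      R * p n + iteratedDeriv n S x := by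
  have hle : (n : WithTop ℕ∞) ≤ ∞ := by exact_mod_cast le_top
  have h1 : ContDiffAt ℝ ∞ (fun y => R * jetFun (t, x) m p (t, y)) x :=
    (contDiff_const.mul ((contDiff_jetFun (t, x) m p).comp
      (contDiff_const.prodMk contDiff_id))).contDiffAt
  have h2 := iteratedDeriv_add (h1.of_le hle) (hS.of_le hle)
  have h3 := dx_iterate_jetFun (t, x) m p hn
  rw [dx_iterate_apply] at h3
  rw [iteratedDeriv_const_mul_field, h3] at h2
  exact h2

/-- Equivalence transformations are scalings in `x` and `u`. -/
theorem IsEquivalenceTransformation.exists_scaleMap (h : IsEquivalenceTransformation I J K Φ)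
    (hI : IsOpen I) (hI' : I.OrdConnected) (hI₀ : I.Nonempty) (hJ : IsOpen J)
    (hJ' : J.OrdConnected) (hJ₀ : J.Nonempty) (hK : IsOpen K)
    (hK' : K.OrdConnected) (hK₀ : K.Nonempty) :
    ∃ (α R : ℝ → ℝ) (a b : ℝ), IsScaling I α R a ∧ EqOn Φ (scaleMap α R a b) (box I J K) := by
  obtain ⟨α, a, b, hα, ha, hb, hα0, ha0, hΦ⟩ := h.exists_affine hI hJ hJ' hJ₀ hK hK' hK₀
  obtain ⟨R, S, hR, hSt, hSx, hU⟩ := exists_affine_in_u hK hK₀ hJ₀ h.smooth.snd.snd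
    fun t ht => h.exists_slope hI hJ hJ' hJ₀ hK hK' hK₀ ht
  obtain ⟨x₀, hx₀⟩ := id hJ₀
  obtain ⟨x₁, hx₁, hx₁'⟩ := (dense_compl_singleton x₀).inter_open_nonempty J hJ hJ₀
  obtain ⟨w₀, hw₀⟩ := id hK₀
  obtain ⟨w₁, hw₁, hw₁'⟩ := (dense_compl_singleton w₀).inter_open_nonempty K hK hK₀
  have hwne : w₁ - w₀ ≠ 0 := sub_ne_zero.2 hw₁'
  -- A zero of R would make Φ stationary in u, against nondegeneracy.
  have hR0 : ∀ t ∈ I, R t ≠ 0 := by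
    intro t ht h0
    have hp : (t, x₀, w₀) ∈ box I J K := ⟨ht, hx₀, hw₀⟩
    have hd := ((h.contDiffAt hI hJ hK hp).differentiableAt (by simp)).hasFDerivAt
    have e : HasDerivAt (fun s : ℝ => ((t, x₀, s) : Base)) (0, 0, 1) w₀ :=
      (hasDerivAt_const _ _).prodMk ((hasDerivAt_const _ _).prodMk (hasDerivAt_id _))
    have h1 := HasFDerivAt.comp_hasDerivAt w₀ hd e
    have h2 : HasDerivAt (Φ ∘ fun s : ℝ => ((t, x₀, s) : Base)) 0 w₀ := by
      refine (hasDerivAt_const w₀ ((α t, a t * x₀ + b t, S t x₀) : Base)).congr_of_eventuallyEq ?_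
      filter_upwards [hK.mem_nhds hw₀] with s hs
      have hb' : (t, x₀, s) ∈ box I J K := ⟨ht, hx₀, hs⟩
      have e3 := hU _ hb'
      simp only [h0, zero_mul, zero_add] at e3
      simp only [Function.comp_apply]
      ext
      · exact (hΦ _ hb').1
      · exact (hΦ _ hb').2
      · exact e3
    have h3 := (det_ne_zero_iff_injective _).1 (h.nondegenerate _ hp)
      ((h1.unique h2).trans (map_zero (fderiv ℝ Φ (t, x₀, w₀))).symm)
    simp at h3
  have hD : ∀ {f : ℝ → ℝ}, ContDiffOn ℝ ∞ f I → ∀ {t}, t ∈ I → HasDerivAt f (deriv f t) t :=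
    fun hf t ht => ((hf.contDiffAt (hI.mem_nhds ht)).differentiableAt (by simp)).hasDerivAt
  -- The transformed equation with u_t eliminated by the test equation, an identity in the free
  -- values w, p1, p2, p3, p5. The function c is the new coefficient vector at α(t).
  have key : ∀ e f : ℝ, ∃ c : ℝ → Coeff, ∀ t ∈ I, ∀ x ∈ J, ∀ w ∈ K, ∀ p1 p2 p3 p5 : ℝ,
      (deriv R t * w + deriv (fun s => S s x) t
        - R t * (p5 + w * p3 + e * w * p1 + f * p1 * p2)
        - (deriv a t * x + deriv b t) * ((R t * p1 + iteratedDeriv 1 (S t) x) / a t)) / deriv α t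
      + c t 0 * ((R t * p5 + iteratedDeriv 5 (S t) x) / a t ^ 5)
      + (c t 1 + c t 2 * (R t * w + S t x)) * ((R t * p3 + iteratedDeriv 3 (S t) x) / a t ^ 3)
      + c t 3 * (R t * w + S t x) * ((R t * p1 + iteratedDeriv 1 (S t) x) / a t)
      + c t 4 * ((R t * p1 + iteratedDeriv 1 (S t) x) / a t)
        * ((R t * p2 + iteratedDeriv 2 (S t) x) / a t ^ 2)
      + c t 5 * (R t * w + S t x) = 0 := by
    intro e f
    obtain ⟨θ', hθ', hM⟩ := h.maps_class _ (isClassCoeff_testCoeff I e f)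
    refine ⟨fun t => θ' (α t), fun t ht x hx w hw p1 p2 p3 p5 => ?_⟩
    set m := -(p5 + w * p3 + e * w * p1 + f * p1 * p2) with hm
    set u := jetFun (t, x) m (jet w p1 p2 p3 0 p5) with hu
    have hus : ContDiff ℝ ∞ u := contDiff_jetFun _ _ _
    have hu0 : u (t, x) = w := jetFun_self _ _ _
    have hSxt : ContDiffAt ℝ ∞ (S t) x := (hSx t ht).contDiffAt (hJ.mem_nhds hx)
    have hN : ∀ n < 6, iteratedDeriv n (fun y => (Φ (t, y, u (t, y))).2.2) x =
        R t * jet w p1 p2 p3 0 p5 n + iteratedDeriv n (S t) x := by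
      intro n hn
      rw [← iteratedDeriv_affine_jetFun t x m (R t) _ hSxt hn]
      refine Filter.EventuallyEq.iteratedDeriv_eq n ?_
      have hcK : ∀ᶠ y in 𝓝 x, u (t, y) ∈ K := by
        have : ContinuousAt (fun y => u (t, y)) x := by
          have := hus.continuous; fun_prop
        exact this.eventually_mem (hK.mem_nhds (by rw [hu0]; exact hw))
      filter_upwards [hJ.mem_nhds hx, hcK] with y hy1 hy2
      exact hU (t, y, u (t, y)) ⟨ht, hy1, hy2⟩
    have hut : HasDerivAt (fun s => u (s, x)) m t := by
      have h1 : DifferentiableAt ℝ (fun s => u (s, x)) t := by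
        have := hus.differentiable (by simp); fun_prop
      have h2 : dt u (t, x) = m := by rw [hu, dt_jetFun]
      rw [← h2]; exact h1.hasDerivAt
    have hNt : HasDerivAt (fun s => (Φ (s, x, u (s, x))).2.2)
        (deriv R t * u (t, x) + R t * m + deriv (fun s => S s x) t) t := by
      refine (((hD hR ht).mul hut).add (hD (hSt x hx) ht)).congr_of_eventuallyEq ?_
      have hcK : ∀ᶠ s in 𝓝 t, u (s, x) ∈ K := by
        exact hut.continuousAt.eventually_mem (hK.mem_nhds (by rw [hu0]; exact hw))
      filter_upwards [hI.mem_nhds ht, hcK] with s hs1 hs2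
      exact hU (s, x, u (s, x)) ⟨hs1, hx, hs2⟩
    have hid := hM.lhs_identity hI hJ hK h.smooth hα ha hb hα0 ha0 hΦ hus.contDiffAt
      (by rw [hu0]; exact ⟨ht, hx, hw⟩)
      (by rw [hu, lhs_testCoeff_jetFun, hm]; simp only [jet]; ring) (fun n => rfl) hNt
    rw [hN 0 (by norm_num), hN 1 (by norm_num), hN 2 (by norm_num), hN 3 (by norm_num),
      hN 5 (by norm_num), hu0] at hid
    simp only [jet, iteratedDeriv_zero, hm] at hid
    linear_combination hid
  -- For f = 1 the term u_x u_xx must survive, which makes the new coefficient c 4 nonzero; the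
  -- coefficient of u_xx alone is a nonzero multiple of c 4 times S_x.
  have hS1 : ∀ t ∈ I, ∀ x ∈ J, iteratedDeriv 1 (S t) x = 0 := by
    obtain ⟨c, hc⟩ := key 0 1
    intro t ht x hx
    have k := hc t ht x hx w₀ hw₀
    have k0 := k 0 0 0 0
    have k1 := k 0 1 0 0
    have k2 := k 1 0 0 0
    have k3 := k 1 1 0 0
    have hα' := hα0 t ht
    have ha' := ha0 t ht
    have hR' := hR0 t ht
    have e1 : c t 4 * R t * iteratedDeriv 1 (S t) x / a t ^ 3 = 0 := by
      linear_combination k1 - k0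
    have e2 : c t 4 * R t ^ 2 / a t ^ 3 - R t / deriv α t = 0 := by
      linear_combination k3 - k2 - k1 + k0
    have hc4 : c t 4 ≠ 0 := by
      intro h0
      rw [h0] at e2
      have : R t / deriv α t ≠ 0 := div_ne_zero hR' hα'
      apply this
      linear_combination -e2
    simpa [hc4, hR', ha'] using e1
  have hSd : ∀ t ∈ I, ∀ x ∈ J, HasDerivAt (S t) 0 x := fun t ht x hx => by
    have := (((hSx t ht).contDiffAt (hJ.mem_nhds hx)).differentiableAt (by simp)).hasDerivAt
    rwa [← iteratedDeriv_one, hS1 t ht x hx] at this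
  have hS2 : ∀ t ∈ I, ∀ x ∈ J, iteratedDeriv 2 (S t) x = 0 := by
    intro t ht x hx
    rw [iteratedDeriv_succ, Filter.EventuallyEq.deriv_eq (f := fun _ => (0 : ℝ))]
    · simp
    · filter_upwards [hJ.mem_nhds hx] with y hy
      exact hS1 t ht y hy
  -- The coefficient of u_x is affine in u, and vanishing at two values of u makes both of its parts
  -- vanish.
  have hlin : ∀ e : ℝ, ∃ c : ℝ → Coeff, ∀ t ∈ I, ∀ x ∈ J,
      e = deriv α t * c t 3 * R t / a t ∧
      deriv a t * x + deriv b t = deriv α t * c t 3 * S t x := by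
    intro e
    obtain ⟨c, hc⟩ := key e 0
    refine ⟨c, fun t ht x hx => ?_⟩
    have hα' := hα0 t ht
    have ha' := ha0 t ht
    have hR' := hR0 t ht
    have H : ∀ w ∈ K, -(e * w) - (deriv a t * x + deriv b t) / a t
        + deriv α t * c t 3 * (R t * w + S t x) / a t = 0 := by
      intro w hw
      have k0 := hc t ht x hx w hw 0 0 0 0
      have k1 := hc t ht x hx w hw 1 0 0 0
      rw [hS1 t ht x hx, hS2 t ht x hx] at k0 k1
      have e1 : R t / deriv α t * (-(e * w) - (deriv a t * x + deriv b t) / a t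
        + deriv α t * c t 3 * (R t * w + S t x) / a t) = 0 := by
        have hαi : R t / deriv α t * deriv α t = R t := by field_simp
        linear_combination k1 - k0 + (c t 3 * (R t * w + S t x) / a t) * hαi
      exact (mul_eq_zero.1 e1).resolve_left (div_ne_zero hR' hα')
    have H0 := H w₀ hw₀
    have H1 := H w₁ hw₁
    have e1 : (w₁ - w₀) * (e - deriv α t * c t 3 * R t / a t) = 0 := by
      linear_combination H0 - H1
    have e2 := sub_eq_zero.1 ((mul_eq_zero.1 e1).resolve_left hwne)
    refine ⟨e2, ?_⟩
    rw [e2] at H0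
    field_simp at H0
    linear_combination -H0
  -- With e = 0 the new coefficient c 3 is zero, which leaves a_t x + b_t = 0; with e = 1, used
  -- next, c 3 is nonzero and S must vanish.
  have hab : ∀ t ∈ I, ∀ x ∈ J, deriv a t * x + deriv b t = 0 := by
    obtain ⟨c, hc⟩ := hlin 0
    intro t ht x hx
    obtain ⟨h1, h2⟩ := hc t ht x hx
    have : c t 3 = 0 := by simpa [hα0 t ht, hR0 t ht, ha0 t ht] using h1.symm
    rw [h2, this]; ring
  have hS0 : ∀ t ∈ I, ∀ x ∈ J, S t x = 0 := by
    obtain ⟨c, hc⟩ := hlin 1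
    intro t ht x hx
    obtain ⟨h1, h2⟩ := hc t ht x hx
    rw [hab t ht x hx] at h2
    have hc3 : c t 3 ≠ 0 := by
      intro h0; simp [h0] at h1
    simpa [hα0 t ht, hc3] using h2.symm
  have hda : ∀ t ∈ I, deriv a t = 0 := by
    intro t ht
    have e1 := hab t ht x₀ hx₀
    have e2 := hab t ht x₁ hx₁
    exact (mul_eq_zero.1 (show (x₁ - x₀) * deriv a t = 0 by linear_combination e2 - e1)).resolve_left
      (sub_ne_zero.2 hx₁')
  have hdb : ∀ t ∈ I, deriv b t = 0 := by
    intro t ht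
    have e1 := hab t ht x₀ hx₀
    rw [hda t ht] at e1
    linarith
  obtain ⟨t₀, ht₀⟩ := hI₀
  have hac : ∀ t ∈ I, a t = a t₀ := fun t ht => eq_of_hasDerivAt_zero hI hI'
    (fun s hs => by rw [← hda s hs]; exact hD ha hs) ht ht₀
  have hbc : ∀ t ∈ I, b t = b t₀ := fun t ht => eq_of_hasDerivAt_zero hI hI'
    (fun s hs => by rw [← hdb s hs]; exact hD hb hs) ht ht₀
  refine ⟨α, R, a t₀, b t₀, ⟨hα, hα0, hR, hR0, ha0 t₀ ht₀⟩, ?_⟩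
  rintro ⟨t, x, w⟩ hp
  have h3 := hU _ hp
  rw [hS0 _ hp.1 _ hp.2.1, add_zero] at h3
  have h2 := (hΦ _ hp).2
  rw [hac _ hp.1, hbc _ hp.1] at h2
  exact Prod.ext (hΦ _ hp).1 (Prod.ext h2 h3)

end Necessity

/-! ### Partial derivatives of smooth functions -/

theorem contDiffAt_fderiv_apply {E : Type*} [NormedAddCommGroup E] [NormedSpace ℝ E] {f : E → ℝ}
    {p : E} (hf : ContDiffAt ℝ ∞ f p) (e : E) : ContDiffAt ℝ ∞ (fun z => fderiv ℝ f z e) p :=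
  (hf.fderiv_right (m := ∞) (by simp)).clm_apply contDiffAt_const

theorem fderiv_fderiv_comm {E : Type*} [NormedAddCommGroup E] [NormedSpace ℝ E] {f : E → ℝ}
    {p : E} (hf : ContDiffAt ℝ ∞ f p) (e e' : E) :
    fderiv ℝ (fun z => fderiv ℝ f z e) p e' = fderiv ℝ (fun z => fderiv ℝ f z e') p e := by
  have hd : DifferentiableAt ℝ (fderiv ℝ f) p :=
    (hf.fderiv_right (m := ∞) (by simp)).differentiableAt (by simp)
  have h : ∀ a b : E, fderiv ℝ (fun z => fderiv ℝ f z a) p b = fderiv ℝ (fderiv ℝ f) p b a := by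
    intro a b
    rw [fderiv_clm_apply hd (differentiableAt_const a)]
    simp
  rw [h, h]
  exact (hf.isSymmSndFDerivAt (by simp; norm_cast)) e' e

theorem eventually_differentiableAt {E : Type*} [NormedAddCommGroup E] [NormedSpace ℝ E]
    {f : E → ℝ} {p : E} (hf : ContDiffAt ℝ ∞ f p) : ∀ᶠ z in 𝓝 p, DifferentiableAt ℝ f z :=
  ((hf.of_le (m := 1) (by norm_cast)).eventually (by simp)).mono fun _ hz =>
    hz.differentiableAt (by simp)

theorem dt_eventuallyEq {u : ℝ × ℝ → ℝ} {q : ℝ × ℝ} (hu : ContDiffAt ℝ ∞ u q) :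
    dt u =ᶠ[𝓝 q] fun z => fderiv ℝ u z (1, 0) :=
  (eventually_differentiableAt hu).mono fun _ hz => dt_eq_fderiv hz

theorem dx_eventuallyEq {u : ℝ × ℝ → ℝ} {q : ℝ × ℝ} (hu : ContDiffAt ℝ ∞ u q) :
    dx u =ᶠ[𝓝 q] fun z => fderiv ℝ u z (0, 1) :=
  (eventually_differentiableAt hu).mono fun _ hz => dx_eq_fderiv hz

theorem contDiffAt_dt {u : ℝ × ℝ → ℝ} {q : ℝ × ℝ} (hu : ContDiffAt ℝ ∞ u q) :
    ContDiffAt ℝ ∞ (dt u) q :=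
  (contDiffAt_fderiv_apply hu _).congr_of_eventuallyEq (dt_eventuallyEq hu)

theorem contDiffAt_dx {u : ℝ × ℝ → ℝ} {q : ℝ × ℝ} (hu : ContDiffAt ℝ ∞ u q) :
    ContDiffAt ℝ ∞ (dx u) q :=
  (contDiffAt_fderiv_apply hu _).congr_of_eventuallyEq (dx_eventuallyEq hu)

theorem dt_dx_comm {u : ℝ × ℝ → ℝ} {q : ℝ × ℝ} (hu : ContDiffAt ℝ ∞ u q) :
    dt (dx u) q = dx (dt u) q := by
  rw [dt_eq_fderiv ((contDiffAt_dx hu).differentiableAt (by simp)),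
    dx_eq_fderiv ((contDiffAt_dt hu).differentiableAt (by simp)),
    (dx_eventuallyEq hu).fderiv_eq, (dt_eventuallyEq hu).fderiv_eq, fderiv_fderiv_comm hu]

theorem eventually_contDiffAt {u : ℝ × ℝ → ℝ} {q : ℝ × ℝ} (hu : ContDiffAt ℝ ∞ u q) (n : ℕ) :
    ∀ᶠ z in 𝓝 q, ContDiffAt ℝ n u z :=
  (hu.of_le (by exact_mod_cast le_top)).eventually (by simp)

/-- Iterating the exchange of derivatives requires it in a neighbourhood. Smoothness at a point
provides second-order smoothness at nearby points, which is enough for symmetry. -/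
theorem dt_dx_comm_eventually {u : ℝ × ℝ → ℝ} {q : ℝ × ℝ} (hu : ContDiffAt ℝ ∞ u q) :
    dt (dx u) =ᶠ[𝓝 q] dx (dt u) := by
  filter_upwards [eventually_contDiffAt hu 2, (dx_eventuallyEq hu).eventually_nhds,
    (dt_eventuallyEq hu).eventually_nhds] with z hz h1 h2
  have hd : DifferentiableAt ℝ (fderiv ℝ u) z :=
    (hz.fderiv_right (m := 1) (by norm_cast)).differentiableAt (by simp)
  have h : ∀ a b : ℝ × ℝ, fderiv ℝ (fun z => fderiv ℝ u z a) z b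
      = fderiv ℝ (fderiv ℝ u) z b a := by
    intro a b
    rw [fderiv_clm_apply hd (differentiableAt_const a)]
    simp
  have hda : ∀ a : ℝ × ℝ, DifferentiableAt ℝ (fun z => fderiv ℝ u z a) z := fun a =>
    hd.clm_apply (differentiableAt_const a)
  have h1' : dx u =ᶠ[𝓝 z] fun z => fderiv ℝ u z (0, 1) := h1
  have h2' : dt u =ᶠ[𝓝 z] fun z => fderiv ℝ u z (1, 0) := h2
  rw [dt_eq_fderiv (h1'.differentiableAt_iff.2 (hda _)),
    dx_eq_fderiv (h2'.differentiableAt_iff.2 (hda _)), h1'.fderiv_eq, h2'.fderiv_eq, h, h]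
  exact (hz.isSymmSndFDerivAt (by simp)) _ _

theorem dx_iterate_congr {u v : ℝ × ℝ → ℝ} {q : ℝ × ℝ} (h : u =ᶠ[𝓝 q] v) (n : ℕ) :
    dx^[n] u q = dx^[n] v q := by
  rw [dx_iterate_apply, dx_iterate_apply]
  have hl : Tendsto (fun y => (q.1, y)) (𝓝 q.2) (𝓝 q) := Continuous.tendsto (by fun_prop) q.2
  exact Filter.EventuallyEq.iteratedDeriv_eq n (hl.eventually h)

theorem dt_dx_iterate_comm {u : ℝ × ℝ → ℝ} {q : ℝ × ℝ} (hu : ContDiffAt ℝ ∞ u q) (n : ℕ) :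
    dt (dx^[n] u) q = dx^[n] (dt u) q := by
  induction n generalizing u with
  | zero => rfl
  | succ n ih =>
    rw [Function.iterate_succ_apply, ih (contDiffAt_dx hu),
      dx_iterate_congr (dt_dx_comm_eventually hu), ← Function.iterate_succ_apply]

/-- Leibniz rule: an affine factor leaves only two terms. -/
theorem iteratedDeriv_affine_mul_deriv (a b : ℝ) {h : ℝ → ℝ} {x : ℝ} (hh : ContDiffAt ℝ ∞ h x)
    (n : ℕ) : iteratedDeriv n (fun y => (a * y + b) * deriv h y) x =
      (a * x + b) * iteratedDeriv (n + 1) h x + n * a * iteratedDeriv n h x := by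
  have hderiv : ∀ {g : ℝ → ℝ}, ContDiffAt ℝ ∞ g x → ContDiffAt ℝ ∞ (deriv g) x := fun hg => by
    simpa using contDiffAt_fderiv_apply hg 1
  induction n generalizing h with
  | zero => simp
  | succ n ih =>
    have hg := hderiv hh
    have hle : (n : WithTop ℕ∞) ≤ ∞ := by exact_mod_cast le_top
    have e : deriv (fun y => (a * y + b) * deriv h y) =ᶠ[𝓝 x]
        fun y => a * deriv h y + (a * y + b) * deriv (deriv h) y := by
      filter_upwards [eventually_differentiableAt hg] with y hy
      have h1 : HasDerivAt (fun y => a * y + b) a y := by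
        simpa using ((hasDerivAt_id y).const_mul a).add_const b
      exact (h1.mul hy.hasDerivAt).deriv
    have h0 : ContDiffAt ℝ ∞ (fun y => a * y + b) x := by fun_prop
    have h1 : ContDiffAt ℝ ∞ (fun y => a * deriv h y) x := contDiffAt_const.mul hg
    rw [iteratedDeriv_succ', Filter.EventuallyEq.iteratedDeriv_eq n e,
      iteratedDeriv_fun_add (h1.of_le hle) ((h0.mul (hderiv hg)).of_le hle),
      ih hg, iteratedDeriv_const_mul_field, ← iteratedDeriv_succ', ← iteratedDeriv_succ']
    push_cast
    ring

/-! ### Prolongation of vector fields that are affine in `x` and `u` -/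

section Prolongation

variable {I J K : Set ℝ} {v : Base → Base} {τ a b R : ℝ → ℝ} {S : ℝ → ℝ → ℝ}

theorem charac_eventuallyEq (hI : IsOpen I) (hJ : IsOpen J) (hK : IsOpen K)
    (hv : ∀ p ∈ box I J K, v p =
      (τ p.1, a p.1 * p.2.1 + b p.1, R p.1 * p.2.2 + S p.1 p.2.1))
    {u : ℝ × ℝ → ℝ} {q : ℝ × ℝ} (hu : ContDiffAt ℝ ∞ u q) (hq : (q.1, q.2, u q) ∈ box I J K) :
    charac v u =ᶠ[𝓝 q] fun z => R z.1 * u z + S z.1 z.2 - τ z.1 * dt u z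
      - (a z.1 * z.2 + b z.1) * dx u z := by
  have hc : ContinuousAt (fun q' : ℝ × ℝ => ((q'.1, q'.2, u q') : Base)) q :=
    (contDiffAt_graph hu).continuousAt
  filter_upwards [hc.eventually_mem ((isOpen_box hI hJ hK).mem_nhds hq)] with z hz
  simp only [charac, hv _ hz]

/-- The terms in τ and the highest-order term in ξ are exactly those that the definition of the
prolongation adds back. Of ξ only its slope a survives, once for each of the n differentiations. -/
theorem zetaX_eq (hI : IsOpen I) (hJ : IsOpen J) (hK : IsOpen K)
    (hv : ∀ p ∈ box I J K, v p =
      (τ p.1, a p.1 * p.2.1 + b p.1, R p.1 * p.2.2 + S p.1 p.2.1))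
    (hS : ∀ t ∈ I, ContDiffOn ℝ ∞ (S t) J)
    {u : ℝ × ℝ → ℝ} {q : ℝ × ℝ} (hu : ContDiffAt ℝ ∞ u q) (hq : (q.1, q.2, u q) ∈ box I J K)
    (n : ℕ) : zetaX v n u q = (R q.1 - n * a q.1) * dx^[n] u q + iteratedDeriv n (S q.1) q.2 := by
  obtain ⟨t, x⟩ := q
  have hle : (n : WithTop ℕ∞) ≤ ∞ := by exact_mod_cast le_top
  have hline : ∀ {w : ℝ × ℝ → ℝ}, ContDiffAt ℝ ∞ w (t, x) →
      ContDiffAt ℝ ∞ (fun y => w (t, y)) x := fun hw =>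
    ContDiffAt.comp x hw (contDiffAt_const.prodMk contDiffAt_id)
  have s1 := hline hu
  have s2 : ContDiffAt ℝ ∞ (S t) x := (hS t hq.1).contDiffAt (hJ.mem_nhds hq.2.1)
  have s3 := hline (contDiffAt_dt hu)
  have s4 : ContDiffAt ℝ ∞ (deriv fun y => u (t, y)) x := hline (contDiffAt_dx hu)
  have s5 : ContDiffAt ℝ ∞ (fun y => a t * y + b t) x := by fun_prop
  have e : dx^[n] (charac v u) (t, x) = R t * dx^[n] u (t, x) + iteratedDeriv n (S t) x
      - τ t * dx^[n] (dt u) (t, x) - ((a t * x + b t) * dx^[n + 1] u (t, x)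
        + n * a t * dx^[n] u (t, x)) := by
    rw [dx_iterate_congr (charac_eventuallyEq hI hJ hK hv hu hq)]
    simp only [dx_iterate_apply]
    rw [← iteratedDeriv_affine_mul_deriv (a t) (b t) s1 n, ← iteratedDeriv_const_mul_field,
      ← iteratedDeriv_const_mul_field,
      ← iteratedDeriv_fun_add ((contDiffAt_const.mul s1).of_le hle) (s2.of_le hle),
      ← iteratedDeriv_fun_sub (((contDiffAt_const.mul s1).add s2).of_le hle)
        ((contDiffAt_const.mul s3).of_le hle),
      ← iteratedDeriv_fun_sub
        ((((contDiffAt_const.mul s1).add s2).sub (contDiffAt_const.mul s3)).of_le hle)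
        ((s5.mul s4).of_le hle)]
    rfl
  rw [zetaX, e, dt_dx_iterate_comm hu, ← Function.iterate_succ_apply' dx]
  simp only [hv _ hq]
  ring

theorem zetaT_eq (hI : IsOpen I) (hJ : IsOpen J) (hK : IsOpen K)
    (hv : ∀ p ∈ box I J K, v p =
      (τ p.1, a p.1 * p.2.1 + b p.1, R p.1 * p.2.2 + S p.1 p.2.1))
    (hτ : ContDiffOn ℝ ∞ τ I) (ha : ContDiffOn ℝ ∞ a I) (hb : ContDiffOn ℝ ∞ b I)
    (hR : ContDiffOn ℝ ∞ R I) (hS : ∀ x ∈ J, ContDiffOn ℝ ∞ (fun t => S t x) I)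
    {u : ℝ × ℝ → ℝ} {q : ℝ × ℝ} (hu : ContDiffAt ℝ ∞ u q) (hq : (q.1, q.2, u q) ∈ box I J K) :
    zetaT v u q = deriv R q.1 * u q + R q.1 * dt u q + deriv (fun t => S t q.2) q.1
      - deriv τ q.1 * dt u q - (deriv a q.1 * q.2 + deriv b q.1) * dx u q := by
  obtain ⟨t, x⟩ := q
  have hD : ∀ {f : ℝ → ℝ}, ContDiffOn ℝ ∞ f I → HasDerivAt f (deriv f t) t := fun hf =>
    ((hf.contDiffAt (hI.mem_nhds hq.1)).differentiableAt (by simp)).hasDerivAt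
  have hline : ∀ {w : ℝ × ℝ → ℝ}, ContDiffAt ℝ ∞ w (t, x) →
      HasDerivAt (fun s => w (s, x)) (dt w (t, x)) t := fun {w} hw => by
    have h : DifferentiableAt ℝ (fun s => w (s, x)) t :=
      DifferentiableAt.comp t (g := w) (f := fun s => (s, x)) (hw.differentiableAt (by simp))
        (by fun_prop)
    exact h.hasDerivAt
  have hl : Tendsto (fun s => (s, x)) (𝓝 t) (𝓝 (t, x)) := Continuous.tendsto (by fun_prop) t
  have e : HasDerivAt (fun s => charac v u (s, x)) (deriv R t * u (t, x) + R t * dt u (t, x)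
      + deriv (fun t => S t x) t - (deriv τ t * dt u (t, x) + τ t * dt (dt u) (t, x))
      - ((deriv a t * x + deriv b t) * dx u (t, x)
        + (a t * x + b t) * dt (dx u) (t, x))) t := by
    refine HasDerivAt.congr_of_eventuallyEq ?_
      (hl.eventually (charac_eventuallyEq hI hJ hK hv hu hq))
    exact ((((hD hR).mul (hline hu)).add (hD (hS x hq.2.1))).sub
      ((hD hτ).mul (hline (contDiffAt_dt hu)))).sub
      ((((hD ha).mul_const x).add (hD hb)).mul (hline (contDiffAt_dx hu)))
  have e' : dt (charac v u) (t, x) = _ := e.deriv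
  rw [zetaT, e', dt_dx_comm hu]
  simp only [hv _ hq]
  ring

end Prolongation

/-! ### The fields that span the equivalence algebra -/

/-- The `(t, x, u)`-components of the linear combinations of the generators. -/
def genBase (a b : ℝ) (α R : ℝ → ℝ) : Base → Base := fun p =>
  (α p.1, a * p.2.1 + b, R p.1 * p.2.2)

/-- The factors with which the linear combinations of the generators scale the coefficients. -/
noncomputable def genRate (a : ℝ) (α R : ℝ → ℝ) (t : ℝ) : Coeff :=
  ![5 * a - deriv α t, 3 * a - deriv α t, 3 * a - deriv α t - R t, a - deriv α t - R t,
    3 * a - deriv α t - R t, -deriv α t]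

/-- The components of the linear combinations of the generators along the coefficients. -/
noncomputable def genCoeff (a : ℝ) (α R : ℝ → ℝ) : Base × Coeff → Coeff := fun z i =>
  genRate a α R z.1.1 i * z.2 i - if i = 5 then deriv R z.1.1 else 0

section Generators

variable {I J K : Set ℝ}

theorem genCoeff_apply (a : ℝ) (α R : ℝ → ℝ) (p : Base) (c : Coeff) :
    genCoeff a α R (p, c) = ![(5 * a - deriv α p.1) * c 0, (3 * a - deriv α p.1) * c 1,
      (3 * a - deriv α p.1 - R p.1) * c 2, (a - deriv α p.1 - R p.1) * c 3,
      (3 * a - deriv α p.1 - R p.1) * c 4, -deriv α p.1 * c 5 - deriv R p.1] := by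
  ext i
  fin_cases i <;> simp [genCoeff, genRate]

theorem exists_mem_generatorSpan (a b : ℝ) {α R : ℝ → ℝ} (hα : ContDiffOn ℝ ∞ α I)
    (hR : ContDiffOn ℝ ∞ R I) :
    ((genBase a b α R, genCoeff a α R) : VectorField) ∈ generatorSpan I := by
  have e : ((genBase a b α R, genCoeff a α R) : VectorField) =
      -- `Y₁` already contributes a u/2 to the u-component, hence the correction of R by a/2.
      a • Y₁ + b • Y₂ + Yα α + Yr (fun t => R t - a / 2) := by
    refine Prod.ext (funext fun p => ?_) (funext fun z => ?_)
    · simp [genBase, Y₁, Y₂, Yα, Yr]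
      ring
    · obtain ⟨p, c⟩ := z
      simp only [genCoeff_apply]
      ext i
      simp only [Prod.snd_add, Prod.smul_snd, Pi.add_apply, Pi.smul_apply, smul_eq_mul]
      fin_cases i <;> simp [Y₁, Y₂, Yα, Yr] <;> ring
  rw [e]
  refine Submodule.add_mem _ (Submodule.add_mem _ (Submodule.add_mem _
    (Submodule.smul_mem _ _ ?_) (Submodule.smul_mem _ _ ?_)) ?_) ?_ <;>
    apply Submodule.subset_span
  · exact Or.inl (Or.inl (by simp))
  · exact Or.inl (Or.inl (by simp))
  · exact Or.inl (Or.inr ⟨α, hα, rfl⟩)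
  · exact Or.inr ⟨_, hR.sub contDiffOn_const, rfl⟩

/-- Agreement is asserted only for t in I: elsewhere α and R need not be differentiable, and `deriv`
need not be additive. -/
theorem exists_of_mem_generatorSpan (hI : IsOpen I) {Z : VectorField} (hZ : Z ∈ generatorSpan I) :
    ∃ (a b : ℝ) (α R : ℝ → ℝ), ContDiffOn ℝ ∞ α I ∧ ContDiffOn ℝ ∞ R I ∧
      ∀ p : Base, p.1 ∈ I → Z.1 p = genBase a b α R p ∧
        ∀ c, Z.2 (p, c) = genCoeff a α R (p, c) := by
  induction hZ using Submodule.span_induction with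
  | mem Z hZ =>
    rcases hZ with ((hZ | hZ) | ⟨α, hα, rfl⟩) | ⟨r, hr, rfl⟩
    · rw [hZ]
      refine ⟨1, 0, 0, fun _ => 1 / 2, contDiffOn_const, contDiffOn_const, fun p _ => ⟨?_, ?_⟩⟩
      · simp [genBase, Y₁]
      · intro c
        rw [genCoeff_apply]
        ext i
        fin_cases i <;> simp [Y₁] <;> norm_num
    · rw [mem_singleton_iff.1 hZ]
      refine ⟨0, 1, 0, 0, contDiffOn_const, contDiffOn_const, fun p _ => ⟨?_, ?_⟩⟩
      · simp [genBase, Y₂]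
      · intro c
        rw [genCoeff_apply]
        ext i
        fin_cases i <;> simp [Y₂]
    · refine ⟨0, 0, α, 0, hα, contDiffOn_const, fun p _ => ⟨?_, ?_⟩⟩
      · simp [genBase, Yα]
      · intro c
        rw [genCoeff_apply]
        ext i
        fin_cases i <;> simp [Yα]
    · refine ⟨0, 0, 0, r, contDiffOn_const, hr, fun p _ => ⟨?_, ?_⟩⟩
      · simp [genBase, Yr]
      · intro c
        rw [genCoeff_apply]
        ext i
        fin_cases i <;> simp [Yr]
  | zero =>
    refine ⟨0, 0, 0, 0, contDiffOn_const, contDiffOn_const, fun p _ => ⟨?_, ?_⟩⟩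
    · simp [genBase]
      rfl
    · intro c
      rw [genCoeff_apply]
      ext i
      fin_cases i <;> simp
  | add Z Z' _ _ ih ih' =>
    obtain ⟨a, b, α, R, hα, hR, h⟩ := ih
    obtain ⟨a', b', α', R', hα', hR', h'⟩ := ih'
    refine ⟨a + a', b + b', α + α', R + R', hα.add hα', hR.add hR', fun p hp => ⟨?_, fun c => ?_⟩⟩
    · rw [Prod.fst_add, Pi.add_apply, (h p hp).1, (h' p hp).1]
      simp [genBase]
      exact ⟨by ring, by ring⟩
    · have hd : ∀ {f : ℝ → ℝ}, ContDiffOn ℝ ∞ f I → DifferentiableAt ℝ f p.1 := fun hf =>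
        (hf.contDiffAt (hI.mem_nhds hp)).differentiableAt (by simp)
      rw [Prod.snd_add, Pi.add_apply, (h p hp).2, (h' p hp).2, genCoeff_apply, genCoeff_apply,
        genCoeff_apply, deriv_add (hd hα) (hd hα'), deriv_add (hd hR) (hd hR')]
      ext i
      fin_cases i <;> simp <;> ring
  | smul k Z _ ih =>
    obtain ⟨a, b, α, R, hα, hR, h⟩ := ih
    refine ⟨k * a, k * b, fun t => k * α t, fun t => k * R t, contDiffOn_const.mul hα,
      contDiffOn_const.mul hR, fun p hp => ⟨?_, fun c => ?_⟩⟩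
    · rw [Prod.smul_fst, Pi.smul_apply, (h p hp).1]
      simp [genBase]
      exact ⟨by ring, by ring⟩
    · rw [Prod.smul_snd, Pi.smul_apply, (h p hp).2, genCoeff_apply, genCoeff_apply,
        deriv_const_mul_field, deriv_const_mul_field]
      ext i
      fin_cases i <;> simp <;> ring

/-! ### The generators satisfy the invariance criterion -/

theorem pt_eq_fderiv {f : Base → ℝ} {p : Base} (hf : DifferentiableAt ℝ f p) :
    pt f p = fderiv ℝ f p (1, 0, 0) := by
  have e : HasDerivAt (fun s : ℝ => ((s, p.2.1, p.2.2) : Base)) (1, 0, 0) p.1 :=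
    (hasDerivAt_id _).prodMk ((hasDerivAt_const _ _).prodMk (hasDerivAt_const _ _))
  exact (HasFDerivAt.comp_hasDerivAt p.1 (f := fun s : ℝ => ((s, p.2.1, p.2.2) : Base))
    hf.hasFDerivAt e).deriv

theorem px_eq_fderiv {f : Base → ℝ} {p : Base} (hf : DifferentiableAt ℝ f p) :
    px f p = fderiv ℝ f p (0, 1, 0) := by
  have e : HasDerivAt (fun s : ℝ => ((p.1, s, p.2.2) : Base)) (0, 1, 0) p.2.1 :=
    (hasDerivAt_const _ _).prodMk ((hasDerivAt_id _).prodMk (hasDerivAt_const _ _))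
  exact (HasFDerivAt.comp_hasDerivAt p.2.1 (f := fun s : ℝ => ((p.1, s, p.2.2) : Base))
    hf.hasFDerivAt e).deriv

theorem pu_eq_fderiv {f : Base → ℝ} {p : Base} (hf : DifferentiableAt ℝ f p) :
    pu f p = fderiv ℝ f p (0, 0, 1) := by
  have e : HasDerivAt (fun s : ℝ => ((p.1, p.2.1, s) : Base)) (0, 0, 1) p.2.2 :=
    (hasDerivAt_const _ _).prodMk ((hasDerivAt_const _ _).prodMk (hasDerivAt_id _))
  exact (HasFDerivAt.comp_hasDerivAt p.2.2 (f := fun s : ℝ => ((p.1, p.2.1, s) : Base))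
    hf.hasFDerivAt e).deriv

theorem isEquivalenceGenerator_of_eqOn (hI : IsOpen I) (hJ : IsOpen J) (hK : IsOpen K)
    {Y : VectorField} {a b : ℝ} {α R : ℝ → ℝ} (hα : ContDiffOn ℝ ∞ α I) (hR : ContDiffOn ℝ ∞ R I)
    (h1 : EqOn Y.1 (genBase a b α R) (box I J K))
    (h2 : EqOn Y.2 (genCoeff a α R) (box I J K ×ˢ admissible)) :
    IsEquivalenceGenerator (box I J K) Y := by
  have hα' : ContDiffOn ℝ ∞ (deriv α) I := hα.deriv_of_isOpen hI (by simp)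
  have hR' : ContDiffOn ℝ ∞ (deriv R) I := hR.deriv_of_isOpen hI (by simp)
  have hadm : IsOpen admissible :=
    (isOpen_ne.preimage (continuous_apply (0 : Fin 6))).inter
      (isOpen_ne.preimage (continuous_apply (2 : Fin 6)))
  have hD := isOpen_box hI hJ hK
  constructor
  · have hf : ∀ {f : ℝ → ℝ}, ContDiffOn ℝ ∞ f I →
        ContDiffOn ℝ ∞ (fun p : Base => f p.1) (box I J K) := fun hf =>
      hf.comp contDiff_fst.contDiffOn fun p hp => hp.1
    have hR1 := hf hR
    have hα1 := hf hα
    refine ContDiffOn.congr ?_ h1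
    exact hα1.prodMk (ContDiffOn.prodMk (by fun_prop) (hR1.mul (by fun_prop)))
  · have hf : ∀ {f : ℝ → ℝ}, ContDiffOn ℝ ∞ f I →
        ContDiffOn ℝ ∞ (fun z : Base × Coeff => f z.1.1) (box I J K ×ˢ admissible) := fun hf =>
      hf.comp (contDiff_fst.comp contDiff_fst).contDiffOn fun p hp => hp.1.1
    have e1 := hf hα'
    have e2 := hf hR'
    have e3 := hf hR
    refine ContDiffOn.congr ?_ h2
    rw [contDiffOn_pi]
    intro i
    have ec : ContDiffOn ℝ ∞ (fun z : Base × Coeff => z.2 i) (box I J K ×ˢ admissible) := by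
      fun_prop
    simp only [genCoeff]
    refine ContDiffOn.sub (ContDiffOn.mul ?_ ec) ?_
    · fin_cases i <;> simp only [genRate]
      · exact contDiffOn_const.sub e1
      · exact contDiffOn_const.sub e1
      · exact (contDiffOn_const.sub e1).sub e3
      · exact (contDiffOn_const.sub e1).sub e3
      · exact (contDiffOn_const.sub e1).sub e3
      · exact e1.neg
    · split_ifs
      · exact e2
      · exact contDiffOn_const
  · intro u q c hu hq hc hl
    have hv : ∀ p ∈ box I J K, Y.1 p = (α p.1, (fun _ => a) p.1 * p.2.1 + (fun _ => b) p.1,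
        R p.1 * p.2.2 + (fun _ _ => (0 : ℝ)) p.1 p.2.1) := fun p hp => by
      rw [h1 hp]; simp [genBase]
    have hX := zetaX_eq (v := Y.1) (τ := α) (a := fun _ => a) (b := fun _ => b) (R := R)
      (S := fun _ _ => 0) hI hJ hK hv (fun _ _ => contDiffOn_const) hu hq
    have hT := zetaT_eq (v := Y.1) (τ := α) (a := fun _ => a) (b := fun _ => b) (R := R)
      (S := fun _ _ => 0) hI hJ hK hv hα contDiffOn_const contDiffOn_const hR
      (fun _ _ => contDiffOn_const) hu hq
    have hX1 := hX 1
    rw [Function.iterate_one] at hX1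
    rw [prolongLhs, h2 (show ((q.1, q.2, u q), c) ∈ box I J K ×ˢ admissible from ⟨hq, hc⟩),
      genCoeff_apply, hT, hX 5, hX 3, hX 2, hX1, hv _ hq]
    rw [lhs] at hl
    simp only [iteratedDeriv_const, deriv_const]
    simp [Matrix.cons_val] at hl ⊢
    -- The prolonged field multiplies the left-hand side by R - α_t.
    linear_combination (R q.1 - deriv α q.1) * hl
  -- The second derivatives cancel by symmetry, and what remains is a multiple of θ_x, respectively
  -- θ_u, which vanish at the point.
  · intro θ p hθ hp hc hθ0 i
    set f : Base → ℝ := fun z => θ z i with hf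
    have hfs : ContDiffAt ℝ ∞ f p := contDiffAt_pi.1 hθ i
    have hft : pt f =ᶠ[𝓝 p] fun z => fderiv ℝ f z (1, 0, 0) :=
      (eventually_differentiableAt hfs).mono fun _ hz => pt_eq_fderiv hz
    have hfx : px f =ᶠ[𝓝 p] fun z => fderiv ℝ f z (0, 1, 0) :=
      (eventually_differentiableAt hfs).mono fun _ hz => px_eq_fderiv hz
    have hfu : pu f =ᶠ[𝓝 p] fun z => fderiv ℝ f z (0, 0, 1) :=
      (eventually_differentiableAt hfs).mono fun _ hz => pu_eq_fderiv hz
    have dd : ∀ e, DifferentiableAt ℝ (fun z => fderiv ℝ f z e) p := fun e =>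
      (contDiffAt_fderiv_apply hfs e).differentiableAt (by simp)
    have dt' := hft.differentiableAt_iff.2 (dd _)
    have dx' := hfx.differentiableAt_iff.2 (dd _)
    have du' := hfu.differentiableAt_iff.2 (dd _)
    have hfd := hfs.differentiableAt (by simp)
    have ctx : px (pt f) p = pt (px f) p := by
      rw [px_eq_fderiv dt', pt_eq_fderiv dx', hft.fderiv_eq, hfx.fderiv_eq, fderiv_fderiv_comm hfs]
    have ctu : pu (pt f) p = pt (pu f) p := by
      rw [pu_eq_fderiv dt', pt_eq_fderiv du', hft.fderiv_eq, hfu.fderiv_eq, fderiv_fderiv_comm hfs]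
    have cxu : pu (px f) p = px (pu f) p := by
      rw [pu_eq_fderiv dx', px_eq_fderiv du', hfx.fderiv_eq, hfu.fderiv_eq, fderiv_fderiv_comm hfs]
    obtain ⟨t, x, w⟩ := p
    have hx0 : px f (t, x, w) = 0 := (hθ0 i).1
    have hu0 : pu f (t, x, w) = 0 := (hθ0 i).2
    have hY : Y.1 (t, x, w) = (α t, a * x + b, R t * w) := h1 hp
    have hch : auxCharac Y θ i =ᶠ[𝓝 (t, x, w)] fun z =>
        genRate a α R z.1 i * f z - (if i = 5 then deriv R z.1 else 0) - α z.1 * pt f z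
          - (a * z.2.1 + b) * px f z - R z.1 * z.2.2 * pu f z := by
      filter_upwards [hD.mem_nhds hp, hθ.continuousAt.eventually_mem (hadm.mem_nhds hc)]
        with z hz1 hz2
      have e2 := h2 (show (z, θ z) ∈ box I J K ×ˢ admissible from ⟨hz1, hz2⟩)
      simp only [auxCharac, e2, h1 hz1]
      simp [genCoeff, genBase, hf]
    have lx : ∀ {g : Base → ℝ}, DifferentiableAt ℝ g (t, x, w) →
        HasDerivAt (fun y => g (t, y, w)) (px g (t, x, w)) x := fun {g} hg => by
      have : DifferentiableAt ℝ (fun y => g (t, y, w)) x :=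
        DifferentiableAt.comp x (g := g) (f := fun y => (t, y, w)) hg (by fun_prop)
      exact this.hasDerivAt
    have lu : ∀ {g : Base → ℝ}, DifferentiableAt ℝ g (t, x, w) →
        HasDerivAt (fun y => g (t, x, y)) (pu g (t, x, w)) w := fun {g} hg => by
      have : DifferentiableAt ℝ (fun y => g (t, x, y)) w :=
        DifferentiableAt.comp w (g := g) (f := fun y => (t, x, y)) hg (by fun_prop)
      exact this.hasDerivAt
    have tx : Tendsto (fun y => ((t, y, w) : Base)) (𝓝 x) (𝓝 (t, x, w)) :=
      Continuous.tendsto (by fun_prop) x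
    have tu : Tendsto (fun y => ((t, x, y) : Base)) (𝓝 w) (𝓝 (t, x, w)) :=
      Continuous.tendsto (by fun_prop) w
    have hax : HasDerivAt (fun y => a * y + b) a x := by
      simpa using ((hasDerivAt_id x).const_mul a).add_const b
    have hRu : HasDerivAt (fun y => R t * y) (R t) w := by
      simpa using (hasDerivAt_id w).const_mul (R t)
    have sx : HasDerivAt (fun y => genRate a α R t i * f (t, y, w)
        - (if i = 5 then deriv R t else 0) - α t * pt f (t, y, w) - (a * y + b) * px f (t, y, w)
        - R t * w * pu f (t, y, w)) (genRate a α R t i * px f (t, x, w)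
        - α t * px (pt f) (t, x, w) - (a * px f (t, x, w) + (a * x + b) * px (px f) (t, x, w))
        - R t * w * px (pu f) (t, x, w)) x :=
      (((((lx hfd).const_mul _).sub_const _).sub ((lx dt').const_mul _)).sub
        (hax.mul (lx dx'))).sub ((lx du').const_mul _)
    have su : HasDerivAt (fun y => genRate a α R t i * f (t, x, y)
        - (if i = 5 then deriv R t else 0) - α t * pt f (t, x, y) - (a * x + b) * px f (t, x, y)
        - R t * y * pu f (t, x, y)) (genRate a α R t i * pu f (t, x, w)
        - α t * pu (pt f) (t, x, w) - (a * x + b) * pu (px f) (t, x, w)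
        - (R t * pu f (t, x, w) + R t * w * pu (pu f) (t, x, w))) w :=
      (((((lu hfd).const_mul _).sub_const _).sub ((lu dt').const_mul _)).sub
        ((lu dx').const_mul _)).sub (hRu.mul (lu du'))
    have ex : px (auxCharac Y θ i) (t, x, w) = _ :=
      (sx.congr_of_eventuallyEq (tx.eventually hch)).deriv
    have eu : pu (auxCharac Y θ i) (t, x, w) = _ :=
      (su.congr_of_eventuallyEq (tu.eventually hch)).deriv
    constructor
    · rw [auxX, ex, ctx, hx0, hY, cxu]
      ring
    · rw [auxU, eu, ctu, hu0, hY, cxu]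
      ring

end Generators

/-! ### Prolongation along polynomial test functions -/

section Necessity

variable {I J K : Set ℝ} {Y : VectorField}

theorem hasDerivAt_coordinate_lines {f : Base → Base} {p : Base} (hf : DifferentiableAt ℝ f p) :
    HasDerivAt (fun s => f (s, p.2.1, p.2.2)) (fderiv ℝ f p (1, 0, 0)) p.1 ∧
    HasDerivAt (fun y => f (p.1, y, p.2.2)) (fderiv ℝ f p (0, 1, 0)) p.2.1 ∧
    HasDerivAt (fun w => f (p.1, p.2.1, w)) (fderiv ℝ f p (0, 0, 1)) p.2.2 :=
  ⟨HasFDerivAt.comp_hasDerivAt p.1 (f := fun s : ℝ => ((s, p.2.1, p.2.2) : Base)) hf.hasFDerivAt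
      ((hasDerivAt_id _).prodMk ((hasDerivAt_const _ _).prodMk (hasDerivAt_const _ _))),
    HasFDerivAt.comp_hasDerivAt p.2.1 (f := fun s : ℝ => ((p.1, s, p.2.2) : Base)) hf.hasFDerivAt
      ((hasDerivAt_const _ _).prodMk ((hasDerivAt_id _).prodMk (hasDerivAt_const _ _))),
    HasFDerivAt.comp_hasDerivAt p.2.2 (f := fun s : ℝ => ((p.1, p.2.1, s) : Base)) hf.hasFDerivAt
      ((hasDerivAt_const _ _).prodMk ((hasDerivAt_const _ _).prodMk (hasDerivAt_id _)))⟩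

/-- The test functions c + (t - t₀) d satisfy the auxiliary equations identically and have an
arbitrary t-derivative d. The criterion becomes the vanishing of the x- and u-derivatives of ω - τ
d; the values d = 0 and d = 1 then separate ω from τ. -/
theorem IsEquivalenceGenerator.deriv_aux (h : IsEquivalenceGenerator (box I J K) Y) {p : Base}
    {c : Coeff} (hp : p ∈ box I J K) (hc : c ∈ admissible) (d : ℝ) (i : Fin 6) :
    deriv (fun y => Y.2 ((p.1, y, p.2.2), c) i - (Y.1 (p.1, y, p.2.2)).1 * d) p.2.1 = 0 ∧
    deriv (fun w => Y.2 ((p.1, p.2.1, w), c) i - (Y.1 (p.1, p.2.1, w)).1 * d) p.2.2 = 0 := by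
  set θ : Base → Coeff := fun z => c + (z.1 - p.1) • fun _ => d with hθ
  have hx : ∀ j, (px fun z => θ z j) = fun _ => 0 := fun j => by ext z; simp [px, hθ]
  have hu : ∀ j, (pu fun z => θ z j) = fun _ => 0 := fun j => by ext z; simp [pu, hθ]
  have ht : ∀ j, (pt fun z => θ z j) = fun _ => d := fun j => by ext z; simp [pt, hθ]
  have h0 : θ p = c := by simp [hθ]
  have hs : ContDiffAt ℝ ∞ θ p := by rw [hθ]; fun_prop
  have H := h.invariant_aux θ p hs hp (by rwa [h0]) (fun j => by simp [hx, hu]) i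
  have hch : auxCharac Y θ i = fun z => Y.2 (z, θ z) i - (Y.1 z).1 * d := by
    ext z
    simp [auxCharac, hx, hu, ht]
  simp only [auxX, auxU, hx, hu, hch] at H
  simpa [px, pu, pt, hθ] using H

theorem IsEquivalenceGenerator.hasDerivAt_coeff (h : IsEquivalenceGenerator (box I J K) Y)
    (hI : IsOpen I) (hJ : IsOpen J) (hK : IsOpen K) {p : Base} {c : Coeff} (hp : p ∈ box I J K)
    (hc : c ∈ admissible) (i : Fin 6) :
    (HasDerivAt (fun y => Y.2 ((p.1, y, p.2.2), c) i) 0 p.2.1 ∧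
      HasDerivAt (fun w => Y.2 ((p.1, p.2.1, w), c) i) 0 p.2.2) ∧
    (HasDerivAt (fun y => (Y.1 (p.1, y, p.2.2)).1) 0 p.2.1 ∧
      HasDerivAt (fun w => (Y.1 (p.1, p.2.1, w)).1) 0 p.2.2) := by
  have hadm : IsOpen admissible :=
    (isOpen_ne.preimage (continuous_apply (0 : Fin 6))).inter
      (isOpen_ne.preimage (continuous_apply (2 : Fin 6)))
  have hd1 : DifferentiableAt ℝ Y.1 p :=
    (h.smooth_base.contDiffAt ((isOpen_box hI hJ hK).mem_nhds hp)).differentiableAt (by simp)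
  have hd2 : DifferentiableAt ℝ Y.2 (p, c) :=
    (h.smooth_coeff.contDiffAt (((isOpen_box hI hJ hK).prod hadm).mem_nhds
      ⟨hp, hc⟩)).differentiableAt (by simp)
  have hd3 : DifferentiableAt ℝ (fun z => Y.2 (z, c) i) p :=
    differentiableAt_pi.1
      (DifferentiableAt.comp p (g := Y.2) (f := fun z => (z, c)) hd2 (by fun_prop)) i
  have e1 : DifferentiableAt ℝ (fun y => Y.2 ((p.1, y, p.2.2), c) i) p.2.1 :=
    DifferentiableAt.comp p.2.1 (g := fun z : Base => Y.2 (z, c) i)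
      (f := fun y => (p.1, y, p.2.2)) hd3 (by fun_prop)
  have e2 : DifferentiableAt ℝ (fun y => Y.2 ((p.1, p.2.1, y), c) i) p.2.2 :=
    DifferentiableAt.comp p.2.2 (g := fun z : Base => Y.2 (z, c) i)
      (f := fun y => (p.1, p.2.1, y)) hd3 (by fun_prop)
  obtain ⟨-, e3, e4⟩ := hasDerivAt_coordinate_lines hd1
  have h0 := h.deriv_aux hp hc 0 i
  have h1 := h.deriv_aux hp hc 1 i
  simp only [mul_zero, sub_zero, mul_one] at h0 h1
  have e1' := e1.hasDerivAt
  have e2' := e2.hasDerivAt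
  rw [h0.1] at e1'
  rw [h0.2] at e2'
  have e3' : HasDerivAt (fun y => (Y.1 (p.1, y, p.2.2)).1) (fderiv ℝ Y.1 p (0, 1, 0)).1 p.2.1 :=
    e3.fst
  have e4' : HasDerivAt (fun w => (Y.1 (p.1, p.2.1, w)).1) (fderiv ℝ Y.1 p (0, 0, 1)).1 p.2.2 :=
    e4.fst
  have e5 := (e1'.fun_sub e3').deriv
  have e6 := (e2'.fun_sub e4').deriv
  rw [h1.1, zero_sub] at e5
  rw [h1.2, zero_sub] at e6
  refine ⟨⟨e1', e2'⟩, ?_, ?_⟩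
  · rwa [neg_eq_zero.1 e5.symm] at e3'
  · rwa [neg_eq_zero.1 e6.symm] at e4'

theorem eq_of_hasDerivAt_zero_box {F : Base → ℝ} (hJ : IsOpen J) (hJ' : J.OrdConnected)
    (hK : IsOpen K) (hK' : K.OrdConnected)
    (hx : ∀ p ∈ box I J K, HasDerivAt (fun y => F (p.1, y, p.2.2)) 0 p.2.1)
    (hu : ∀ p ∈ box I J K, HasDerivAt (fun w => F (p.1, p.2.1, w)) 0 p.2.2)
    {t x w x' w' : ℝ} (hp : (t, x, w) ∈ box I J K) (hp' : (t, x', w') ∈ box I J K) :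
    F (t, x, w) = F (t, x', w') := by
  have e1 : F (t, x, w) = F (t, x', w) :=
    eq_of_hasDerivAt_zero (f := fun y => F (t, y, w)) hJ hJ'
      (fun y hy => hx (t, y, w) ⟨hp.1, hy, hp.2.2⟩) hp.2.1 hp'.2.1
  have e2 : F (t, x', w) = F (t, x', w') :=
    eq_of_hasDerivAt_zero (f := fun y => F (t, x', y)) hK hK'
      (fun y hy => hu (t, x', y) ⟨hp.1, hp'.2.1, hy⟩) hp.2.2 hp'.2.2
  exact e1.trans e2

theorem IsEquivalenceGenerator.coeff_eq (h : IsEquivalenceGenerator (box I J K) Y)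
    (hI : IsOpen I) (hJ : IsOpen J) (hJ' : J.OrdConnected) (hK : IsOpen K)
    (hK' : K.OrdConnected) {t x w x' w' : ℝ} {c : Coeff} (hp : (t, x, w) ∈ box I J K)
    (hp' : (t, x', w') ∈ box I J K) (hc : c ∈ admissible) :
    Y.2 ((t, x, w), c) = Y.2 ((t, x', w'), c) := by
  ext i
  exact eq_of_hasDerivAt_zero_box (F := fun p => Y.2 (p, c) i) hJ hJ' hK hK'
    (fun p hp => (h.hasDerivAt_coeff hI hJ hK hp hc i).1.1)
    (fun p hp => (h.hasDerivAt_coeff hI hJ hK hp hc i).1.2) hp hp'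

theorem testCoeff_mem_admissible (e f t : ℝ) : testCoeff e f t ∈ admissible :=
  (isClassCoeff_testCoeff univ e f).2 t (mem_univ t)

theorem IsEquivalenceGenerator.time_eq (h : IsEquivalenceGenerator (box I J K) Y)
    (hI : IsOpen I) (hJ : IsOpen J) (hJ' : J.OrdConnected) (hK : IsOpen K)
    (hK' : K.OrdConnected) {t x w x' w' : ℝ} (hp : (t, x, w) ∈ box I J K)
    (hp' : (t, x', w') ∈ box I J K) : (Y.1 (t, x, w)).1 = (Y.1 (t, x', w')).1 :=
  have hc := testCoeff_mem_admissible 0 0 0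
  eq_of_hasDerivAt_zero_box (F := fun p => (Y.1 p).1) hJ hJ' hK hK'
    (fun _ hp => (h.hasDerivAt_coeff hI hJ hK hp hc 0).2.1)
    (fun _ hp => (h.hasDerivAt_coeff hI hJ hK hp hc 0).2.2) hp hp'

/-- Along `jetFun` the derivative u_t is constant, and τ does not vary with x or u, so τ u_t
contributes a constant that any positive number of x-derivatives removes. -/
theorem zetaX_jetFun (hJ : IsOpen J) (hK : IsOpen K) {v : Base → Base} {t x m : ℝ} {p : ℕ → ℝ}
    (hp : (t, x, p 0) ∈ box I J K)
    (hv : ∀ x' ∈ J, ∀ w' ∈ K, (v (t, x', w')).1 = (v (t, x, p 0)).1) {n : ℕ} (hn : 0 < n) :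
    zetaX v n (jetFun (t, x) m p) (t, x) =
      iteratedDeriv n (fun y => (v (t, y, jetFun (t, x) m p (t, y))).2.2 -
        (v (t, y, jetFun (t, x) m p (t, y))).2.1 * dx (jetFun (t, x) m p) (t, y)) x +
      (v (t, x, p 0)).2.1 * if n < 5 then p (n + 1) else 0 := by
  set u := jetFun (t, x) m p with hu
  have hus : ContDiff ℝ ∞ u := contDiff_jetFun _ _ _
  have hu0 : u (t, x) = p 0 := jetFun_self _ _ _
  have hcK : ∀ᶠ y in 𝓝 x, u (t, y) ∈ K := by
    have : ContinuousAt (fun y => u (t, y)) x := by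
      have := hus.continuous; fun_prop
    exact this.eventually_mem (hK.mem_nhds (by rw [hu0]; exact hp.2.2))
  have e1 : dx^[n] (charac v u) (t, x) =
      iteratedDeriv n (fun y => (v (t, y, u (t, y))).2.2 -
        (v (t, y, u (t, y))).2.1 * dx u (t, y)) x := by
    rw [dx_iterate_apply]
    refine Eq.trans (Filter.EventuallyEq.iteratedDeriv_eq n ?_)
      (iteratedDeriv_const_add hn (-((v (t, x, p 0)).1 * m)))
    filter_upwards [hJ.mem_nhds hp.2.1, hcK] with y hy1 hy2
    simp only [charac, hv y hy1 _ hy2]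
    rw [hu, dt_jetFun]
    ring
  obtain ⟨k, rfl⟩ := Nat.exists_eq_succ_of_ne_zero hn.ne'
  rw [zetaX, e1]
  have e2 : dt (dx^[k + 1] u) (t, x) = 0 := by rw [hu, dx_iterate_jetFun_succ, dt_jetFun]
  have e3 : dx (dx^[k + 1] u) (t, x) = if k + 1 < 5 then p (k + 1 + 1) else 0 := by
    rw [← Function.iterate_succ_apply' dx, hu, dx_iterate_jetFun_succ, jetFun_self]
    simp
  rw [Nat.succ_eq_add_one, e2, e3]
  simp only [hu0]
  ring

theorem zetaT_jetFun {v : Base → Base} {t x m : ℝ} {p : ℕ → ℝ}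
    (hv : DifferentiableAt ℝ v (t, x, p 0)) :
    zetaT v (jetFun (t, x) m p) (t, x) =
      (fderiv ℝ v (t, x, p 0) (1, 0, m)).2.2 - (fderiv ℝ v (t, x, p 0) (1, 0, m)).1 * m
        - (fderiv ℝ v (t, x, p 0) (1, 0, m)).2.1 * p 1 := by
  have e1 : dt (jetFun (t, x) m p) = fun _ => m := dt_jetFun _ _ _
  have e2 : ∀ s, dx (jetFun (t, x) m p) (s, x) = p 1 := fun s => by
    rw [dx_jetFun]
    simp [jetFun, Finset.sum_range_succ]
  have e3 : ∀ s, jetFun (t, x) m p (s, x) = m * (s - t) + p 0 := fun s => by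
    simp [jetFun, Finset.sum_range_succ]
  have hl : HasDerivAt (fun s => v (s, x, m * (s - t) + p 0))
      (fderiv ℝ v (t, x, p 0) (1, 0, m)) t := by
    have h1 : HasDerivAt (fun s : ℝ => m * (s - t) + p 0) m t := by
      simpa using (((hasDerivAt_id t).sub_const t).const_mul m).add_const (p 0)
    have h2 : HasDerivAt (fun s : ℝ => ((s, x, m * (s - t) + p 0) : Base)) (1, 0, m) t :=
      (hasDerivAt_id _).prodMk ((hasDerivAt_const _ _).prodMk h1)
    refine HasFDerivAt.comp_hasDerivAt t (f := fun s : ℝ => ((s, x, m * (s - t) + p 0) : Base))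
      ?_ h2
    simpa using hv.hasFDerivAt
  have e4 : dt (charac v (jetFun (t, x) m p)) (t, x) =
      (fderiv ℝ v (t, x, p 0) (1, 0, m)).2.2 - (fderiv ℝ v (t, x, p 0) (1, 0, m)).1 * m
        - (fderiv ℝ v (t, x, p 0) (1, 0, m)).2.1 * p 1 := by
    have h1 : HasDerivAt (fun s => (v (s, x, m * (s - t) + p 0)).1)
      (fderiv ℝ v (t, x, p 0) (1, 0, m)).1 t := hl.fst
    have h2 : HasDerivAt (fun s => (v (s, x, m * (s - t) + p 0)).2.1)
      (fderiv ℝ v (t, x, p 0) (1, 0, m)).2.1 t := hl.snd.fst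
    have h3 : HasDerivAt (fun s => (v (s, x, m * (s - t) + p 0)).2.2)
      (fderiv ℝ v (t, x, p 0) (1, 0, m)).2.2 t := hl.snd.snd
    have := ((h3.fun_sub (h1.mul_const m)).fun_sub (h2.mul_const (p 1))).deriv
    have e : ∀ s, charac v (jetFun (t, x) m p) (s, x) =
        (v (s, x, m * (s - t) + p 0)).2.2 - (v (s, x, m * (s - t) + p 0)).1 * m
          - (v (s, x, m * (s - t) + p 0)).2.1 * p 1 := fun s => by
      simp only [charac, e1, e2, e3]
    simp only [dt, e]
    exact this
  have e5 : ∀ q : ℝ × ℝ, dt (fun _ => m) q = 0 := fun q => by simp [dt]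
  have e6 : ∀ q : ℝ × ℝ, dx (fun _ => m) q = 0 := fun q => by simp [dx]
  rw [zetaT, e4, e1, e5, e6]
  ring

end Necessity

/-! ### Necessity of the form of the infinitesimal transformations -/

/-- A first-order version of `fiber_expansion`; it suffices for perturbations that are themselves of
fifth order. -/
theorem isLittleO_fiber_perturbation {f : ℝ × ℝ → ℝ} {x : ℝ} {h d : ℝ → ℝ}
    (hf : ContDiffAt ℝ ∞ f (x, h x)) (hh : ContinuousAt h x) (hd : ContinuousAt d x)
    (hd0 : d x = 0) :
    (fun y => f (y, h y + d y) - f (y, h y) - d y * fderiv ℝ f (x, h x) (0, 1)) =o[𝓝 x] d := by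
  have hst := hf.hasStrictFDerivAt (n := ∞) (by simp)
  have hc : ContinuousAt (fun y => ((y, h y + d y), (y, h y))) x := by fun_prop
  have hl : Tendsto (fun y => ((y, h y + d y), (y, h y))) (𝓝 x) (𝓝 ((x, h x), (x, h x))) := by
    simpa [ContinuousAt, hd0] using hc
  refine (((hasStrictFDerivAt_iff_isLittleO.1 hst).comp_tendsto hl).congr_left
    fun y => ?_).trans_isBigO ?_
  · have : ((y, h y + d y) : ℝ × ℝ) - (y, h y) = d y • ((0, 1) : ℝ × ℝ) := by ext <;> simp
    simp only [Function.comp_apply, this, map_smul, smul_eq_mul]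
  · refine IsBigO.of_bound 1 (Eventually.of_forall fun y => ?_)
    simp [Prod.norm_def]

/-- The derivatives of the characteristic of `ξ ∂_x + η ∂_u` along `h(y) = w + z (y - x)` and
along `h(y) + (y - x)^5`. -/
theorem iteratedDeriv_charac_perturbation {η ξ : ℝ × ℝ → ℝ} {x w : ℝ} (z : ℝ)
    (hη : ContDiffAt ℝ ∞ η (x, w)) (hξ : ContDiffAt ℝ ∞ ξ (x, w)) {k : ℕ} (hk : k ≤ 5)
    (hk4 : k ≠ 4) :
    iteratedDeriv k (fun y => η (y, w + z * (y - x) + (y - x) ^ 5) -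
        ξ (y, w + z * (y - x) + (y - x) ^ 5) * (z + 5 * (y - x) ^ 4)) x =
      iteratedDeriv k (fun y => η (y, w + z * (y - x)) - ξ (y, w + z * (y - x)) * z) x +
        if k = 5 then 120 * (fderiv ℝ η (x, w) (0, 1) - z * fderiv ℝ ξ (x, w) (0, 1)
          - 5 * fderiv ℝ ξ (x, w) (1, z)) else 0 := by
  have hη' : ContDiffAt ℝ ∞ η (x, w + z * (x - x)) := by simpa using hη
  have hξ' : ContDiffAt ℝ ∞ ξ (x, w + z * (x - x)) := by simpa using hξ
  have a1 := isLittleO_fiber_perturbation (h := fun y => w + z * (y - x))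
    (d := fun y => (y - x) ^ 5) hη' (by fun_prop) (by fun_prop) (by simp)
  have a2 := isLittleO_fiber_perturbation (h := fun y => w + z * (y - x))
    (d := fun y => (y - x) ^ 5) hξ' (by fun_prop) (by fun_prop) (by simp)
  have a3 : HasDerivAt (fun y => ξ (y, w + z * (y - x) + (y - x) ^ 5)) (fderiv ℝ ξ (x, w) (1, z))
      x := by
    have h0 : HasDerivAt (fun y : ℝ => w + z * (y - x)) z x := by
      simpa using (((hasDerivAt_id x).sub_const x).const_mul z).const_add w
    have h5 : HasDerivAt (fun y : ℝ => (y - x) ^ 5) 0 x := by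
      simpa using ((hasDerivAt_id x).sub_const x).fun_pow 5
    have h1 : HasDerivAt (fun y : ℝ => (y, w + z * (y - x) + (y - x) ^ 5)) ((1 : ℝ), z) x := by
      simpa using (hasDerivAt_id x).prodMk (h0.fun_add h5)
    refine HasFDerivAt.comp_hasDerivAt x
      (f := fun y : ℝ => (y, w + z * (y - x) + (y - x) ^ 5)) ?_ h1
    simpa using (hξ.differentiableAt (by simp)).hasFDerivAt
  -- The derivative of (y - x)^5 multiplies ξ by 5(y - x)^4. Its leading part touches only the
  -- excluded fourth derivative; the next term brings in the derivative of ξ along the slope z.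
  have a4 : (fun y => (y - x) ^ 4 * (ξ (y, w + z * (y - x) + (y - x) ^ 5) - ξ (x, w)
      - fderiv ℝ ξ (x, w) (1, z) * (y - x))) =o[𝓝 x] fun y => (y - x) ^ 5 := by
    have h0 : (fun y => ξ (y, w + z * (y - x) + (y - x) ^ 5) - ξ (x, w)
        - fderiv ℝ ξ (x, w) (1, z) * (y - x)) =o[𝓝 x] fun y => y - x :=
      (hasDerivAt_iff_isLittleO.1 a3).congr_left fun s => by simp [mul_comm]
    exact ((isBigO_refl (fun y : ℝ => (y - x) ^ 4) (𝓝 x)).mul_isLittleO h0).congr_right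
      fun y => by ring
  have s0 : ∀ {f : ℝ × ℝ → ℝ}, ContDiffAt ℝ ∞ f (x, w) →
      ContDiffAt ℝ ∞ (fun y => f (y, w + z * (y - x) + (y - x) ^ 5)) x ∧
      ContDiffAt ℝ ∞ (fun y => f (y, w + z * (y - x))) x := fun {f} hf =>
    ⟨ContDiffAt.comp x (g := f) (f := fun y => (y, w + z * (y - x) + (y - x) ^ 5))
        (by simpa using hf) (by fun_prop),
      ContDiffAt.comp x (g := f) (f := fun y => (y, w + z * (y - x)))
        (by simpa using hf) (by fun_prop)⟩
  set g₁ : ℝ → ℝ := fun y => η (y, w + z * (y - x) + (y - x) ^ 5) -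
    ξ (y, w + z * (y - x) + (y - x) ^ 5) * (z + 5 * (y - x) ^ 4) with hg₁
  set g₂ : ℝ → ℝ := fun y => η (y, w + z * (y - x)) - ξ (y, w + z * (y - x)) * z with hg₂
  have s1 : ContDiffAt ℝ ∞ g₁ x := (s0 hη).1.sub ((s0 hξ).1.mul (by fun_prop))
  have s2 : ContDiffAt ℝ ∞ g₂ x := (s0 hη).2.sub ((s0 hξ).2.mul (by fun_prop))
  have s12 : ContDiffAt ℝ ∞ (g₁ - g₂) x := s1.sub s2
  have s3 : ContDiffAt ℝ ∞ (fun y : ℝ => -5 * ξ (x, w) * (y - x) ^ 4) x := by fun_prop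
  have hle : ∀ n : ℕ, (n : WithTop ℕ∞) ≤ ∞ := fun n => by exact_mod_cast le_top
  have h4 := iteratedDeriv_eq_of_isLittleO (n := 5) (x₀ := x)
    (c := fderiv ℝ η (x, w) (0, 1) - z * fderiv ℝ ξ (x, w) (0, 1)
          - 5 * fderiv ℝ ξ (x, w) (1, z))
    (f := (g₁ - g₂) - fun y => -5 * ξ (x, w) * (y - x) ^ 4)
    ((s12.sub s3).of_le (hle 5))
    (((a1.sub (a2.const_mul_left z)).sub (a4.const_mul_left 5)).congr_left fun y => by
      simp only [Pi.sub_apply, sub_self, mul_zero, add_zero, hg₁, hg₂]; ring) hk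
  rw [iteratedDeriv_sub (s12.of_le (hle k)) (s3.of_le (hle k)),
    iteratedDeriv_sub (s1.of_le (hle k)) (s2.of_le (hle k)), iteratedDeriv_const_mul_field,
    iteratedDeriv_pow_sub, if_neg hk4] at h4
  have h5 : ((5).factorial : ℝ) = 120 := by norm_num [Nat.factorial]
  rw [h5] at h4
  linear_combination h4

section Necessity

variable {I J K : Set ℝ} {Y : VectorField}

theorem IsEquivalenceGenerator.contDiffAt (h : IsEquivalenceGenerator (box I J K) Y)
    (hI : IsOpen I) (hJ : IsOpen J) (hK : IsOpen K) {p : Base} (hp : p ∈ box I J K) :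
    ContDiffAt ℝ ∞ Y.1 p := h.smooth_base.contDiffAt ((isOpen_box hI hJ hK).mem_nhds hp)

theorem IsEquivalenceGenerator.fderiv_time (h : IsEquivalenceGenerator (box I J K) Y)
    (hI : IsOpen I) (hJ : IsOpen J) (hK : IsOpen K) {p : Base} (hp : p ∈ box I J K) :
    (fderiv ℝ Y.1 p (0, 0, 1)).1 = 0 := by
  obtain ⟨-, -, e⟩ :=
    hasDerivAt_coordinate_lines ((h.contDiffAt hI hJ hK hp).differentiableAt (by simp))
  have e' : HasDerivAt (fun w => (Y.1 (p.1, p.2.1, w)).1) (fderiv ℝ Y.1 p (0, 0, 1)).1 p.2.2 :=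
    e.fst
  exact e'.unique (h.hasDerivAt_coeff hI hJ hK hp (testCoeff_mem_admissible 0 0 0) 0).2.2

/-- The invariance criterion for u_t + u_xxxxx + u u_xxx = 0 on jets with u_xx = u_xxx = 0. The
condition u_t = -u_xxxxx makes them solutions, while r4 and r5 remain free to vary. -/
theorem IsEquivalenceGenerator.prolong_jetFun (h : IsEquivalenceGenerator (box I J K) Y)
    {t x w : ℝ} (hp : (t, x, w) ∈ box I J K) (z r4 r5 : ℝ) :
    zetaT Y.1 (jetFun (t, x) (-r5) (jet w z 0 0 r4 r5)) (t, x)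
      + Y.2 ((t, x, w), testCoeff 0 0 0) 0 * r5
      + zetaX Y.1 5 (jetFun (t, x) (-r5) (jet w z 0 0 r4 r5)) (t, x)
      + w * zetaX Y.1 3 (jetFun (t, x) (-r5) (jet w z 0 0 r4 r5)) (t, x)
      + Y.2 ((t, x, w), testCoeff 0 0 0) 3 * w * z
      + Y.2 ((t, x, w), testCoeff 0 0 0) 5 * w = 0 := by
  have h0 : jetFun (t, x) (-r5) (jet w z 0 0 r4 r5) (t, x) = w := jetFun_self _ _ _
  have h1 : dx (jetFun (t, x) (-r5) (jet w z 0 0 r4 r5)) (t, x) = z :=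
    dx_iterate_jetFun (t, x) _ _ (n := 1) (by norm_num)
  have H := h.invariant_eq (jetFun (t, x) (-r5) (jet w z 0 0 r4 r5)) (t, x) (testCoeff 0 0 0)
    (contDiff_jetFun _ _ _).contDiffAt (by rw [h0]; exact hp) (testCoeff_mem_admissible 0 0 0)
    (by rw [lhs_testCoeff_jetFun]; simp [jet])
  rw [prolongLhs, h0, h1, dx_iterate_jetFun _ _ _ (by norm_num),
    dx_iterate_jetFun _ _ _ (by norm_num), dx_iterate_jetFun _ _ _ (by norm_num)] at H
  simp only [jet] at H
  have c0 : testCoeff 0 0 0 0 = 1 := rfl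
  have c1 : testCoeff 0 0 0 1 = 0 := rfl
  have c2 : testCoeff 0 0 0 2 = 1 := rfl
  have c3 : testCoeff 0 0 0 3 = 0 := rfl
  have c4 : testCoeff 0 0 0 4 = 0 := rfl
  have c5 : testCoeff 0 0 0 5 = 0 := rfl
  rw [c0, c1, c2, c3, c4, c5] at H
  linear_combination H

/-- Infinitesimal analogue of `fderiv_space_pow`: raising u_xxxxx by 120 and lowering u_t by 120
gives τ_t + ω¹ = 5 (ξ_x + z ξ_u). Comparing z = 0 with z = 1 forces ξ_u = 0. -/
theorem IsEquivalenceGenerator.fderiv_space (h : IsEquivalenceGenerator (box I J K) Y)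
    (hI : IsOpen I) (hJ : IsOpen J) (hJ' : J.OrdConnected) (hK : IsOpen K)
    (hK' : K.OrdConnected) {t x w : ℝ} (hp : (t, x, w) ∈ box I J K) :
    (fderiv ℝ Y.1 (t, x, w) (0, 0, 1)).2.1 = 0 ∧
    (fderiv ℝ Y.1 (t, x, w) (1, 0, 0)).1 + Y.2 ((t, x, w), testCoeff 0 0 0) 0 =
      5 * (fderiv ℝ Y.1 (t, x, w) (0, 1, 0)).2.1 := by
  have hs := h.contDiffAt hI hJ hK hp
  have hd := hs.differentiableAt (by simp)
  set L := fderiv ℝ Y.1 (t, x, w) with hL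
  have hsl : ContDiffAt ℝ ∞ (fun z : ℝ × ℝ => Y.1 (t, z.1, z.2)) (x, w) :=
    ContDiffAt.comp (x, w) (g := Y.1) (f := fun z : ℝ × ℝ => ((t, z.1, z.2) : Base)) hs
      (by fun_prop)
  have hfd : ∀ a b : ℝ,
      fderiv ℝ (fun z : ℝ × ℝ => (Y.1 (t, z.1, z.2)).2.2) (x, w) (a, b) = (L (0, a, b)).2.2 ∧
      fderiv ℝ (fun z : ℝ × ℝ => (Y.1 (t, z.1, z.2)).2.1) (x, w) (a, b) = (L (0, a, b)).2.1 := by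
    intro a b
    have e : HasFDerivAt (fun z : ℝ × ℝ => ((t, z.1, z.2) : Base))
        ((0 : ℝ × ℝ →L[ℝ] ℝ).prod ((ContinuousLinearMap.fst ℝ ℝ ℝ).prod
          (ContinuousLinearMap.snd ℝ ℝ ℝ))) (x, w) :=
      (hasFDerivAt_const _ _).prodMk (hasFDerivAt_fst.prodMk hasFDerivAt_snd)
    have e' : HasFDerivAt (fun z : ℝ × ℝ => Y.1 (t, z.1, z.2)) _ (x, w) :=
      HasFDerivAt.comp (x, w) (g := Y.1) hd.hasFDerivAt e
    constructor
    · rw [e'.snd.snd.fderiv]; rfl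
    · rw [e'.snd.fst.fderiv]; rfl
  have hτ : ∀ x' ∈ J, ∀ w' ∈ K, (Y.1 (t, x', w')).1 = (Y.1 (t, x, w)).1 := fun x' hx' w' hw' =>
    h.time_eq hI hJ hJ' hK hK' ⟨hp.1, hx', hw'⟩ hp
  have hX : ∀ z : ℝ, ∀ k ≤ 5, k ≠ 4 → 0 < k →
      zetaX Y.1 k (jetFun (t, x) (-120) (jet w z 0 0 0 120)) (t, x) =
      zetaX Y.1 k (jetFun (t, x) (-0) (jet w z 0 0 0 0)) (t, x) +
        if k = 5 then 120 * ((L (0, 0, 1)).2.2 - z * (L (0, 0, 1)).2.1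
          - 5 * (L (0, 1, z)).2.1) else 0 := by
    intro z k hk hk4 hk0
    have j0 : ∀ y, jetFun (t, x) (-0) (jet w z 0 0 0 0) (t, y) = w + z * (y - x) := fun y => by
      simp [jetFun, Finset.sum_range_succ, jet]
    have j1 : ∀ y, jetFun (t, x) (-120) (jet w z 0 0 0 120) (t, y)
        = w + z * (y - x) + (y - x) ^ 5 := fun y => by
      simp [jetFun, Finset.sum_range_succ, jet, Nat.factorial]
    have d0 : ∀ y, dx (jetFun (t, x) (-0) (jet w z 0 0 0 0)) (t, y) = z := fun y => by
      rw [dx_jetFun]; simp [jetFun, Finset.sum_range_succ, jet]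
    have d1 : ∀ y, dx (jetFun (t, x) (-120) (jet w z 0 0 0 120)) (t, y)
        = z + 5 * (y - x) ^ 4 := fun y => by
      rw [dx_jetFun]; simp [jetFun, Finset.sum_range_succ, jet, Nat.factorial]
      ring
    rw [zetaX_jetFun hJ hK (p := jet w z 0 0 0 120) hp hτ hk0,
      zetaX_jetFun hJ hK (p := jet w z 0 0 0 0) hp hτ hk0]
    simp only [j0, j1, d0, d1]
    have e := iteratedDeriv_charac_perturbation (η := fun z : ℝ × ℝ => (Y.1 (t, z.1, z.2)).2.2)
      (ξ := fun z : ℝ × ℝ => (Y.1 (t, z.1, z.2)).2.1) z hsl.snd.snd hsl.snd.fst hk hk4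
    rw [(hfd 0 1).1, (hfd 0 1).2, (hfd 1 z).2] at e
    rw [e]
    have hj : (if k < 5 then jet w z 0 0 0 120 (k + 1) else 0)
        = if k < 5 then jet w z 0 0 0 0 (k + 1) else 0 := by
      interval_cases k <;> simp_all [jet]
    rw [hj, add_right_comm]
    rfl
  have key : ∀ z : ℝ, (L (1, 0, 0)).1 + Y.2 ((t, x, w), testCoeff 0 0 0) 0
      = 5 * ((L (0, 1, 0)).2.1 + z * (L (0, 0, 1)).2.1) := by
    intro z
    have k0 := h.prolong_jetFun hp z 0 0
    have k1 := h.prolong_jetFun hp z 0 120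
    rw [hX z 5 le_rfl (by norm_num) (by norm_num), if_pos rfl,
      hX z 3 (by norm_num) (by norm_num) (by norm_num), if_neg (by norm_num),
      zetaT_jetFun (p := jet w z 0 0 0 120) hd] at k1
    rw [zetaT_jetFun (p := jet w z 0 0 0 0) hd] at k0
    have hLt := h.fderiv_time hI hJ hK hp
    simp only [jet] at k0 k1
    rw [← hL] at k0 k1 hLt
    rw [clm_apply_eq L 1 0] at k0 k1
    rw [clm_apply_eq L 0 1 z] at k1
    simp only [Prod.fst_add, Prod.snd_add, Prod.smul_fst, Prod.smul_snd, smul_eq_mul, hLt]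
      at k0 k1
    linear_combination (k1 - k0) / 120
  have z0 := key 0
  have z1 := key 1
  exact ⟨by linarith, by linarith⟩

end Necessity

/-! ### Affine components and the final coefficient comparison -/

section Necessity

variable {I J K : Set ℝ} {Y : VectorField}

theorem sub_eq_mul_of_hasDerivAt {f : ℝ → ℝ} {A : ℝ} (hJ : IsOpen J) (hJ' : J.OrdConnected)
    (hf : ∀ y ∈ J, HasDerivAt f A y) {x x' : ℝ} (hx : x ∈ J) (hx' : x' ∈ J) :
    f x - f x' = A * (x - x') := by
  have := eq_of_hasDerivAt_zero (f := fun y => f y - A * y) hJ hJ'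
    (fun y hy => by simpa using (hf y hy).fun_sub ((hasDerivAt_id y).const_mul A)) hx hx'
  linarith

theorem IsEquivalenceGenerator.exists_affine (h : IsEquivalenceGenerator (box I J K) Y)
    (hI : IsOpen I) (hJ : IsOpen J) (hJ' : J.OrdConnected) (hJ₀ : J.Nonempty) (hK : IsOpen K)
    (hK' : K.OrdConnected) (hK₀ : K.Nonempty) :
    ∃ τ a b : ℝ → ℝ, ContDiffOn ℝ ∞ τ I ∧ ContDiffOn ℝ ∞ a I ∧ ContDiffOn ℝ ∞ b I ∧
      ∀ p ∈ box I J K, (Y.1 p).1 = τ p.1 ∧ (Y.1 p).2.1 = a p.1 * p.2.1 + b p.1 := by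
  obtain ⟨x₀, hx₀⟩ := id hJ₀
  obtain ⟨w₀, hw₀⟩ := id hK₀
  have hd : ∀ {p : Base}, p ∈ box I J K → DifferentiableAt ℝ Y.1 p := fun hp =>
    (h.contDiffAt hI hJ hK hp).differentiableAt (by simp)
  have hτt : ∀ {t x w : ℝ}, (t, x, w) ∈ box I J K →
      (fderiv ℝ Y.1 (t, x, w) (1, 0, 0)).1 = deriv (fun s => (Y.1 (s, x₀, w₀)).1) t := by
    intro t x w hp
    have e : HasDerivAt (fun s => (Y.1 (s, x, w)).1) (fderiv ℝ Y.1 (t, x, w) (1, 0, 0)).1 t :=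
      (hasDerivAt_coordinate_lines (hd hp)).1.fst
    refine (e.congr_of_eventuallyEq ?_).deriv.symm
    filter_upwards [hI.mem_nhds hp.1] with s hs
    exact h.time_eq hI hJ hJ' hK hK' ⟨hs, hx₀, hw₀⟩ ⟨hs, hp.2.1, hp.2.2⟩
  -- The value of ξ_x prescribed by `fderiv_space`; it depends on t alone because τ and ω do not
  -- depend on (x, u).
  set A : ℝ → ℝ := fun t => (deriv (fun s => (Y.1 (s, x₀, w₀)).1) t +
    Y.2 ((t, x₀, w₀), testCoeff 0 0 0) 0) / 5 with hA
  have hξx : ∀ {t x w : ℝ}, (t, x, w) ∈ box I J K →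
      HasDerivAt (fun y => (Y.1 (t, y, w)).2.1) (A t) x := by
    intro t x w hp
    have e : HasDerivAt (fun y => (Y.1 (t, y, w)).2.1) (fderiv ℝ Y.1 (t, x, w) (0, 1, 0)).2.1 x :=
      (hasDerivAt_coordinate_lines (hd hp)).2.1.snd.fst
    have e1 := (h.fderiv_space hI hJ hJ' hK hK' hp).2
    rw [hτt hp, h.coeff_eq hI hJ hJ' hK hK' hp (show (t, x₀, w₀) ∈ box I J K from ⟨hp.1, hx₀, hw₀⟩)
      (testCoeff_mem_admissible 0 0 0)] at e1
    have e2 : A t = (fderiv ℝ Y.1 (t, x, w) (0, 1, 0)).2.1 := by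
      simp only [hA]; linarith
    rwa [e2]
  have hξu : ∀ {t x w : ℝ}, (t, x, w) ∈ box I J K →
      (Y.1 (t, x, w)).2.1 = (Y.1 (t, x, w₀)).2.1 := by
    intro t x w hp
    refine eq_of_hasDerivAt_zero (f := fun y => (Y.1 (t, x, y)).2.1) hK hK' (fun y hy => ?_)
      hp.2.2 hw₀
    have hb : (t, x, y) ∈ box I J K := ⟨hp.1, hp.2.1, hy⟩
    rw [← (h.fderiv_space hI hJ hJ' hK hK' hb).1]
    exact (hasDerivAt_coordinate_lines (hd hb)).2.2.snd.fst
  -- The roles of x and u are exchanged, so that `exists_affine_in_u` gives affinity of ξ in x.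
  have hsw : ContDiffOn ℝ ∞ (fun p : Base => (Y.1 (p.1, p.2.2, p.2.1)).2.1) (box I K J) :=
    (h.smooth_base.comp (f := fun p : Base => ((p.1, p.2.2, p.2.1) : Base)) (by fun_prop)
      fun p hp => ⟨hp.1, hp.2.2, hp.2.1⟩).snd.fst
  obtain ⟨a, S, ha, hS, -, hξ⟩ := exists_affine_in_u hJ hJ₀ hK₀ hsw fun t ht =>
    ⟨A t, fun w hw x hx x' hx' => sub_eq_mul_of_hasDerivAt (f := fun y => (Y.1 (t, y, w)).2.1)
      hJ hJ' (fun y hy => hξx ⟨ht, hy, hw⟩) hx hx'⟩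
  refine ⟨fun t => (Y.1 (t, x₀, w₀)).1, a, fun t => S t w₀, ?_, ha, hS w₀ hw₀, ?_⟩
  · exact (contDiffOn_slices h.smooth_base.fst (t := 0)).1 hx₀ hw₀
  · rintro ⟨t, x, w⟩ hp
    refine ⟨h.time_eq hI hJ hJ' hK hK' hp ⟨hp.1, hx₀, hw₀⟩, ?_⟩
    rw [hξu hp]
    exact hξ (t, w₀, x) ⟨hp.1, hw₀, hp.2.1⟩

theorem zetaX_jetFun_of_affine (hJ : IsOpen J) (hK : IsOpen K) {v : Base → Base} {τ a b : ℝ → ℝ}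
    (hv : ∀ p ∈ box I J K, (v p).1 = τ p.1 ∧ (v p).2.1 = a p.1 * p.2.1 + b p.1)
    (hs : ContDiffOn ℝ ∞ (fun p => (v p).2.2) (box I J K)) (hI : IsOpen I) {t x m : ℝ} {p : ℕ → ℝ}
    (hp : (t, x, p 0) ∈ box I J K) {n : ℕ} (hn : 0 < n) (hn5 : n ≤ 5) :
    zetaX v n (jetFun (t, x) m p) (t, x) =
      iteratedDeriv n (fun y => (v (t, y, jetFun (t, x) m p (t, y))).2.2) x - n * a t * p n := by
  rw [zetaX_jetFun hJ hK hp (fun x' hx' w' hw' => by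
    rw [(hv (t, x', w') ⟨hp.1, hx', hw'⟩).1, (hv _ hp).1]) hn, (hv _ hp).2]
  set u := jetFun (t, x) m p with hu
  have hus : ContDiff ℝ ∞ u := contDiff_jetFun _ _ _
  have hu0 : u (t, x) = p 0 := jetFun_self _ _ _
  have hul : ContDiff ℝ ∞ (fun y => u (t, y)) := hus.comp (by fun_prop)
  have hcK : ∀ᶠ y in 𝓝 x, u (t, y) ∈ K :=
    hul.continuous.continuousAt.eventually_mem (hK.mem_nhds (by rw [hu0]; exact hp.2.2))
  have hle : (n : WithTop ℕ∞) ≤ ∞ := by exact_mod_cast le_top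
  have s1 : ContDiffAt ℝ ∞ (fun y => (v (t, y, u (t, y))).2.2) x := by
    have h1 : ContDiffAt ℝ ∞ (fun p => (v p).2.2) (t, x, u (t, x)) :=
      hs.contDiffAt ((isOpen_box hI hJ hK).mem_nhds (by rw [hu0]; exact hp))
    exact ContDiffAt.comp x (g := fun p => (v p).2.2) (f := fun y => ((t, y, u (t, y)) : Base)) h1
      (contDiffAt_const.prodMk (contDiffAt_id.prodMk hul.contDiffAt))
  have s2 : ContDiffAt ℝ ∞ (fun y => (a t * y + b t) * deriv (fun y => u (t, y)) y) x := by
    have h1 : ContDiff ℝ ∞ (deriv fun y => u (t, y)) := (contDiff_infty_iff_deriv.1 hul).2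
    exact (ContDiff.mul (by fun_prop) h1).contDiffAt
  have e : iteratedDeriv n (fun y => (v (t, y, u (t, y))).2.2 -
      (v (t, y, u (t, y))).2.1 * dx u (t, y)) x =
      iteratedDeriv n (fun y => (v (t, y, u (t, y))).2.2) x -
      iteratedDeriv n (fun y => (a t * y + b t) * deriv (fun y => u (t, y)) y) x := by
    rw [← iteratedDeriv_fun_sub (s1.of_le hle) (s2.of_le hle)]
    refine Filter.EventuallyEq.iteratedDeriv_eq n ?_
    filter_upwards [hJ.mem_nhds hp.2.1, hcK] with y hy1 hy2
    rw [(hv (t, y, u (t, y)) ⟨hp.1, hy1, hy2⟩).2]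
    rfl
  have e1 : iteratedDeriv n (fun y => u (t, y)) x = p n := by
    rw [← dx_iterate_apply n u (t, x), hu, dx_iterate_jetFun _ _ _ (by omega)]
  have e2 : iteratedDeriv (n + 1) (fun y => u (t, y)) x = if n < 5 then p (n + 1) else 0 := by
    rw [← dx_iterate_apply (n + 1) u (t, x), hu, dx_iterate_jetFun_succ, jetFun_self]
    simp
  rw [e, iteratedDeriv_affine_mul_deriv _ _ hul.contDiffAt, e1, e2]
  ring

/-- As for finite transformations: varying u_xxxx by 4! keeps the jet a solution, and in the
criterion only the fifth derivative of η along the graph could react. -/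
theorem IsEquivalenceGenerator.exists_slope (h : IsEquivalenceGenerator (box I J K) Y)
    (hI : IsOpen I) (hJ : IsOpen J) (hJ' : J.OrdConnected) (hK : IsOpen K)
    (hK' : K.OrdConnected) {τ a b : ℝ → ℝ}
    (hv : ∀ p ∈ box I J K, (Y.1 p).1 = τ p.1 ∧ (Y.1 p).2.1 = a p.1 * p.2.1 + b p.1)
    {t : ℝ} (ht : t ∈ I) :
    ∃ R : ℝ, ∀ x ∈ J, ∀ w ∈ K, ∀ w' ∈ K,
      (Y.1 (t, x, w)).2.2 - (Y.1 (t, x, w')).2.2 = R * (w - w') := by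
  set f : ℝ × ℝ → ℝ := fun z => (Y.1 (t, z.1, z.2)).2.2 with hf
  have hfs : ContDiffOn ℝ ∞ f (J ×ˢ K) :=
    (h.smooth_base.comp (f := fun z : ℝ × ℝ => ((t, z.1, z.2) : Base)) (by fun_prop)
      fun z hz => ⟨ht, hz.1, hz.2⟩).snd.snd
  refine FifthOrderKdV.exists_slope hJ hJ' hK hK' hfs fun x hx w hw z => ?_
  have hp : (t, x, w) ∈ box I J K := ⟨ht, hx, hw⟩
  have k0 := h.prolong_jetFun hp z 0 0
  have k1 := h.prolong_jetFun hp z 24 0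
  have hd := (h.contDiffAt hI hJ hK hp).differentiableAt (by simp)
  have j0 : ∀ y, jetFun (t, x) (-0) (jet w z 0 0 0 0) (t, y) = w + z * (y - x) := fun y => by
    simp [jetFun, Finset.sum_range_succ, jet]
  have j1 : ∀ y, jetFun (t, x) (-0) (jet w z 0 0 24 0) (t, y) = w + z * (y - x) + (y - x) ^ 4 :=
    fun y => by simp [jetFun, Finset.sum_range_succ, jet, Nat.factorial]
  have Z0 : ∀ k : ℕ, 0 < k → k ≤ 5 →
      zetaX Y.1 k (jetFun (t, x) (-0) (jet w z 0 0 0 0)) (t, x) = _ := fun k hk hk5 =>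
    zetaX_jetFun_of_affine (p := jet w z 0 0 0 0) hJ hK hv h.smooth_base.snd.snd hI hp hk hk5
  have Z1 : ∀ k : ℕ, 0 < k → k ≤ 5 →
      zetaX Y.1 k (jetFun (t, x) (-0) (jet w z 0 0 24 0)) (t, x) = _ := fun k hk hk5 =>
    zetaX_jetFun_of_affine (p := jet w z 0 0 24 0) hJ hK hv h.smooth_base.snd.snd hI hp hk hk5
  rw [Z0 5 (by norm_num) le_rfl, Z0 3 (by norm_num) (by norm_num),
    zetaT_jetFun (p := jet w z 0 0 0 0) hd] at k0
  rw [Z1 5 (by norm_num) le_rfl, Z1 3 (by norm_num) (by norm_num),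
    zetaT_jetFun (p := jet w z 0 0 24 0) hd] at k1
  simp only [j0, jet] at k0
  simp only [j1, jet] at k1
  have hO : IsOpen (J ×ˢ K) := hJ.prod hK
  have hfx : ContDiffAt ℝ ∞ f (x, w + z * (x - x)) := by
    simpa using hfs.contDiffAt (hO.mem_nhds ⟨hx, hw⟩)
  have hφ : DifferentiableAt ℝ (fun y => fderiv ℝ f (y, w + z * (y - x)) (0, 1)) x :=
    DifferentiableAt.comp x (g := fun p => fderiv ℝ f p (0, 1)) (f := fun y => (y, w + z * (y - x)))
      ((contDiffAt_fderiv_apply hfx _).differentiableAt (by simp)) (by fun_prop)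
  have P : iteratedDeriv 3 (fun y => (Y.1 (t, y, w + z * (y - x) + (y - x) ^ 4)).2.2) x =
      iteratedDeriv 3 (fun y => (Y.1 (t, y, w + z * (y - x))).2.2) x := by
    have := iteratedDeriv_fiber_perturbation (h := fun y => w + z * (y - x)) hfx (by fun_prop)
      hφ.hasDerivAt (k := 3) (by norm_num) (by norm_num)
    rwa [if_neg (by norm_num), add_zero] at this
  rw [P] at k1
  show iteratedDeriv 5 (fun y => (Y.1 (t, y, w + z * (y - x) + (y - x) ^ 4)).2.2) x =
      iteratedDeriv 5 (fun y => (Y.1 (t, y, w + z * (y - x))).2.2) x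
  linear_combination k1 - k0

/-- Infinitesimal equivalence transformations are combinations of the generators. -/
theorem IsEquivalenceGenerator.exists_eqOn (h : IsEquivalenceGenerator (box I J K) Y)
    (hI : IsOpen I) (hI' : I.OrdConnected) (hI₀ : I.Nonempty) (hJ : IsOpen J)
    (hJ' : J.OrdConnected) (hJ₀ : J.Nonempty) (hK : IsOpen K)
    (hK' : K.OrdConnected) (hK₀ : K.Nonempty) :
    ∃ (a b : ℝ) (α R : ℝ → ℝ), ContDiffOn ℝ ∞ α I ∧ ContDiffOn ℝ ∞ R I ∧
      EqOn Y.1 (genBase a b α R) (box I J K) ∧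
      EqOn Y.2 (genCoeff a α R) (box I J K ×ˢ admissible) := by
  obtain ⟨τ, a, b, hτ, ha, hb, hv⟩ := h.exists_affine hI hJ hJ' hJ₀ hK hK' hK₀
  obtain ⟨R, S, hR, hSt, hSx, hη⟩ := exists_affine_in_u hK hK₀ hJ₀ h.smooth_base.snd.snd
    fun t ht => h.exists_slope hI hJ hJ' hK hK' hv ht
  obtain ⟨x₀, hx₀⟩ := id hJ₀
  obtain ⟨x₁, hx₁, hx₁'⟩ := (dense_compl_singleton x₀).inter_open_nonempty J hJ hJ₀
  obtain ⟨w₀, hw₀⟩ := id hK₀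
  obtain ⟨w₁, hw₁, hw₁'⟩ := (dense_compl_singleton w₀).inter_open_nonempty K hK hK₀
  have hwne : w₁ - w₀ ≠ 0 := sub_ne_zero.2 hw₁'
  have hv' : ∀ p ∈ box I J K, Y.1 p =
      (τ p.1, a p.1 * p.2.1 + b p.1, R p.1 * p.2.2 + S p.1 p.2.1) := fun p hp =>
    Prod.ext (hv p hp).1 (Prod.ext (hv p hp).2 (hη p hp))
  -- The invariance criterion with u_t eliminated, for arbitrary coefficient values c. The
  -- components ω are evaluated at the reference point (x₀, w₀), so their independence of (x, u) is
  -- built in.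
  have key : ∀ t ∈ I, ∀ x ∈ J, ∀ w ∈ K, ∀ c ∈ admissible, ∀ p1 p2 p3 p5 : ℝ,
      deriv R t * w + deriv (fun s => S s x) t - (R t - deriv τ t) *
        (c 0 * p5 + c 1 * p3 + c 2 * w * p3 + c 3 * w * p1 + c 4 * p1 * p2 + c 5 * w)
      - (deriv a t * x + deriv b t) * p1
      + (Y.2 ((t, x₀, w₀), c) 0 * p5 + c 0 * ((R t - 5 * a t) * p5 + iteratedDeriv 5 (S t) x))
      + (Y.2 ((t, x₀, w₀), c) 1 * p3 + c 1 * ((R t - 3 * a t) * p3 + iteratedDeriv 3 (S t) x))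
      + (Y.2 ((t, x₀, w₀), c) 2 * w * p3 + c 2 * (R t * w + S t x) * p3
        + c 2 * w * ((R t - 3 * a t) * p3 + iteratedDeriv 3 (S t) x))
      + (Y.2 ((t, x₀, w₀), c) 3 * w * p1 + c 3 * (R t * w + S t x) * p1
        + c 3 * w * ((R t - a t) * p1 + iteratedDeriv 1 (S t) x))
      + (Y.2 ((t, x₀, w₀), c) 4 * p1 * p2 + c 4 * ((R t - a t) * p1 + iteratedDeriv 1 (S t) x) * p2
        + c 4 * p1 * ((R t - 2 * a t) * p2 + iteratedDeriv 2 (S t) x))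
      + (Y.2 ((t, x₀, w₀), c) 5 * w + c 5 * (R t * w + S t x)) = 0 := by
    intro t ht x hx w hw c hc p1 p2 p3 p5
    set m := -(c 0 * p5 + c 1 * p3 + c 2 * w * p3 + c 3 * w * p1 + c 4 * p1 * p2 + c 5 * w) with hm
    set u := jetFun (t, x) m (jet w p1 p2 p3 0 p5) with hu
    have hp : (t, x, w) ∈ box I J K := ⟨ht, hx, hw⟩
    have hus : ContDiffAt ℝ ∞ u (t, x) := (contDiff_jetFun _ _ _).contDiffAt
    have h0 : u (t, x) = w := jetFun_self _ _ _
    have h1 : dx u (t, x) = p1 := dx_iterate_jetFun (t, x) _ _ (n := 1) (by norm_num)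
    have hN : ∀ n < 6, dx^[n] u (t, x) = jet w p1 p2 p3 0 p5 n := fun n hn =>
      dx_iterate_jetFun _ _ _ hn
    have ht' : dt u (t, x) = m := by rw [hu, dt_jetFun]
    have hq : (t, x, u (t, x)) ∈ box I J K := by rw [h0]; exact hp
    have H := h.invariant_eq u (t, x) c hus hq hc
      (by rw [hu, lhs_jetFun, hm]; simp only [jet]; ring)
    have hX := zetaX_eq hI hJ hK hv' hSx hus hq
    have hX1 := hX 1
    rw [Function.iterate_one] at hX1
    rw [prolongLhs, zetaT_eq hI hJ hK hv' hτ ha hb hR hSt hus hq, hX 5, hX 3, hX 2, hX1,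
      hN 5 (by norm_num), hN 3 (by norm_num), hN 2 (by norm_num)] at H
    simp only [h0, h1, ht', hη _ hp, jet,
      h.coeff_eq hI hJ hJ' hK hK' hp ⟨ht, hx₀, hw₀⟩ hc] at H
    push_cast at H
    linear_combination H + (R t - deriv τ t) * hm
  have hadm : ∀ e f : ℝ, testCoeff e f 0 ∈ admissible := fun e f =>
    testCoeff_mem_admissible e f 0
  -- For F = 1 and u_x = 0 the coefficient of u_xx is S_x.
  have hS1 : ∀ t ∈ I, ∀ x ∈ J, iteratedDeriv 1 (S t) x = 0 := by
    intro t ht x hx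
    have k := key t ht x hx w₀ hw₀ _ (hadm 0 1) 0
    have k0 := k 0 0 0
    have k1 := k 1 0 0
    have c4 : testCoeff 0 1 0 4 = 1 := rfl
    rw [c4] at k0 k1
    linear_combination k1 - k0
  have hSe : ∀ t ∈ I, ∀ x ∈ J, S t =ᶠ[𝓝 x] fun _ => S t x := by
    intro t ht x hx
    filter_upwards [hJ.mem_nhds hx] with y hy
    refine eq_of_hasDerivAt_zero hJ hJ' (fun z hz => ?_) hy hx
    rw [← hS1 t ht z hz, iteratedDeriv_one]
    exact (((hSx t ht).contDiffAt (hJ.mem_nhds hz)).differentiableAt (by simp)).hasDerivAt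
  have hSn : ∀ t ∈ I, ∀ x ∈ J, ∀ n : ℕ, 0 < n → iteratedDeriv n (S t) x = 0 := by
    intro t ht x hx n hn
    rw [(hSe t ht x hx).iteratedDeriv_eq n, iteratedDeriv_const, if_neg hn.ne']
  -- The coefficient of u_x is affine in u and vanishes at two values. Its constant part then gives
  -- a_t x + b_t = 0 from E = 0 and S = 0 from E = 1.
  have key3 : ∀ t ∈ I, ∀ x ∈ J, ∀ c ∈ admissible,
      Y.2 ((t, x₀, w₀), c) 3 = (a t - deriv τ t - R t) * c 3 ∧
      c 3 * S t x = deriv a t * x + deriv b t := by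
    intro t ht x hx c hc
    have H : ∀ w ∈ K, (Y.2 ((t, x₀, w₀), c) 3 - (a t - deriv τ t - R t) * c 3) * w
        + (c 3 * S t x - (deriv a t * x + deriv b t)) = 0 := by
      intro w hw
      have k0 := key t ht x hx w hw c hc 0 0 0 0
      have k1 := key t ht x hx w hw c hc 1 0 0 0
      rw [hSn t ht x hx 2 (by norm_num)] at k0 k1
      linear_combination k1 - k0
    have H0 := H w₀ hw₀
    have H1 := H w₁ hw₁
    have e : (w₁ - w₀) * (Y.2 ((t, x₀, w₀), c) 3 - (a t - deriv τ t - R t) * c 3) = 0 := by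
      linear_combination H1 - H0
    have e' := (mul_eq_zero.1 e).resolve_left hwne
    rw [e'] at H0
    exact ⟨by linarith, by linarith⟩
  have hab : ∀ t ∈ I, ∀ x ∈ J, deriv a t * x + deriv b t = 0 := by
    intro t ht x hx
    have := (key3 t ht x hx _ (hadm 0 0)).2
    have c3 : testCoeff 0 0 0 3 = 0 := rfl
    rw [c3] at this
    linarith
  have hS0 : ∀ t ∈ I, ∀ x ∈ J, S t x = 0 := by
    intro t ht x hx
    have := (key3 t ht x hx _ (hadm 1 0)).2
    have c3 : testCoeff 1 0 0 3 = 1 := rfl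
    rw [c3, hab t ht x hx] at this
    linarith
  have hSt0 : ∀ t ∈ I, ∀ x ∈ J, deriv (fun s => S s x) t = 0 := by
    intro t ht x hx
    rw [Filter.EventuallyEq.deriv_eq (f := fun _ => (0 : ℝ))]
    · simp
    · filter_upwards [hI.mem_nhds ht] with s hs
      exact hS0 s hs x hx
  have hda : ∀ t ∈ I, deriv a t = 0 := by
    intro t ht
    have e1 := hab t ht x₀ hx₀
    have e2 := hab t ht x₁ hx₁
    exact (mul_eq_zero.1 (show (x₁ - x₀) * deriv a t = 0 by linear_combination e2 - e1)).resolve_left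
      (sub_ne_zero.2 hx₁')
  have hdb : ∀ t ∈ I, deriv b t = 0 := by
    intro t ht
    have e1 := hab t ht x₀ hx₀
    rw [hda t ht] at e1
    linarith
  have hD : ∀ {f : ℝ → ℝ}, ContDiffOn ℝ ∞ f I → ∀ {t}, t ∈ I → HasDerivAt f (deriv f t) t :=
    fun hf t ht => ((hf.contDiffAt (hI.mem_nhds ht)).differentiableAt (by simp)).hasDerivAt
  obtain ⟨t₀, ht₀⟩ := hI₀
  have hac : ∀ t ∈ I, a t = a t₀ := fun t ht => eq_of_hasDerivAt_zero hI hI'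
    (fun s hs => by rw [← hda s hs]; exact hD ha hs) ht ht₀
  have hbc : ∀ t ∈ I, b t = b t₀ := fun t ht => eq_of_hasDerivAt_zero hI hI'
    (fun s hs => by rw [← hdb s hs]; exact hD hb hs) ht ht₀
  refine ⟨a t₀, b t₀, τ, R, hτ, hR, ?_, ?_⟩
  · rintro ⟨t, x, w⟩ hp
    rw [hv' _ hp]
    simp only [genBase, hac _ hp.1, hbc _ hp.1, hS0 _ hp.1 _ hp.2.1, add_zero]
  · rintro ⟨⟨t, x, w⟩, c⟩ ⟨hp, hc⟩
    have ht : t ∈ I := hp.1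
    rw [h.coeff_eq hI hJ hJ' hK hK' hp ⟨ht, hx₀, hw₀⟩ hc, genCoeff_apply, ← hac t ht]
    have k : ∀ w ∈ K, ∀ p1 p2 p3 p5 : ℝ, _ := fun w hw => key t ht x₀ hx₀ w hw c hc
    simp only [hSn t ht x₀ hx₀ 1 (by norm_num), hSn t ht x₀ hx₀ 2 (by norm_num),
      hSn t ht x₀ hx₀ 3 (by norm_num), hSn t ht x₀ hx₀ 5 (by norm_num), hS0 t ht x₀ hx₀,
      hSt0 t ht x₀ hx₀, hda t ht, hdb t ht] at k
    have k0 := fun w hw => k w hw 0 0 0 0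
    have e3 := (key3 t ht x₀ hx₀ c hc).1
    have e0 : Y.2 ((t, x₀, w₀), c) 0 = (5 * a t - deriv τ t) * c 0 := by
      linear_combination k w₀ hw₀ 0 0 0 1 - k0 w₀ hw₀
    have e4 : Y.2 ((t, x₀, w₀), c) 4 = (3 * a t - deriv τ t - R t) * c 4 := by
      linear_combination k w₀ hw₀ 1 1 0 0 - k w₀ hw₀ 1 0 0 0
    -- The coefficient of u_xxx involves ω² and ω³ together; two values of u separate them.
    have H : ∀ w ∈ K, (Y.2 ((t, x₀, w₀), c) 1 - (3 * a t - deriv τ t) * c 1)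
        + (Y.2 ((t, x₀, w₀), c) 2 - (3 * a t - deriv τ t - R t) * c 2) * w = 0 := fun w hw => by
      linear_combination k w hw 0 0 1 0 - k0 w hw
    have e2 : Y.2 ((t, x₀, w₀), c) 2 = (3 * a t - deriv τ t - R t) * c 2 :=
      sub_eq_zero.1 ((mul_eq_zero.1 (show (w₁ - w₀) * (Y.2 ((t, x₀, w₀), c) 2
        - (3 * a t - deriv τ t - R t) * c 2) = 0 by
          linear_combination H w₁ hw₁ - H w₀ hw₀)).resolve_left hwne)
    have e1 : Y.2 ((t, x₀, w₀), c) 1 = (3 * a t - deriv τ t) * c 1 := by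
      linear_combination H w₀ hw₀ - w₀ * e2
    have e5 : Y.2 ((t, x₀, w₀), c) 5 = -deriv τ t * c 5 - deriv R t :=
      sub_eq_zero.1 ((mul_eq_zero.1 (show (w₁ - w₀) * (Y.2 ((t, x₀, w₀), c) 5
        - (-deriv τ t * c 5 - deriv R t)) = 0 by
          linear_combination k0 w₁ hw₁ - k0 w₀ hw₀)).resolve_left hwne)
    ext i
    fin_cases i
    · exact e0
    · exact e1
    · exact e2
    · exact e3
    · exact e4
    · exact e5

end Necessity

section Families

variable {I J K : Set ℝ} {α r : ℝ → ℝ} {k₁ k₂ kr : ℝ} {θ : ℝ → Coeff}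

/-! ### The transformations of the equivalence group as scalings -/

theorem reflection_comp_groupMap (σ₁ σ₂ : ℝ) (α r : ℝ → ℝ) (k₁ k₂ kr : ℝ) :
    reflection σ₁ σ₂ ∘ groupMap α r k₁ k₂ kr =
      scaleMap α (fun t => σ₂ * Real.exp (r t * kr + k₁ / 2)) (σ₁ * Real.exp k₁)
        (σ₁ * k₂ * Real.exp k₁) := by
  ext p
  · rfl
  · simp [reflection, groupMap, scaleMap]; ring
  · simp [reflection, groupMap, scaleMap]; ring

theorem reflection_one_comp (Φ : Base → Base) : reflection 1 1 ∘ Φ = Φ := by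
  ext p <;> simp [reflection]

theorem AdmissibleParams.isScaling (h : AdmissibleParams I α r) {σ₁ σ₂ : ℝ} (h₁ : σ₁ ≠ 0)
    (h₂ : σ₂ ≠ 0) : IsScaling I α (fun t => σ₂ * Real.exp (r t * kr + k₁ / 2))
      (σ₁ * Real.exp k₁) where
  smooth_time := h.1
  deriv_time := h.2.1
  smooth_factor :=
    contDiffOn_const.mul ((h.2.2.mul contDiffOn_const).add contDiffOn_const).exp
  factor_ne := fun _ _ => mul_ne_zero h₂ (Real.exp_ne_zero _)
  scale_ne := mul_ne_zero h₁ (Real.exp_ne_zero _)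

theorem exists_sign {a : ℝ} (ha : a ≠ 0) : ∃ σ : ℝ, (σ = 1 ∨ σ = -1) ∧ 0 < σ * a := by
  rcases ha.lt_or_gt with h | h
  · exact ⟨-1, Or.inr rfl, by linarith⟩
  · exact ⟨1, Or.inl rfl, by linarith⟩

theorem exists_sign_of_ne_zero {R : ℝ → ℝ} (hI' : I.OrdConnected) (hI₀ : I.Nonempty)
    (hR : ContinuousOn R I) (hR0 : ∀ t ∈ I, R t ≠ 0) :
    ∃ σ : ℝ, (σ = 1 ∨ σ = -1) ∧ ∀ t ∈ I, 0 < σ * R t := by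
  obtain ⟨t₀, ht₀⟩ := hI₀
  obtain ⟨σ, hσ, hσ0⟩ := exists_sign (hR0 t₀ ht₀)
  refine ⟨σ, hσ, fun t ht => ?_⟩
  by_contra! hlt
  have hc : ContinuousOn (fun t => σ * R t) I := continuousOn_const.mul hR
  obtain ⟨s, hs, hs0⟩ := ((hI'.isPreconnected.image _ hc).ordConnected).out
    (mem_image_of_mem _ ht) (mem_image_of_mem _ ht₀) ⟨hlt, hσ0.le⟩
  rcases mul_eq_zero.1 hs0 with h | h
  · rcases hσ with rfl | rfl <;> norm_num at h
  · exact hR0 s hs h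

theorem IsScaling.exists_groupMap {R : ℝ → ℝ} {a : ℝ} (h : IsScaling I α R a)
    (hI' : I.OrdConnected) (hI₀ : I.Nonempty) (b : ℝ) :
    ∃ (σ₁ σ₂ : ℝ) (r : ℝ → ℝ) (k₁ k₂ kr : ℝ), (σ₁ = 1 ∨ σ₁ = -1) ∧ (σ₂ = 1 ∨ σ₂ = -1) ∧
      AdmissibleParams I α r ∧
      EqOn (scaleMap α R a b) (reflection σ₁ σ₂ ∘ groupMap α r k₁ k₂ kr) (box I J K) := by
  obtain ⟨σ₁, hσ₁, h₁⟩ := exists_sign h.scale_ne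
  obtain ⟨σ₂, hσ₂, h₂⟩ := exists_sign_of_ne_zero hI' hI₀ h.smooth_factor.continuousOn h.factor_ne
  have q₁ : σ₁ * σ₁ = 1 := by rcases hσ₁ with rfl | rfl <;> norm_num
  have q₂ : σ₂ * σ₂ = 1 := by rcases hσ₂ with rfl | rfl <;> norm_num
  -- Here k₁ = log |a| and k₂ = b/a. The constant k_r is redundant and set to 1; log |R| is lowered
  -- by k₁/2 to compensate for the factor e^{k₁/2} in the group formula.
  refine ⟨σ₁, σ₂, fun t => Real.log (σ₂ * R t) - Real.log (σ₁ * a) / 2, Real.log (σ₁ * a), b / a,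
    1, hσ₁, hσ₂, ⟨h.smooth_time, h.deriv_time,
      ((contDiffOn_const.mul h.smooth_factor).log fun t ht => (h₂ t ht).ne').sub
        contDiffOn_const⟩, ?_⟩
  rintro ⟨t, x, w⟩ hp
  have ha := h.scale_ne
  rw [reflection_comp_groupMap]
  simp only [scaleMap, mul_one, sub_add_cancel, Real.exp_log h₁, Real.exp_log (h₂ t hp.1)]
  refine Prod.ext rfl (Prod.ext ?_ ?_)
  · simp only
    field_simp
    linear_combination -(a * x + b) * q₁
  · simp only
    linear_combination -(R t * w) * q₂

theorem groupMap_orientation (hI : IsOpen I) (hJ : IsOpen J) (hK : IsOpen K) {Φ : Base → Base}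
    {σ₁ σ₂ : ℝ} (hΦ : EqOn Φ (reflection σ₁ σ₂ ∘ groupMap α r k₁ k₂ kr) (box I J K)) {p : Base}
    (hp : p ∈ box I J K) : px (fun z => (Φ z).2.1) p = σ₁ * Real.exp k₁ ∧
      pu (fun z => (Φ z).2.2) p = σ₂ * Real.exp (r p.1 * kr + k₁ / 2) := by
  rw [reflection_comp_groupMap] at hΦ
  have hmem := (isOpen_box hI hJ hK).mem_nhds hp
  obtain ⟨t, x, w⟩ := p
  have cx : ContinuousAt (fun y => ((t, y, w) : Base)) x := by fun_prop
  have cu : ContinuousAt (fun y => ((t, x, y) : Base)) w := by fun_prop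
  constructor
  · have e : HasDerivAt (fun y => σ₁ * Real.exp k₁ * y + σ₁ * k₂ * Real.exp k₁)
        (σ₁ * Real.exp k₁) x := by
      simpa using ((hasDerivAt_id x).const_mul (σ₁ * Real.exp k₁)).add_const (σ₁ * k₂ * Real.exp k₁)
    refine (e.congr_of_eventuallyEq ?_).deriv
    filter_upwards [cx.eventually_mem hmem] with y hy
    rw [hΦ hy]; rfl
  · have e : HasDerivAt (fun y => σ₂ * Real.exp (r t * kr + k₁ / 2) * y)
        (σ₂ * Real.exp (r t * kr + k₁ / 2)) w := by
      simpa using (hasDerivAt_id w).const_mul (σ₂ * Real.exp (r t * kr + k₁ / 2))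
    refine (e.congr_of_eventuallyEq ?_).deriv
    filter_upwards [cu.eventually_mem hmem] with y hy
    rw [hΦ hy]; rfl

/-- The factors `1 *` are the signs in `reflection_comp_groupMap` set to one. The exponent 5k₁/2 is
3k₁ from three x-derivatives minus the k₁/2 carried by u. -/
theorem scaleCoeff_groupMap (hI : IsOpen I) (h : AdmissibleParams I α r) {t : ℝ} (ht : t ∈ I) :
    scaleCoeff α (fun t => 1 * Real.exp (r t * kr + k₁ / 2)) (1 * Real.exp k₁) θ t =
      groupCoeff α r k₁ kr θ t := by
  have hr : HasDerivAt r (deriv r t) t :=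
    ((h.2.2.contDiffAt (hI.mem_nhds ht)).differentiableAt (by simp)).hasDerivAt
  have hα := h.2.1 t ht
  have hd : deriv (fun t => 1 * Real.exp (r t * kr + k₁ / 2)) t =
      Real.exp (r t * kr + k₁ / 2) * (deriv r t * kr) := by
    simpa using (((hr.mul_const kr).add_const (k₁ / 2)).exp.const_mul 1).deriv
  have e5 : Real.exp (5 * k₁) = Real.exp k₁ ^ 5 := by rw [← Real.exp_nat_mul]; norm_num
  have e3 : Real.exp (3 * k₁) = Real.exp k₁ ^ 3 := by rw [← Real.exp_nat_mul]; norm_num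
  have e52 : Real.exp (5 * k₁ / 2 - r t * kr) =
      Real.exp k₁ ^ 3 / Real.exp (r t * kr + k₁ / 2) := by
    rw [← e3, ← Real.exp_sub]; congr 1; ring
  have e12 : Real.exp (k₁ / 2 - r t * kr) = Real.exp k₁ / Real.exp (r t * kr + k₁ / 2) := by
    rw [← Real.exp_sub]; congr 1; ring
  have hn := Real.exp_ne_zero (r t * kr + k₁ / 2)
  rw [scaleCoeff, groupCoeff, hd, e5, e3, e52, e12]
  ext i
  fin_cases i <;> simp <;> field_simp

/-! ### The normalization -/

theorem exists_isTimePrimitive (hI : IsOpen I) (hI' : I.OrdConnected) (hI₀ : I.Nonempty)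
    (hθ : IsClassCoeff I θ) (k₁ : ℝ) : ∃ α : ℝ → ℝ, IsTimePrimitive I θ k₁ α := by
  obtain ⟨t₀, ht₀⟩ := hI₀
  have hc : ContinuousOn (fun t => Real.exp (5 * k₁) * θ t 0) I :=
    continuousOn_const.mul (contDiffOn_pi.1 hθ.1 0).continuousOn
  refine ⟨fun t => ∫ s in t₀..t, Real.exp (5 * k₁) * θ s 0, fun t ht => ?_⟩
  exact intervalIntegral.integral_hasDerivAt_right
    ((hc.mono (hI'.uIcc_subset ht₀ ht)).intervalIntegrable)
    (hc.stronglyMeasurableAtFilter hI t ht) (hc.continuousAt (hI.mem_nhds ht))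

theorem normMap_eq_scaleMap (θ : ℝ → Coeff) (α : ℝ → ℝ) (k₁ k₂ : ℝ) :
    normMap θ α k₁ k₂ = scaleMap α (fun t => Real.exp (-2 * k₁) * θ t 2 / θ t 0) (Real.exp k₁)
      (k₂ * Real.exp k₁) := by
  ext p
  · rfl
  · simp [normMap, scaleMap]; ring
  · rfl

theorem IsTimePrimitive.isScaling (h : IsTimePrimitive I θ k₁ α) (hI : IsOpen I)
    (hθ : IsClassCoeff I θ) :
    IsScaling I α (fun t => Real.exp (-2 * k₁) * θ t 2 / θ t 0) (Real.exp k₁) where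
  smooth_time := by
    refine (contDiffOn_infty_iff_deriv_of_isOpen hI).2
      ⟨fun t ht => (h t ht).differentiableAt.differentiableWithinAt, ?_⟩
    exact ContDiffOn.congr (contDiffOn_const.mul (contDiffOn_pi.1 hθ.1 0)) fun t ht => (h t ht).deriv
  deriv_time := fun t ht => by
    rw [(h t ht).deriv]
    exact mul_ne_zero (Real.exp_ne_zero _) (hθ.2 t ht).1
  smooth_factor := (contDiffOn_const.mul (contDiffOn_pi.1 hθ.1 2)).div (contDiffOn_pi.1 hθ.1 0)
    fun t ht => (hθ.2 t ht).1
  factor_ne := fun t ht =>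
    div_ne_zero (mul_ne_zero (Real.exp_ne_zero _) (hθ.2 t ht).2) (hθ.2 t ht).1
  scale_ne := Real.exp_ne_zero _

/-- Since α_t = e^{5k₁} A and R α_t = e^{3k₁} C, the leading coefficients become 1. The term in Q̃
is the logarithmic derivative -R_t/R, which equals (log |A/C|)_t. -/
theorem IsTimePrimitive.scaleCoeff_eq (h : IsTimePrimitive I θ k₁ α) (hI : IsOpen I)
    (hθ : IsClassCoeff I θ) {t : ℝ} (ht : t ∈ I) :
    scaleCoeff α (fun t => Real.exp (-2 * k₁) * θ t 2 / θ t 0) (Real.exp k₁) θ t =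
      normCoeff θ k₁ t := by
  obtain ⟨hA, hC⟩ := hθ.2 t ht
  have hD : ∀ i, HasDerivAt (fun s => θ s i) (deriv (fun s => θ s i) t) t := fun i =>
    (((contDiffOn_pi.1 hθ.1 i).contDiffAt (hI.mem_nhds ht)).differentiableAt (by simp)).hasDerivAt
  have hR : deriv (fun t => Real.exp (-2 * k₁) * θ t 2 / θ t 0) t =
      (Real.exp (-2 * k₁) * deriv (fun s => θ s 2) t * θ t 0
        - Real.exp (-2 * k₁) * θ t 2 * deriv (fun s => θ s 0) t) / θ t 0 ^ 2 :=
    (((hD 2).const_mul _).fun_div (hD 0) hA).deriv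
  have hL : deriv (fun s => Real.log |θ s 0 / θ s 2|) t =
      (deriv (fun s => θ s 0) t * θ t 2 - θ t 0 * deriv (fun s => θ s 2) t) / θ t 2 ^ 2
        / (θ t 0 / θ t 2) := by
    simp only [Real.log_abs]
    exact (((hD 0).fun_div (hD 2) hC).log (div_ne_zero hA hC)).deriv
  have e5 : Real.exp (5 * k₁) = Real.exp k₁ ^ 5 := by rw [← Real.exp_nat_mul]; norm_num
  have e2 : Real.exp (-2 * k₁) = (Real.exp k₁ ^ 2)⁻¹ := by
    rw [← Real.exp_nat_mul, ← Real.exp_neg]; norm_num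
  have e5' : Real.exp (-5 * k₁) = (Real.exp k₁ ^ 5)⁻¹ := by
    rw [← Real.exp_nat_mul, ← Real.exp_neg]; norm_num
  have hn := Real.exp_ne_zero k₁
  rw [scaleCoeff, normCoeff, hR, hL, (h t ht).deriv, e5, e2, e5']
  ext i
  fin_cases i <;> simp [hA] <;> field_simp
  ring

end Families

end FifthOrderKdV

/-! ### Assembly of the theorem -/

theorem mainTheorem2 (I J K : Set ℝ)
    (hI : IsOpen I) (hI' : I.OrdConnected) (hI₀ : I.Nonempty)
    (hJ : IsOpen J) (hJ' : J.OrdConnected) (hJ₀ : J.Nonempty)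
    (hK : IsOpen K) (hK' : K.OrdConnected) (hK₀ : K.Nonempty) :
    -- the equivalence algebra
    (∀ Y : VectorField, IsEquivalenceGenerator (box I J K) Y ↔
      ∃ Z ∈ generatorSpan I,
        EqOn Y.1 Z.1 (box I J K) ∧ EqOn Y.2 Z.2 (box I J K ×ˢ admissible)) ∧
    -- all equivalence transformations
    (∀ Φ : Base → Base, IsEquivalenceTransformation I J K Φ ↔
      ∃ (σ₁ σ₂ : ℝ) (α r : ℝ → ℝ) (k₁ k₂ kr : ℝ),
        (σ₁ = 1 ∨ σ₁ = -1) ∧ (σ₂ = 1 ∨ σ₂ = -1) ∧ AdmissibleParams I α r ∧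
        EqOn Φ (reflection σ₁ σ₂ ∘ groupMap α r k₁ k₂ kr) (box I J K)) ∧
    -- those that preserve the orientations of `x` and of `u`
    (∀ Φ : Base → Base,
      (IsEquivalenceTransformation I J K Φ ∧
        ∀ p ∈ box I J K, 0 < px (fun z => (Φ z).2.1) p ∧ 0 < pu (fun z => (Φ z).2.2) p) ↔
      ∃ (α r : ℝ → ℝ) (k₁ k₂ kr : ℝ), AdmissibleParams I α r ∧
        EqOn Φ (groupMap α r k₁ k₂ kr) (box I J K)) ∧
    -- the transformation rules for the coefficients
    (∀ (α r : ℝ → ℝ) (k₁ k₂ kr : ℝ) (θ θ' : ℝ → Coeff),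
      AdmissibleParams I α r → IsClassCoeff I θ →
      (MapsEquation (groupMap α r k₁ k₂ kr) (box I J K) θ θ' ↔
        ∀ t ∈ I, θ' (α t) = groupCoeff α r k₁ kr θ t)) ∧
    -- the normalization `A = C = 1`
    (∀ (θ : ℝ → Coeff) (k₁ k₂ : ℝ), IsClassCoeff I θ →
      (∃ α : ℝ → ℝ, IsTimePrimitive I θ k₁ α) ∧
      ∀ α : ℝ → ℝ, IsTimePrimitive I θ k₁ α →
        IsEquivalenceTransformation I J K (normMap θ α k₁ k₂) ∧
        (∃ θ', IsReducedCoeff (α '' I) θ' ∧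
          MapsEquation (normMap θ α k₁ k₂) (box I J K) θ θ') ∧
        ∀ θ' : ℝ → Coeff,
          MapsEquation (normMap θ α k₁ k₂) (box I J K) θ θ' ↔
            ∀ t ∈ I, θ' (α t) = normCoeff θ k₁ t) := by
  have hgroup : ∀ Φ : Base → Base, IsEquivalenceTransformation I J K Φ ↔
      ∃ (σ₁ σ₂ : ℝ) (α r : ℝ → ℝ) (k₁ k₂ kr : ℝ),
        (σ₁ = 1 ∨ σ₁ = -1) ∧ (σ₂ = 1 ∨ σ₂ = -1) ∧ AdmissibleParams I α r ∧
        EqOn Φ (reflection σ₁ σ₂ ∘ groupMap α r k₁ k₂ kr) (box I J K) := by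
    intro Φ
    constructor
    · intro h
      obtain ⟨α, R, a, b, hs, hΦ⟩ := h.exists_scaleMap hI hI' hI₀ hJ hJ' hJ₀ hK hK' hK₀
      obtain ⟨σ₁, σ₂, r, k₁, k₂, kr, h₁, h₂, hp, he⟩ :=
        hs.exists_groupMap (J := J) (K := K) hI' hI₀ b
      exact ⟨σ₁, σ₂, α, r, k₁, k₂, kr, h₁, h₂, hp, hΦ.trans he⟩
    · rintro ⟨σ₁, σ₂, α, r, k₁, k₂, kr, h₁, h₂, hp, he⟩
      have n₁ : σ₁ ≠ 0 := by rcases h₁ with rfl | rfl <;> norm_num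
      have n₂ : σ₂ ≠ 0 := by rcases h₂ with rfl | rfl <;> norm_num
      refine IsEquivalenceTransformation.congr hI hJ hK he.symm ?_
      rw [reflection_comp_groupMap]
      exact (hp.isScaling n₁ n₂).isEquivalenceTransformation hI hI' hJ₀ hK hK₀
  refine ⟨fun Y => ⟨fun h => ?_, ?_⟩, hgroup, fun Φ => ⟨?_, ?_⟩, ?_, ?_⟩
  · obtain ⟨a, b, α, R, hα, hR, h₁, h₂⟩ := h.exists_eqOn hI hI' hI₀ hJ hJ' hJ₀ hK hK' hK₀
    exact ⟨_, exists_mem_generatorSpan a b hα hR, h₁, h₂⟩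
  · rintro ⟨Z, hZ, h₁, h₂⟩
    obtain ⟨a, b, α, R, hα, hR, h⟩ := exists_of_mem_generatorSpan hI hZ
    exact isEquivalenceGenerator_of_eqOn hI hJ hK hα hR
      (fun p hp => (h₁ hp).trans (h p hp.1).1)
      (fun z hz => (h₂ hz).trans ((h z.1 hz.1.1).2 z.2))
  · rintro ⟨h, hpos⟩
    obtain ⟨σ₁, σ₂, α, r, k₁, k₂, kr, h₁, h₂, hp, he⟩ := (hgroup Φ).1 h
    obtain ⟨t, ht⟩ := hI₀
    obtain ⟨x, hx⟩ := hJ₀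
    obtain ⟨w, hw⟩ := hK₀
    have hb : (t, x, w) ∈ box I J K := ⟨ht, hx, hw⟩
    obtain ⟨e₁, e₂⟩ := groupMap_orientation hI hJ hK he hb
    obtain ⟨q₁, q₂⟩ := hpos _ hb
    rw [e₁] at q₁
    rw [e₂] at q₂
    -- The signs are constants, so positivity at a single point of the box excludes -1.
    have s₁ : σ₁ = 1 := h₁.resolve_right fun h0 => by
      have := Real.exp_pos k₁
      rw [h0] at q₁
      linarith
    have s₂ : σ₂ = 1 := h₂.resolve_right fun h0 => by
      have := Real.exp_pos (r t * kr + k₁ / 2)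
      rw [h0] at q₂
      simp only at q₂
      linarith
    rw [s₁, s₂, reflection_one_comp] at he
    exact ⟨α, r, k₁, k₂, kr, hp, he⟩
  · rintro ⟨α, r, k₁, k₂, kr, hp, he⟩
    rw [← reflection_one_comp (groupMap α r k₁ k₂ kr)] at he
    refine ⟨(hgroup Φ).2 ⟨1, 1, α, r, k₁, k₂, kr, Or.inl rfl, Or.inl rfl, hp, he⟩,
      fun p hb => ?_⟩
    obtain ⟨e₁, e₂⟩ := groupMap_orientation hI hJ hK he hb
    rw [e₁, e₂]
    constructor <;> positivity
  · intro α r k₁ k₂ kr θ θ' hp _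
    rw [← reflection_one_comp (groupMap α r k₁ k₂ kr), reflection_comp_groupMap,
      (hp.isScaling one_ne_zero one_ne_zero).mapsEquation_iff hI hJ₀ hK hK₀]
    exact forall₂_congr fun t ht => by rw [scaleCoeff_groupMap hI hp ht]
  · intro θ k₁ k₂ hθ
    refine ⟨exists_isTimePrimitive hI hI' hI₀ hθ k₁, fun α hα => ?_⟩
    have hs := hα.isScaling hI hθ
    have hiff : ∀ θ' : ℝ → Coeff, MapsEquation (normMap θ α k₁ k₂) (box I J K) θ θ' ↔
        ∀ t ∈ I, θ' (α t) = normCoeff θ k₁ t := fun θ' => by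
      rw [normMap_eq_scaleMap, hs.mapsEquation_iff hI hJ₀ hK hK₀]
      exact forall₂_congr fun t ht => by rw [hα.scaleCoeff_eq hI hθ ht]
    refine ⟨?_, ?_, hiff⟩
    · rw [normMap_eq_scaleMap]
      exact hs.isEquivalenceTransformation hI hI' hJ₀ hK hK₀
    · obtain ⟨θ', h₁, h₂⟩ := hs.exists_coeff hI hI' hθ
      have h₃ : ∀ t ∈ I, θ' (α t) = normCoeff θ k₁ t := fun t ht => by
        rw [h₂ t ht, hα.scaleCoeff_eq hI hθ ht]
      refine ⟨θ', ⟨h₁, ?_⟩, (hiff θ').2 h₃⟩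
      rintro _ ⟨t, ht, rfl⟩
      rw [h₃ t ht]
      exact ⟨rfl, rfl⟩
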